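/- Let $M$ be a smooth $n$-dimensional manifold and $(\mathcal E,\phi,\nabla^{\mathcal E})$ a (smooth) coherent tangent bundle over $M$: $\mathcal E\to M$ is a real vector bundle of rank $n$, $\phi:TM\to\mathcal E$ is a bundle map over $\mathrm{id}_M$ (its rank may vary from point to point), and $\nabla^{\mathcal E}$ is a connection on $\mathcal E$ that is relatively torsion-free with respect to $\phi$, i.e. $$\nabla^{\mathcal E}_X\phi(Y)-\nabla^{\mathcal E}_Y\phi(X)-\phi([X,Y])=0\qquad (X,Y\in\Gamma(TM)).$$ Let $R(X,Y)\eta=\nabla^{\mathcal E}_X\nabla^{\mathcal E}_Y\eta-\nabla^{\mathcal E}_Y\nabla^{\mathcal E}_X\eta-\nabla^{\mathcal E}_{[X,Y]}\eta$ be its curvature. Two relatively torsion-free connections $\nabla,\widehat\nabla$ on $\mathcal E$ (over an open set) are called projectively equivalent with respect to $\phi$ if there is a section $\rho$ of $\mathcal E^*$ with $\widehat\nabla_X\eta=\nabla_X\eta+\rho(\phi(X))\,\eta+\rho(\eta)\,\phi(X)$ for all $X,\eta$; and $(\mathcal E,\phi,\nabla^{\mathcal E})$ is called projectively flat if every point of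 $M$ has an open neighbourhood on which $\nabla^{\mathcal E}$ is projectively equivalent with respect to $\phi$ to a connection with vanishing curvature. Assume that $\operatorname{rank}\phi\ge 3$ almost everywhere, i.e. outside a set of measure zero in charts. 1. Suppose that $\operatorname{tr}\{\eta\mapsto R(X,Y)\eta\}=0$ for all $X,Y\in\Gamma(TM)$. Then the following are equivalent: (i) $(\mathcal E,\phi,\nabla^{\mathcal E})$ is projectively flat; (ii) there is a tensor field $A\in\Gamma(T^*M\otimes\mathcal E^*)$ such that for all $X,Y\in\Gamma(TM)$, $\eta\in\Gamma(\mathcal E)$ $$R(X,Y)\eta=\frac1{n-1}\{A(Y,\eta)\phi(X)-A(X,\eta)\phi(Y)\}.\qquad(*)$$ 2. Every tensor field $A\in\Gamma(T^*M\otimes\mathcal E^*)$ satisfying $(*)$ automatically satisfies $$XA(Y,\eta)-YA(X,\eta)-A([X,Y],\eta)=A(Y,\nabla^{\mathcal E}_X\eta)-A(X,\nabla^{\mathcal E}_Y\eta)$$ for all $X,Y\in\Gamma(TM)$ and $\eta\in\Gamma(\mathcal E)$. -/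

import Mathlib

open Bundle Set Topology
open scoped Manifold ContDiff

namespace CoherentTB

noncomputable section

section SmoothObjects

variable {n : ℕ} {M : Type*} [TopologicalSpace M]
  [ChartedSpace (EuclideanSpace ℝ (Fin n)) M]

/-- A set is null if every chart of the atlas maps it to a set of Lebesgue measure zero. -/
def IsNull (n : ℕ) {M : Type*} [TopologicalSpace M]
    [ChartedSpace (EuclideanSpace ℝ (Fin n)) M] (S : Set M) : Prop :=
  ∀ e ∈ atlas (EuclideanSpace ℝ (Fin n)) M, MeasureTheory.volume (e '' (S ∩ e.source)) = 0

/-- The derivative `X f` of a function in the direction of a vector field. -/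
def dirDeriv (X : Π x : M, TangentSpace (𝓡 n) x) (f : M → ℝ) (x : M) : ℝ :=
  mvfderiv (𝓡 n) f x (X x)

variable [IsManifold (𝓡 n) ∞ M]

/-- `X` is a smooth vector field on `U` (its values off `U` are irrelevant). -/
def SmoothVectorFieldOn (X : Π x : M, TangentSpace (𝓡 n) x) (U : Set M) : Prop :=
  ContMDiffOn (𝓡 n) (𝓡 n).tangent ∞
    (fun x ↦ (⟨x, X x⟩ : TangentBundle (𝓡 n) M)) U

variable (F : Type*) [NormedAddCommGroup F] [NormedSpace ℝ F]
  {V : M → Type*} [TopologicalSpace (TotalSpace F V)]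
  [∀ x, AddCommGroup (V x)] [∀ x, Module ℝ (V x)] [∀ x, TopologicalSpace (V x)]
  [∀ x, IsTopologicalAddGroup (V x)] [∀ x, ContinuousSMul ℝ (V x)]
  [FiberBundle F V] [VectorBundle ℝ F V]

variable (n) in
/-- `η` is a smooth section of the bundle `V` on `U` (its values off `U` are irrelevant). -/
def SmoothSectionOn (η : Π x : M, V x) (U : Set M) : Prop :=
  ContMDiffOn (𝓡 n) ((𝓡 n).prod 𝓘(ℝ, F)) ∞ (fun x ↦ TotalSpace.mk' F x (η x)) U

variable (n) in
/-- `ρ` is a smooth section of the dual bundle `V*` on `U`. -/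
def SmoothDualSectionOn (ρ : Π x : M, V x →L[ℝ] ℝ) (U : Set M) : Prop :=
  ContMDiffOn (𝓡 n) ((𝓡 n).prod 𝓘(ℝ, F →L[ℝ] ℝ)) ∞
    (fun x ↦ TotalSpace.mk' (F →L[ℝ] ℝ)
      (E := fun y : M ↦ V y →L[ℝ] Bundle.Trivial M ℝ y) x (ρ x)) U

/-- `φ` is a smooth bundle map `TM → V` over the identity; its rank may vary. -/
def SmoothBundleMap (φ : Π x : M, TangentSpace (𝓡 n) x →L[ℝ] V x) : Prop :=
  ContMDiff (𝓡 n) ((𝓡 n).prod 𝓘(ℝ, EuclideanSpace ℝ (Fin n) →L[ℝ] F)) ∞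
    (fun x ↦ TotalSpace.mk' (EuclideanSpace ℝ (Fin n) →L[ℝ] F)
      (E := fun y : M ↦ TangentSpace (𝓡 n) y →L[ℝ] V y) x (φ x))

/-- `A` is a smooth section of `T*M ⊗ V*`, i.e. a smooth field of bilinear forms
`A x : T_x M × V x → ℝ`. -/
def SmoothTensor (A : Π x : M, TangentSpace (𝓡 n) x →L[ℝ] V x →L[ℝ] ℝ) : Prop :=
  ContMDiff (𝓡 n) ((𝓡 n).prod 𝓘(ℝ, EuclideanSpace ℝ (Fin n) →L[ℝ] F →L[ℝ] ℝ)) ∞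
    (fun x ↦ TotalSpace.mk' (EuclideanSpace ℝ (Fin n) →L[ℝ] F →L[ℝ] ℝ)
      (E := fun y : M ↦ TangentSpace (𝓡 n) y →L[ℝ] V y →L[ℝ] Bundle.Trivial M ℝ y) x (A x))

/-- `nabla` is a smooth connection on the restriction of `V` to the open set `U`;
`nabla η x (X x)` is the value `(∇_X η)(x)`. -/
structure IsSmoothConnectionOn
    (nabla : (Π x : M, V x) → (Π x : M, TangentSpace (𝓡 n) x →L[ℝ] V x)) (U : Set M) :
    Prop where
  isCovariantDerivativeOn : IsCovariantDerivativeOn F nabla U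
  smooth : ContMDiffCovariantDerivativeOn F ∞ nabla U

end SmoothObjects

section Curvature

variable {n : ℕ} {M : Type*} [TopologicalSpace M]
  [ChartedSpace (EuclideanSpace ℝ (Fin n)) M]
  {V : M → Type*}
  [∀ x, AddCommGroup (V x)] [∀ x, Module ℝ (V x)] [∀ x, TopologicalSpace (V x)]

/-- The curvature `R(X,Y)η = ∇_X ∇_Y η - ∇_Y ∇_X η - ∇_[X,Y] η`. -/
def curvature (nabla : (Π x : M, V x) → (Π x : M, TangentSpace (𝓡 n) x →L[ℝ] V x))
    (X Y : Π x : M, TangentSpace (𝓡 n) x) (η : Π x : M, V x) (x : M) : V x :=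
  nabla (fun y ↦ nabla η y (Y y)) x (X x) - nabla (fun y ↦ nabla η y (X y)) x (Y x)
    - nabla η x (VectorField.mlieBracket (𝓡 n) X Y x)

/-- The endomorphism `η ↦ R(X,Y)η` of the fibre `V x`. It is defined on a basis of `V x` that
is extended to the local frame of a trivialization; `curvatureEnd_apply` below shows that it
sends `η x` to `(R(X,Y)η)(x)` for every smooth section `η`. -/
def curvatureEnd (F : Type*) [NormedAddCommGroup F] [NormedSpace ℝ F]
    [TopologicalSpace (TotalSpace F V)] [FiberBundle F V] [VectorBundle ℝ F V]
    (nabla : (Π x : M, V x) → (Π x : M, TangentSpace (𝓡 n) x →L[ℝ] V x))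
    (X Y : Π x : M, TangentSpace (𝓡 n) x) (x : M) : V x →ₗ[ℝ] V x :=
  ((trivializationAt F V x).basisAt (Module.Basis.ofVectorSpace ℝ F)
      (FiberBundle.mem_baseSet_trivializationAt F V x)).constr ℝ
    (fun i ↦ curvature nabla X Y
      ((trivializationAt F V x).localFrame (Module.Basis.ofVectorSpace ℝ F) i) x)

end Curvature

section Tensoriality

set_option linter.unusedSectionVars false

variable {n : ℕ} {M : Type*} [TopologicalSpace M]
  [ChartedSpace (EuclideanSpace ℝ (Fin n)) M] [IsManifold (𝓡 n) ∞ M]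
  {F : Type*} [NormedAddCommGroup F] [NormedSpace ℝ F]
  {V : M → Type*} [TopologicalSpace (TotalSpace F V)]
  [∀ x, AddCommGroup (V x)] [∀ x, Module ℝ (V x)] [∀ x, TopologicalSpace (V x)]
  [∀ x, IsTopologicalAddGroup (V x)] [∀ x, ContinuousSMul ℝ (V x)]
  [FiberBundle F V] [VectorBundle ℝ F V]

lemma mdiff_of_eventually {σ : Π x : M, V x} {x : M}
    (h : ContMDiffAt (𝓡 n) ((𝓡 n).prod 𝓘(ℝ, F)) ∞ (fun x ↦ TotalSpace.mk' F x (σ x)) x) :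
    MDifferentiableAt (𝓡 n) ((𝓡 n).prod 𝓘(ℝ, F)) (fun x ↦ TotalSpace.mk' F x (σ x)) x :=
  h.mdifferentiableAt (by simp)

variable [T2Space M] [ContMDiffVectorBundle ∞ F V (𝓡 n)]

lemma exists_cutoff {σ : Π x : M, V x} {x : M}
    (h : ∀ᶠ y in 𝓝 x, ContMDiffAt (𝓡 n) ((𝓡 n).prod 𝓘(ℝ, F)) ∞
      (fun x ↦ TotalSpace.mk' F x (σ x)) y) :
    ∃ σ' : Π x : M, V x, SmoothSectionOn n F σ' univ ∧ ∀ᶠ y in 𝓝 x, σ' y = σ y := by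
  obtain ⟨W, hW, hWo, hxW⟩ := eventually_nhds_iff.1 h
  obtain ⟨ψ, -, hψ⟩ := (SmoothBumpFunction.nhds_basis_tsupport (I := 𝓡 n) x).mem_iff.1
    (hWo.mem_nhds hxW)
  refine ⟨(ψ : M → ℝ) • σ, ?_, ?_⟩
  · exact (ContMDiffOn.smul_section_of_tsupport (u := W) (ψ.contMDiff.contMDiffOn) hWo hψ
      (fun y hy ↦ (hW y hy).contMDiffWithinAt)).contMDiffOn
  · filter_upwards [ψ.eventuallyEq_one] with y hy
    simp [hy]

variable {nabla : (Π x : M, V x) → (Π x : M, TangentSpace (𝓡 n) x →L[ℝ] V x)}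

lemma contMDiffAt_nabla (hn : IsSmoothConnectionOn F nabla univ) {σ : Π x : M, V x} {x : M}
    (h : ∀ᶠ y in 𝓝 x, ContMDiffAt (𝓡 n) ((𝓡 n).prod 𝓘(ℝ, F)) ∞
      (fun x ↦ TotalSpace.mk' F x (σ x)) y)
    {X : Π x : M, TangentSpace (𝓡 n) x} (hX : SmoothVectorFieldOn X univ) :
    ContMDiffAt (𝓡 n) ((𝓡 n).prod 𝓘(ℝ, F)) ∞
      (fun y ↦ TotalSpace.mk' F y (nabla σ y (X y))) x := by
  obtain ⟨σ', h', he⟩ := exists_cutoff h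
  have h1 := hn.smooth.contMDiff (σ := σ') h'
  have h2 := ContMDiffOn.clm_bundle_apply (b := id) h1 hX
  have h3 : ContMDiffAt (𝓡 n) ((𝓡 n).prod 𝓘(ℝ, F)) ∞
      (fun y ↦ TotalSpace.mk' F y (nabla σ' y (X y))) x := h2.contMDiffAt Filter.univ_mem
  refine h3.congr_of_eventuallyEq ?_
  filter_upwards [h, he.eventually_nhds] with y hy hy'
  rw [hn.isCovariantDerivativeOn.congr_of_eventuallyEq (mdiff_of_eventually hy)
    (mdiff_of_eventually (h'.contMDiffAt Filter.univ_mem)) Filter.univ_mem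
    (hy'.mono fun _ h ↦ h.symm)]

lemma curvature_congr (hn : IsSmoothConnectionOn F nabla univ) {σ τ : Π x : M, V x} {x : M}
    (hσ : ∀ᶠ y in 𝓝 x, ContMDiffAt (𝓡 n) ((𝓡 n).prod 𝓘(ℝ, F)) ∞
      (fun x ↦ TotalSpace.mk' F x (σ x)) y)
    (hτ : ∀ᶠ y in 𝓝 x, ContMDiffAt (𝓡 n) ((𝓡 n).prod 𝓘(ℝ, F)) ∞
      (fun x ↦ TotalSpace.mk' F x (τ x)) y)
    (h : ∀ᶠ y in 𝓝 x, σ y = τ y)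
    {X Y : Π x : M, TangentSpace (𝓡 n) x} (hX : SmoothVectorFieldOn X univ)
    (hY : SmoothVectorFieldOn Y univ) :
    curvature nabla X Y σ x = curvature nabla X Y τ x := by
  have key : ∀ᶠ y in 𝓝 x, nabla σ y = nabla τ y := by
    filter_upwards [hσ, hτ, h.eventually_nhds] with y h1 h2 h3
    exact hn.isCovariantDerivativeOn.congr_of_eventuallyEq (mdiff_of_eventually h1)
      (mdiff_of_eventually h2) Filter.univ_mem h3
  have aux : ∀ Z : Π x : M, TangentSpace (𝓡 n) x, SmoothVectorFieldOn Z univ →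
      nabla (fun y ↦ nabla σ y (Z y)) x = nabla (fun y ↦ nabla τ y (Z y)) x := fun Z hZ ↦
    hn.isCovariantDerivativeOn.congr_of_eventuallyEq
      (mdiff_of_eventually (contMDiffAt_nabla hn hσ hZ))
      (mdiff_of_eventually (contMDiffAt_nabla hn hτ hZ)) Filter.univ_mem
      (key.mono fun y hy ↦ by rw [hy])
  simp only [curvature, aux X hX, aux Y hY, key.self_of_nhds]

lemma curvature_add (hn : IsSmoothConnectionOn F nabla univ) {σ τ : Π x : M, V x} {x : M}
    (hσ : ∀ᶠ y in 𝓝 x, ContMDiffAt (𝓡 n) ((𝓡 n).prod 𝓘(ℝ, F)) ∞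
      (fun x ↦ TotalSpace.mk' F x (σ x)) y)
    (hτ : ∀ᶠ y in 𝓝 x, ContMDiffAt (𝓡 n) ((𝓡 n).prod 𝓘(ℝ, F)) ∞
      (fun x ↦ TotalSpace.mk' F x (τ x)) y)
    {X Y : Π x : M, TangentSpace (𝓡 n) x} (hX : SmoothVectorFieldOn X univ)
    (hY : SmoothVectorFieldOn Y univ) :
    curvature nabla X Y (σ + τ) x = curvature nabla X Y σ x + curvature nabla X Y τ x := by
  have hc := hn.isCovariantDerivativeOn
  have hst : ∀ᶠ y in 𝓝 x, ContMDiffAt (𝓡 n) ((𝓡 n).prod 𝓘(ℝ, F)) ∞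
      (fun x ↦ TotalSpace.mk' F x ((σ + τ) x)) y := by
    filter_upwards [hσ, hτ] with y h1 h2
    exact h1.add_section h2
  have key : ∀ᶠ y in 𝓝 x, nabla (σ + τ) y = nabla σ y + nabla τ y := by
    filter_upwards [hσ, hτ] with y h1 h2
    exact hc.add (mdiff_of_eventually h1) (mdiff_of_eventually h2)
  have aux : ∀ Z : Π x : M, TangentSpace (𝓡 n) x, SmoothVectorFieldOn Z univ →
      nabla (fun y ↦ nabla (σ + τ) y (Z y)) x =
        nabla (fun y ↦ nabla σ y (Z y)) x + nabla (fun y ↦ nabla τ y (Z y)) x := fun Z hZ ↦ by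
    have h1 := contMDiffAt_nabla hn hσ hZ
    have h2 := contMDiffAt_nabla hn hτ hZ
    rw [← hc.add (mdiff_of_eventually h1) (mdiff_of_eventually h2)]
    exact hc.congr_of_eventuallyEq
      (mdiff_of_eventually (contMDiffAt_nabla hn hst hZ))
      (mdiff_of_eventually (h1.add_section h2)) Filter.univ_mem
      (key.mono fun y hy ↦ by simp [hy])
  simp only [curvature, aux X hX, aux Y hY, key.self_of_nhds, add_apply]
  abel


lemma contMDiffAt_dirDeriv {f : M → ℝ} {x : M} (hf : ContMDiffAt (𝓡 n) 𝓘(ℝ, ℝ) ∞ f x)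
    {X : Π x : M, TangentSpace (𝓡 n) x} (hX : SmoothVectorFieldOn X univ) :
    ContMDiffAt (𝓡 n) 𝓘(ℝ, ℝ) ∞ (dirDeriv X f) x := by
  have h1 := hf.mfderiv_const (m := ∞) (by simp)
  have h2 : ContMDiffAt (𝓡 n) (𝓡 n).tangent ∞
    (fun x ↦ (⟨x, X x⟩ : TangentBundle (𝓡 n) M)) x := hX.contMDiffAt Filter.univ_mem
  have h3 := ContMDiffAt.clm_apply_of_inCoordinates (b₁ := id) (b₂ := f) h1 h2 hf
  exact (contMDiff_snd_tangentBundle_modelSpace ℝ 𝓘(ℝ, ℝ)).contMDiffAt.comp x h3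

/-- `X(Yf) - Y(Xf) = [X,Y]f`. -/
lemma bracket_dirDeriv {f : M → ℝ} {x : M}
    (hf : ∀ᶠ y in 𝓝 x, ContMDiffAt (𝓡 n) 𝓘(ℝ, ℝ) ∞ f y)
    {X Y : Π x : M, TangentSpace (𝓡 n) x} (hX : SmoothVectorFieldOn X univ)
    (hY : SmoothVectorFieldOn Y univ) :
    dirDeriv X (dirDeriv Y f) x - dirDeriv Y (dirDeriv X f) x =
      dirDeriv (VectorField.mlieBracket (𝓡 n) X Y) f x := by
  by_cases hz : VectorField.mlieBracket (𝓡 n) X Y x = 0 ∧ X x = 0 ∧ Y x = 0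
  · simp [dirDeriv, hz.1, hz.2.1, hz.2.2]
  have : ∃ w : TangentSpace (𝓡 n) x, w ≠ 0 := by
    by_contra! h
    exact hz ⟨h _, h _, h _⟩
  obtain ⟨w, hw⟩ := this
  have : IsManifold (𝓡 n) (minSmoothness ℝ 3) M := by
    rw [minSmoothness_of_isRCLikeNormedField]; infer_instance
  have : IsManifold (𝓡 n) (((⊤ : ℕ∞) : WithTop ℕ∞) + 1) M := by
    simpa using (inferInstance : IsManifold (𝓡 n) ∞ M)
  let W := FiberBundle.extend (EuclideanSpace ℝ (Fin n)) w
  have hW : ∀ᶠ y in 𝓝 x, ContMDiffAt (𝓡 n) (𝓡 n).tangent ∞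
      (fun y ↦ (⟨y, W y⟩ : TangentBundle (𝓡 n) M)) y := by
    obtain ⟨s, hs, hsW⟩ := FiberBundle.exists_contMDiffOn_extend (k := ∞) (𝓡 n)
      (EuclideanSpace ℝ (Fin n)) (V := fun y : M ↦ TangentSpace (𝓡 n) y) w
    filter_upwards [eventually_mem_nhds_iff.2 hs] with y hy
    exact hsW.contMDiffAt hy
  have hX' : ∀ y, ContMDiffAt (𝓡 n) (𝓡 n).tangent ∞
      (fun y ↦ (⟨y, X y⟩ : TangentBundle (𝓡 n) M)) y := fun y ↦ hX.contMDiffAt Filter.univ_mem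
  have hY' : ∀ y, ContMDiffAt (𝓡 n) (𝓡 n).tangent ∞
      (fun y ↦ (⟨y, Y y⟩ : TangentBundle (𝓡 n) M)) y := fun y ↦ hY.contMDiffAt Filter.univ_mem
  have brk : ∀ {A B : Π x : M, TangentSpace (𝓡 n) x} {y : M}, ContMDiffAt (𝓡 n) (𝓡 n).tangent ∞
      (fun y ↦ (⟨y, A y⟩ : TangentBundle (𝓡 n) M)) y → ContMDiffAt (𝓡 n) (𝓡 n).tangent ∞
      (fun y ↦ (⟨y, B y⟩ : TangentBundle (𝓡 n) M)) y → ContMDiffAt (𝓡 n) (𝓡 n).tangent ∞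
      (fun y ↦ (⟨y, VectorField.mlieBracket (𝓡 n) A B y⟩ : TangentBundle (𝓡 n) M)) y :=
    fun hA hB ↦ hA.mlieBracket_vectorField (m := ⊤) (n := ⊤) hB (by simp)
  have dd : ∀ {Z : Π x : M, TangentSpace (𝓡 n) x} {y : M}, ContMDiffAt (𝓡 n) (𝓡 n).tangent ∞
      (fun y ↦ (⟨y, Z y⟩ : TangentBundle (𝓡 n) M)) y → MDifferentiableAt (𝓡 n) (𝓡 n).tangent
      (fun y ↦ (⟨y, Z y⟩ : TangentBundle (𝓡 n) M)) y := fun h ↦ h.mdifferentiableAt (by simp)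
  have df : ∀ {g : M → ℝ} {y : M}, ContMDiffAt (𝓡 n) 𝓘(ℝ, ℝ) ∞ g y →
      MDifferentiableAt (𝓡 n) 𝓘(ℝ, ℝ) g y := fun h ↦ h.mdifferentiableAt (by simp)
  have hWx := hW.self_of_nhds
  have hfx := hf.self_of_nhds
  have two : ∀ A B : Π x : M, TangentSpace (𝓡 n) x, SmoothVectorFieldOn A univ →
      SmoothVectorFieldOn B univ →
      VectorField.mlieBracket (𝓡 n) A (VectorField.mlieBracket (𝓡 n) B (f • W)) x =
        dirDeriv A (dirDeriv B f) x • W x + dirDeriv B f x • VectorField.mlieBracket (𝓡 n) A W x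
        + (dirDeriv A f x • VectorField.mlieBracket (𝓡 n) B W x
          + f x • VectorField.mlieBracket (𝓡 n) A (VectorField.mlieBracket (𝓡 n) B W) x) := by
    intro A B hA hB
    have hB' : ContMDiffAt (𝓡 n) (𝓡 n).tangent ∞
      (fun y ↦ (⟨y, B y⟩ : TangentBundle (𝓡 n) M)) x := hB.contMDiffAt Filter.univ_mem
    have e1 : VectorField.mlieBracket (𝓡 n) B (f • W) =ᶠ[𝓝 x]
        (dirDeriv B f • W + f • VectorField.mlieBracket (𝓡 n) B W) := by
      filter_upwards [hf, hW] with y h1 h2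
      exact VectorField.mlieBracket_smul_right (df h1) (dd h2)
    have h3 := df (contMDiffAt_dirDeriv hfx hB)
    refine (Filter.EventuallyEq.mlieBracket_vectorField_eq
      (Filter.EventuallyEq.refl (𝓝 x) A) e1).trans ?_
    rw [VectorField.mlieBracket_add_right (h3.smul_section (dd hWx))
        ((df hfx).smul_section (dd (brk hB' hWx))),
      VectorField.mlieBracket_smul_right h3 (dd hWx),
      VectorField.mlieBracket_smul_right (df hfx) (dd (brk hB' hWx))]
    rfl
  have hms : minSmoothness ℝ 2 ≤ (∞ : WithTop ℕ∞) := by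
    rw [minSmoothness_of_isRCLikeNormedField]; exact WithTop.coe_le_coe.2 (le_top : (2 : ℕ∞) ≤ ⊤)
  have J1 := VectorField.leibniz_identity_mlieBracket_apply ((hX' x).of_le hms)
    ((hY' x).of_le hms) ((hfx.smul_section hWx).of_le hms)
  have J2 := VectorField.leibniz_identity_mlieBracket_apply ((hX' x).of_le hms)
    ((hY' x).of_le hms) (hWx.of_le hms)
  rw [two X Y hX hY, two Y X hY hX, VectorField.mlieBracket_smul_right (df hfx) (dd hWx), J2] at J1
  change _ = dirDeriv (VectorField.mlieBracket (𝓡 n) X Y) f x • W x + _ + _ at J1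
  have hWw : W x = w := FiberBundle.extend_apply_self _ _
  have : (dirDeriv X (dirDeriv Y f) x - dirDeriv Y (dirDeriv X f) x -
      dirDeriv (VectorField.mlieBracket (𝓡 n) X Y) f x) • w = 0 := by
    rw [← hWw]
    rw [← sub_eq_zero] at J1
    rw [← J1]
    module
  exact sub_eq_zero.1 ((smul_eq_zero.1 this).resolve_right hw)

lemma curvature_smul (hn : IsSmoothConnectionOn F nabla univ) {f : M → ℝ} {σ : Π x : M, V x}
    {x : M} (hf : ∀ᶠ y in 𝓝 x, ContMDiffAt (𝓡 n) 𝓘(ℝ, ℝ) ∞ f y)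
    (hσ : ∀ᶠ y in 𝓝 x, ContMDiffAt (𝓡 n) ((𝓡 n).prod 𝓘(ℝ, F)) ∞
      (fun x ↦ TotalSpace.mk' F x (σ x)) y)
    {X Y : Π x : M, TangentSpace (𝓡 n) x} (hX : SmoothVectorFieldOn X univ)
    (hY : SmoothVectorFieldOn Y univ) :
    curvature nabla X Y (f • σ) x = f x • curvature nabla X Y σ x := by
  have hc := hn.isCovariantDerivativeOn
  have df : ∀ {g : M → ℝ} {y : M}, ContMDiffAt (𝓡 n) 𝓘(ℝ, ℝ) ∞ g y →
      MDifferentiableAt (𝓡 n) 𝓘(ℝ, ℝ) g y := fun h ↦ h.mdifferentiableAt (by simp)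
  have hst : ∀ᶠ y in 𝓝 x, ContMDiffAt (𝓡 n) ((𝓡 n).prod 𝓘(ℝ, F)) ∞
      (fun x ↦ TotalSpace.mk' F x ((f • σ) x)) y := by
    filter_upwards [hf, hσ] with y h1 h2
    exact h1.smul_section h2
  have hfx := hf.self_of_nhds
  have hσx := hσ.self_of_nhds
  have aux : ∀ Z Z' : Π x : M, TangentSpace (𝓡 n) x, SmoothVectorFieldOn Z univ →
      nabla (fun y ↦ nabla (f • σ) y (Z y)) x (Z' x) =
        f x • nabla (fun y ↦ nabla σ y (Z y)) x (Z' x) + dirDeriv Z' f x • nabla σ x (Z x)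
        + (dirDeriv Z f x • nabla σ x (Z' x) + dirDeriv Z' (dirDeriv Z f) x • σ x) := by
    intro Z Z' hZ
    have h1 := contMDiffAt_nabla hn hσ hZ
    have h2 := contMDiffAt_dirDeriv hfx hZ
    have e : nabla (fun y ↦ nabla (f • σ) y (Z y)) x =
        nabla (f • (fun y ↦ nabla σ y (Z y)) + dirDeriv Z f • σ) x := by
      refine hc.congr_of_eventuallyEq
        (mdiff_of_eventually (contMDiffAt_nabla hn hst hZ))
        (mdiff_of_eventually ((hfx.smul_section h1).add_section (h2.smul_section hσx)))
        Filter.univ_mem ?_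
      filter_upwards [hf, hσ] with y h3 h4
      rw [hc.leibniz (mdiff_of_eventually h4) (df h3)]
      rfl
    rw [e, hc.add (mdiff_of_eventually (hfx.smul_section h1))
      (mdiff_of_eventually (h2.smul_section hσx)), hc.leibniz (mdiff_of_eventually h1) (df hfx),
      hc.leibniz (mdiff_of_eventually hσx) (df h2)]
    rfl
  have hb := bracket_dirDeriv hf hX hY
  have e3 : nabla (f • σ) x (VectorField.mlieBracket (𝓡 n) X Y x) =
      f x • nabla σ x (VectorField.mlieBracket (𝓡 n) X Y x)
      + dirDeriv (VectorField.mlieBracket (𝓡 n) X Y) f x • σ x := by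
    rw [hc.leibniz (mdiff_of_eventually hσx) (df hfx)]; rfl
  rw [curvature, aux Y X hY, aux X Y hX, e3, ← hb, curvature]
  module

/-- `curvatureEnd` is the endomorphism `η ↦ R(X,Y)η`, for every smooth section `η`. -/
lemma curvatureEnd_apply [FiniteDimensional ℝ F] (hn : IsSmoothConnectionOn F nabla univ)
    {X Y : Π x : M, TangentSpace (𝓡 n) x} {η : Π x : M, V x} (hX : SmoothVectorFieldOn X univ)
    (hY : SmoothVectorFieldOn Y univ) (hη : SmoothSectionOn n F η univ) (x : M) :
    curvatureEnd F nabla X Y x (η x) = curvature nabla X Y η x := by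
  classical
  set t := trivializationAt F V x with ht
  set b := Module.Basis.ofVectorSpace ℝ F with hb
  have hx : x ∈ t.baseSet := FiberBundle.mem_baseSet_trivializationAt F V x
  have hs : ∀ i, ∀ᶠ y in 𝓝 x, ContMDiffAt (𝓡 n) ((𝓡 n).prod 𝓘(ℝ, F)) ∞
      (fun x ↦ TotalSpace.mk' F x (t.localFrame b i x)) y := fun i ↦ by
    filter_upwards [t.open_baseSet.mem_nhds hx] with y hy
    exact contMDiffAt_localFrame_of_mem ∞ t b i hy
  have hηy : ∀ y, ContMDiffAt (𝓡 n) ((𝓡 n).prod 𝓘(ℝ, F)) ∞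
      (fun x ↦ TotalSpace.mk' F x (η x)) y := fun y ↦ hη.contMDiffAt Filter.univ_mem
  let c : _ → M → ℝ := fun i ↦ LinearMap.piApply (t.localFrameCoeff (𝓡 n) b i) η
  have hcf : ∀ i, ∀ᶠ y in 𝓝 x, ContMDiffAt (𝓡 n) 𝓘(ℝ, ℝ) ∞ (c i) y := fun i ↦ by
    filter_upwards [t.open_baseSet.mem_nhds hx] with y hy
    exact contMDiffAt_localFrameCoeff b hy (hηy y) i
  have hcs : ∀ i, ∀ᶠ y in 𝓝 x, ContMDiffAt (𝓡 n) ((𝓡 n).prod 𝓘(ℝ, F)) ∞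
      (fun x ↦ TotalSpace.mk' F x ((c i • t.localFrame b i) x)) y := fun i ↦ by
    filter_upwards [hcf i, hs i] with y h1 h2
    exact h1.smul_section h2
  have sum : ∀ S : Finset _, (∀ᶠ y in 𝓝 x, ContMDiffAt (𝓡 n) ((𝓡 n).prod 𝓘(ℝ, F)) ∞
      (fun x ↦ TotalSpace.mk' F x ((∑ i ∈ S, c i • t.localFrame b i) x)) y) ∧
      curvature nabla X Y (∑ i ∈ S, c i • t.localFrame b i) x =
        ∑ i ∈ S, c i x • curvature nabla X Y (t.localFrame b i) x := by
    intro S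
    induction S using Finset.induction_on with
    | empty =>
      have h0 : ∀ᶠ y in 𝓝 x, ContMDiffAt (𝓡 n) ((𝓡 n).prod 𝓘(ℝ, F)) ∞
          (fun x ↦ TotalSpace.mk' F x ((0 : Π x, V x) x)) y :=
        Filter.Eventually.of_forall fun y ↦ (contMDiff_zeroSection ℝ V) y
      refine ⟨by simpa using h0, ?_⟩
      have := curvature_add hn h0 h0 hX hY
      simpa using this
    | insert i S hi ih =>
      simp only [Finset.sum_insert hi]
      refine ⟨?_, ?_⟩
      · filter_upwards [hcs i, ih.1] with y h1 h2
        exact h1.add_section h2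
      · rw [curvature_add hn (hcs i) ih.1 hX hY, ih.2, curvature_smul hn (hcf i) (hs i) hX hY]
  obtain ⟨h1, h2⟩ := sum Finset.univ
  have e : curvature nabla X Y η x =
      curvature nabla X Y (∑ i, c i • t.localFrame b i) x := by
    refine curvature_congr hn (Filter.Eventually.of_forall hηy) h1 ?_ hX hY
    filter_upwards [t.open_baseSet.mem_nhds hx] with y hy
    rw [t.eq_sum_localFrameCoeff_smul (I := 𝓡 n) (s := η) (b := b) hy]
    simp [c]
  rw [e, h2, curvatureEnd, Module.Basis.constr_apply_fintype]
  refine Finset.sum_congr rfl fun i _ ↦ ?_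
  congr 1
  exact (t.localFrameCoeff_apply_of_mem_baseSet (I := 𝓡 n) b hx η i).symm

end Tensoriality

section CoherentTangentBundle

variable {n : ℕ} {M : Type*} [TopologicalSpace M]
  [ChartedSpace (EuclideanSpace ℝ (Fin n)) M] [IsManifold (𝓡 n) ∞ M]
  (F : Type*) [NormedAddCommGroup F] [NormedSpace ℝ F]
  {V : M → Type*} [TopologicalSpace (TotalSpace F V)]
  [∀ x, AddCommGroup (V x)] [∀ x, Module ℝ (V x)] [∀ x, TopologicalSpace (V x)]
  [∀ x, IsTopologicalAddGroup (V x)] [∀ x, ContinuousSMul ℝ (V x)]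
  [FiberBundle F V] [VectorBundle ℝ F V]

/-- `∇_X φ(Y) - ∇_Y φ(X) - φ([X,Y]) = 0` on the open set `U`. -/
def RelativelyTorsionFreeOn (φ : Π x : M, TangentSpace (𝓡 n) x →L[ℝ] V x)
    (nabla : (Π x : M, V x) → (Π x : M, TangentSpace (𝓡 n) x →L[ℝ] V x)) (U : Set M) : Prop :=
  ∀ X Y : Π x : M, TangentSpace (𝓡 n) x, SmoothVectorFieldOn X U → SmoothVectorFieldOn Y U →
    ∀ x ∈ U, nabla (fun y ↦ φ y (Y y)) x (X x) - nabla (fun y ↦ φ y (X y)) x (Y x)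
      - φ x (VectorField.mlieBracket (𝓡 n) X Y x) = 0

/-- The curvature of `nabla` vanishes on the open set `U`. -/
def FlatOn (nabla : (Π x : M, V x) → (Π x : M, TangentSpace (𝓡 n) x →L[ℝ] V x))
    (U : Set M) : Prop :=
  ∀ (X Y : Π x : M, TangentSpace (𝓡 n) x) (η : Π x : M, V x),
    SmoothVectorFieldOn X U → SmoothVectorFieldOn Y U → SmoothSectionOn n F η U →
    ∀ x ∈ U, curvature nabla X Y η x = 0

/-- `nabla` and `nabla'` are projectively equivalent with respect to `φ` on the open set `U`. -/
def ProjectivelyEquivalentOn (φ : Π x : M, TangentSpace (𝓡 n) x →L[ℝ] V x)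
    (nabla nabla' : (Π x : M, V x) → (Π x : M, TangentSpace (𝓡 n) x →L[ℝ] V x))
    (U : Set M) : Prop :=
  ∃ ρ : Π x : M, V x →L[ℝ] ℝ, SmoothDualSectionOn n F ρ U ∧
    ∀ (X : Π x : M, TangentSpace (𝓡 n) x) (η : Π x : M, V x),
      SmoothVectorFieldOn X U → SmoothSectionOn n F η U →
      ∀ x ∈ U, nabla' η x (X x) =
        nabla η x (X x) + ρ x (φ x (X x)) • η x + ρ x (η x) • φ x (X x)

variable (n V) in
/-- The data `(φ, ∇)` of a coherent tangent bundle `(V, φ, ∇)` over the `n`-manifold `M`: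
a smooth bundle map `φ : TM → V` and a smooth connection on `V` that is relatively torsion-free
with respect to `φ`. That `V` has rank `n` is a hypothesis on the model fibre `F`. -/
structure CoherentTangentBundle where
  φ : Π x : M, TangentSpace (𝓡 n) x →L[ℝ] V x
  smooth_φ : SmoothBundleMap F φ
  nabla : (Π x : M, V x) → (Π x : M, TangentSpace (𝓡 n) x →L[ℝ] V x)
  connection : IsSmoothConnectionOn F nabla univ
  torsionFree : RelativelyTorsionFreeOn φ nabla univ

namespace CoherentTangentBundle

variable {F} (B : CoherentTangentBundle n F V)

/-- `rank φ ≥ k` outside of a null set. -/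
def RankAtLeastAE (k : ℕ) : Prop :=
  IsNull n {x : M | ¬ k ≤ Module.finrank ℝ (LinearMap.range (B.φ x).toLinearMap)}

/-- `tr {η ↦ R(X,Y)η} = 0` for all smooth vector fields `X`, `Y`. -/
def CurvatureTraceFree : Prop :=
  ∀ X Y : Π x : M, TangentSpace (𝓡 n) x,
    SmoothVectorFieldOn X univ → SmoothVectorFieldOn Y univ →
    ∀ x, LinearMap.trace ℝ (V x) (curvatureEnd F B.nabla X Y x) = 0

/-- Every point has an open neighbourhood on which the connection is projectively equivalent,
with respect to `φ`, to a flat connection (relatively torsion-free with respect to `φ`). -/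
def ProjectivelyFlat : Prop :=
  ∀ p : M, ∃ U : Set M, IsOpen U ∧ p ∈ U ∧
    ∃ nabla' : (Π x : M, V x) → (Π x : M, TangentSpace (𝓡 n) x →L[ℝ] V x),
      IsSmoothConnectionOn F nabla' U ∧ RelativelyTorsionFreeOn B.φ nabla' U ∧
      FlatOn F nabla' U ∧ ProjectivelyEquivalentOn F B.φ B.nabla nabla' U

/-- `R(X,Y)η = (1/(n-1)) {A(Y,η) φ(X) - A(X,η) φ(Y)}`. -/
def CurvatureCondition (A : Π x : M, TangentSpace (𝓡 n) x →L[ℝ] V x →L[ℝ] ℝ) : Prop :=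
  ∀ (X Y : Π x : M, TangentSpace (𝓡 n) x) (η : Π x : M, V x),
    SmoothVectorFieldOn X univ → SmoothVectorFieldOn Y univ → SmoothSectionOn n F η univ →
    ∀ x, curvature B.nabla X Y η x =
      (1 / ((n : ℝ) - 1)) •
        (A x (Y x) (η x) • B.φ x (X x) - A x (X x) (η x) • B.φ x (Y x))

/-- `X A(Y,η) - Y A(X,η) - A([X,Y],η) = A(Y,∇_X η) - A(X,∇_Y η)`. -/
def CodazziCondition (A : Π x : M, TangentSpace (𝓡 n) x →L[ℝ] V x →L[ℝ] ℝ) : Prop :=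
  ∀ (X Y : Π x : M, TangentSpace (𝓡 n) x) (η : Π x : M, V x),
    SmoothVectorFieldOn X univ → SmoothVectorFieldOn Y univ → SmoothSectionOn n F η univ →
    ∀ x, dirDeriv X (fun y ↦ A y (Y y) (η y)) x - dirDeriv Y (fun y ↦ A y (X y) (η y)) x
        - A x (VectorField.mlieBracket (𝓡 n) X Y x) (η x) =
      A x (Y x) (B.nabla η x (X x)) - A x (X x) (B.nabla η x (Y x))

end CoherentTangentBundle

end CoherentTangentBundle

end

end CoherentTB

/-! For a section ρ of the dual bundle put T(X,η) = (∇_X ρ)(η) - ρ(φX)ρ(η), the Riccati form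
(`riccati`). Since ∇ is relatively torsion-free, the projective change of ∇ by ρ has curvature
R(X,Y)η + {T(X,φY) - T(Y,φX)}η + T(X,η)φ(Y) - T(Y,η)φ(X); this is `curvature_projective_change`, and
both directions of the equivalence are read off from it.

If the changed connection is flat, R is expressed through T up to a multiple d of the identity. The
trace of that expression is -(n+1)d, so trace-freeness gives d = 0 and R has the required form with
A = (n-1)T. Such a ρ exists only locally, but where φ has large rank the form T is determined by R;
these points are dense, so the local forms agree on overlaps and glue (`curvature_form_unique`,
`exists_tensor_of_projectivelyFlat`).

The Codazzi equation comes from the second Bianchi identity. Inserting the formula for R and using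
torsion-freeness turns it into D(X,Y)φ(Z) + D(Y,Z)φ(X) + D(Z,X)φ(Y) = 0, where D is the Codazzi
defect (`codazziDefect_cyclic_sum`). Where rank φ ≥ 3 one can choose Z with φ(Z) outside the span of
φ(X) and φ(Y), so D(X,Y) = 0 there, and everywhere by density and continuity. No trace condition is
involved.

Conversely, given A, one needs ρ with T = A/(n-1). This is an overdetermined nonlinear equation, but
ρ = μ/f linearizes it to ∇μ = f A/(n-1), df = -μ∘φ. The integrability conditions of the linear
system are four: the curvature formula, the Codazzi equation, torsion-freeness, and the symmetry of
A(X,φY), which is again the vanishing of the trace (`linearizedCoeff_integrable`). The Frobenius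
theorem then provides a solution with μ = 0, f = 1 at the given point, and the projective change by
μ/f is flat nearby (`exists_riccati_solution`, `projectivelyFlat_of_curvatureCondition`).

The Frobenius theorem for linear systems is proved directly: the system is integrated along rays
from the origin, and a Grönwall estimate combined with integrability shows that the resulting
function has the prescribed derivative. -/

namespace CoherentTB

/-! ### Linear total differential systems: existence of solutions -/

section Frobenius

variable {E G : Type*} [NormedAddCommGroup E] [NormedSpace ℝ E]
  [NormedAddCommGroup G] [NormedSpace ℝ G]

/-- A linear ODE on `[0, 1]` whose coefficient has norm at most `1 / 2` is solvable. -/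
lemma exists_linear_ode_solution [CompleteSpace G] {B : ℝ → G →L[ℝ] G} (hB : Continuous B)
    (hle : ∀ t ∈ Icc (0 : ℝ) 1, ‖B t‖ ≤ 1 / 2) (u₀ : G) :
    ∃ U : ℝ → G, U 0 = u₀ ∧
      ∀ t ∈ Icc (0 : ℝ) 1, HasDerivWithinAt U (B t (U t)) (Icc 0 1) t := by
  -- On the ball of radius ‖u₀‖ about u₀ every point has norm at most 2‖u₀‖, so the speed is at most
  -- ‖u₀‖ and a solution cannot leave the ball within time 1. Hence the solution lives on all of [0,
  -- 1].
  have hP : IsPicardLindelof (fun t u ↦ B t u) (⟨0, by simp⟩ : Icc (0 : ℝ) 1) u₀ ‖u₀‖₊ 0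
      ‖u₀‖₊ (1 / 2) := by
    refine ⟨fun t ht ↦ ?_, fun x _ ↦ (hB.clm_apply continuous_const).continuousOn,
      fun t ht x hx ↦ ?_, by simp⟩
    · refine ((B t).lipschitz.weaken ?_).lipschitzOnWith
      exact_mod_cast hle t ht
    · have h1 : ‖x‖ ≤ 2 * ‖u₀‖ := by
        have : ‖x - u₀‖ ≤ ‖u₀‖ := by simpa [dist_eq_norm] using hx
        have := norm_le_norm_add_norm_sub' x u₀
        linarith
      calc ‖B t x‖ ≤ ‖B t‖ * ‖x‖ := (B t).le_opNorm x
        _ ≤ 1 / 2 * (2 * ‖u₀‖) := by gcongr; exact hle t ht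
        _ = ‖u₀‖ := by ring
  exact hP.exists_eq_forall_mem_Icc_hasDerivWithinAt₀

/-- A compactly supported `C¹` map is bounded and Lipschitz. -/
lemma exists_lipschitz_bound {Y : Type*} [NormedAddCommGroup Y] [NormedSpace ℝ Y] {f : E → Y}
    (hf : ContDiff ℝ 1 f) (hc : HasCompactSupport f) :
    ∃ C : ℝ, (∀ x, ‖f x‖ ≤ C) ∧ ∀ a b, ‖f b - f a‖ ≤ C * ‖b - a‖ := by
  obtain ⟨C0, h0⟩ := hc.exists_bound_of_continuous hf.continuous
  obtain ⟨C1, h1⟩ := (hc.fderiv ℝ).exists_bound_of_continuous (hf.continuous_fderiv one_ne_zero)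
  exact ⟨max C0 C1, fun x ↦ (h0 x).trans (le_max_left _ _), fun a b ↦
    convex_univ.norm_image_sub_le_of_norm_fderiv_le
      (fun x _ ↦ hf.differentiable one_ne_zero x) (fun x _ ↦ (h1 x).trans (le_max_right _ _))
      (mem_univ a) (mem_univ b)⟩

/-- A compactly supported `C²` map is bounded and Lipschitz, has bounded derivative, and its first
order Taylor expansion has a uniformly quadratic remainder. -/
lemma exists_taylor_bound {Y : Type*} [NormedAddCommGroup Y] [NormedSpace ℝ Y] {f : E → Y}
    (hf : ContDiff ℝ 2 f) (hc : HasCompactSupport f) :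
    ∃ C : ℝ, 1 ≤ C ∧ (∀ x, ‖f x‖ ≤ C) ∧ (∀ x, ‖fderiv ℝ f x‖ ≤ C) ∧
      (∀ a b, ‖f b - f a‖ ≤ C * ‖b - a‖) ∧
      ∀ a b, ‖f b - f a - fderiv ℝ f a (b - a)‖ ≤ C * ‖b - a‖ * ‖b - a‖ := by
  obtain ⟨C0, h0, l0⟩ := exists_lipschitz_bound (hf.of_le (by norm_num)) hc
  obtain ⟨C1, h1, l1⟩ := exists_lipschitz_bound (hf.fderiv_right (m := 1) (by norm_num))
    (hc.fderiv ℝ)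
  have le0 : C0 ≤ max 1 (max C0 C1) := by simp
  have le1 : C1 ≤ max 1 (max C0 C1) := by simp
  refine ⟨max 1 (max C0 C1), le_max_left _ _, fun x ↦ (h0 x).trans le0,
    fun x ↦ (h1 x).trans le1, fun a b ↦ (l0 a b).trans (by gcongr), fun a b ↦ ?_⟩
  -- Mean value inequality for f minus its linear part at a: along the segment the derivative
  -- differs from the one at a by at most C‖b - a‖.
  refine (convex_segment a b).norm_image_sub_le_of_norm_fderiv_le'
    (fun x _ ↦ hf.differentiable (by norm_num) x)
    (fun x hx ↦ (l1 a x).trans ?_) (left_mem_segment ℝ a b) (right_mem_segment ℝ a b)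
  gcongr
  exact norm_sub_le_of_mem_segment hx

/-- **Frobenius theorem** for linear total differential systems `du = Ω u` with compactly
supported coefficients; the coefficients take values in a space `L` acting on the space `G` of
unknowns through `ev`. -/
theorem exists_hasFDerivAt_of_integrable [CompleteSpace G] {L : Type*} [NormedAddCommGroup L]
    [NormedSpace ℝ L] {ev : L →L[ℝ] G →L[ℝ] G} (hev : ∀ a u, ‖ev a u‖ ≤ ‖a‖ * ‖u‖)
    {Ω : E → E →L[ℝ] L} (hΩ : ContDiff ℝ 2 Ω) (hc : HasCompactSupport Ω) {r : ℝ} (hr : 0 < r)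
    (hint : ∀ x ∈ Metric.ball (0 : E) r, ∀ h k (u : G),
      ev (fderiv ℝ Ω x h k) u + ev (Ω x k) (ev (Ω x h) u) =
        ev (fderiv ℝ Ω x k h) u + ev (Ω x h) (ev (Ω x k) u)) (u₀ : G) :
    ∃ δ > 0, ∃ u : E → G, u 0 = u₀ ∧
      ∀ x ∈ Metric.ball (0 : E) δ, HasFDerivAt u ((ev.flip (u x)).comp (Ω x)) x := by
  obtain ⟨C, hC1, hC, hC', lip1, taylor⟩ := exists_taylor_bound hΩ hc
  have hd1 : Differentiable ℝ Ω := hΩ.differentiable (by norm_num)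
  have hC0 : 0 < C := by linarith
  -- The bound r keeps rays inside the region of integrability; the bound 1/(2C) makes the
  -- coefficient of the ODE along each ray at most 1/2.
  set δ := min r (1 / (2 * C)) with hδ
  have hδ0 : 0 < δ := lt_min hr (by positivity)
  have hδC : ∀ x ∈ Metric.ball (0 : E) δ, C * ‖x‖ ≤ 1 / 2 := by
    intro x hx
    have : ‖x‖ ≤ 1 / (2 * C) := (mem_ball_zero_iff.1 hx).le.trans (min_le_right _ _)
    calc C * ‖x‖ ≤ C * (1 / (2 * C)) := by gcongr
      _ = 1 / 2 := by field_simp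
  have hev1 : ∀ a, ‖ev a‖ ≤ ‖a‖ := fun a ↦
    (ev a).opNorm_le_bound (norm_nonneg a) (hev a)
  -- Restricted to the ray t ↦ t x, the system becomes a linear ODE. The candidate solution is u(x)
  -- = U x 1; outside the ball the choice of U is arbitrary.
  have hsol : ∀ x : E, ∃ U : ℝ → G, U 0 = u₀ ∧ (x ∈ Metric.ball (0 : E) δ →
      ∀ t ∈ Icc (0 : ℝ) 1, HasDerivWithinAt U (ev (Ω (t • x) x) (U t)) (Icc 0 1) t) := by
    intro x
    by_cases hx : x ∈ Metric.ball (0 : E) δ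
    · obtain ⟨U, h1, h2⟩ := exists_linear_ode_solution (B := fun t : ℝ ↦ ev (Ω (t • x) x))
        (ev.continuous.comp ((hΩ.continuous.comp (by fun_prop)).clm_apply continuous_const))
        (fun t _ ↦ (hev1 _).trans (((Ω (t • x)).le_opNorm x).trans
          ((mul_le_mul_of_nonneg_right (hC _) (norm_nonneg x)).trans (hδC x hx)))) u₀
      exact ⟨U, h1, fun _ ↦ h2⟩
    · exact ⟨fun _ ↦ u₀, rfl, fun h ↦ absurd h hx⟩
  choose U hU0 hU using hsol
  have hcont : ∀ x ∈ Metric.ball (0 : E) δ, ContinuousOn (U x) (Icc 0 1) :=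
    fun x hx t ht ↦ (hU x hx t ht).continuousWithinAt
  refine ⟨δ, hδ0, fun x ↦ U x 1, ?_, fun x hx ↦ ?_⟩
  · have h0 : (0 : E) ∈ Metric.ball (0 : E) δ := Metric.mem_ball_self hδ0
    have := constant_of_derivWithin_zero (f := U 0) (a := 0) (b := 1)
      (fun t ht ↦ (hU 0 h0 t ht).differentiableWithinAt) (fun t ht ↦ by
        rw [(hU 0 h0 t (Ico_subset_Icc_self ht)).derivWithin
          (uniqueDiffOn_Icc zero_lt_one t (Ico_subset_Icc_self ht))]
        simp) 1 (by simp)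
    exact this.trans (hU0 0)
  obtain ⟨K, hK⟩ := isCompact_Icc.exists_bound_of_continuousOn (hcont x hx)
  have hK0 : 0 ≤ K := (norm_nonneg _).trans (hK 0 (by simp))
  have hx1 : ‖x‖ ≤ 1 := by nlinarith [hδC x hx, norm_nonneg x]
  -- The sum of the constants in the error bounds `n2`, `n3`, `n4` below.
  set ε := (2 * C + 2 * C * C) * K with hε
  have key : ∀ y ∈ Metric.ball (0 : E) δ,
      ‖U y 1 - U x 1 - ev (Ω x (y - x)) (U x 1)‖ ≤ gronwallBound 0 1 (ε * ‖y - x‖ ^ 2) 1 := by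
    intro y hy
    have hy1 : ‖y‖ ≤ 1 := by nlinarith [hδC y hy, norm_nonneg y]
    set h := y - x with hh
    have hyx : y = x + h := by simp [hh]
    -- The deviation, at time t, of the ray solution towards y from its predicted first-order
    -- expansion about the ray towards x. It vanishes at t = 0, and at t = 1 it is the remainder to
    -- be shown quadratic in h.
    set w : ℝ → G := fun t ↦ U y t - U x t - t • ev (Ω (t • x) h) (U x t) with hw
    set w' : ℝ → G := fun t ↦ ev (Ω (t • y) y) (U y t) - ev (Ω (t • x) x) (U x t) -
      (t • (ev (fderiv ℝ Ω (t • x) x h) (U x t) +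
        ev (Ω (t • x) h) (ev (Ω (t • x) x) (U x t))) + ev (Ω (t • x) h) (U x t)) with hw'
    have hderiv : ∀ t ∈ Icc (0 : ℝ) 1, HasDerivWithinAt w (w' t) (Icc 0 1) t := by
      intro t ht
      have e1 : HasDerivWithinAt (fun t : ℝ ↦ Ω (t • x)) (fderiv ℝ Ω (t • x) x) (Icc 0 1) t := by
        have e0 : HasDerivAt (fun t : ℝ ↦ t • x) x t := by
          simpa using (hasDerivAt_id t).smul_const x
        exact ((hd1 (t • x)).hasFDerivAt.comp_hasDerivAt t e0).hasDerivWithinAt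
      have e1' : HasDerivWithinAt (fun t : ℝ ↦ Ω (t • x) h) (fderiv ℝ Ω (t • x) x h)
          (Icc 0 1) t := by
        simpa using e1.clm_apply (hasDerivWithinAt_const t (Icc 0 1) h)
      have e2 := (ev.hasFDerivAt.comp_hasDerivWithinAt t e1').clm_apply (hU x hx t ht)
      have e3 := (hasDerivWithinAt_id t (Icc 0 1)).smul e2
      refine (((hU y hy t ht).sub (hU x hx t ht)).sub e3).congr_deriv ?_
      simp [hw']
    have hmem : ∀ t ∈ Icc (0 : ℝ) 1, t • x ∈ Metric.ball (0 : E) r := by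
      intro t ht
      rw [mem_ball_zero_iff] at hx ⊢
      rw [norm_smul, Real.norm_of_nonneg ht.1]
      have : δ ≤ r := min_le_left _ _
      nlinarith [ht.2, norm_nonneg x]
    have hbound : ∀ t ∈ Icc (0 : ℝ) 1, ‖w' t‖ ≤ 1 * ‖w t‖ + ε * ‖h‖ ^ 2 := by
      intro t ht
      have hi := hint (t • x) (hmem t ht) x h (U x t)
      -- Integrability exchanges x and h in the derivative of t Ω(tx)h U. After the exchange, w
      -- solves the ODE of the ray towards y up to terms of second order in h.
      have e : w' t = ev (Ω (t • y) y) (w t) +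
          (ev ((Ω (t • y) - Ω (t • x) - fderiv ℝ Ω (t • x) (t • y - t • x)) y) (U x t)
          + t • ev (fderiv ℝ Ω (t • x) h h) (U x t)
          + ev ((Ω (t • y) - Ω (t • x)) y + Ω (t • x) h) (t • ev (Ω (t • x) h) (U x t))) := by
        have e1 : Ω (t • x) y = Ω (t • x) x + Ω (t • x) h := by rw [hyx, map_add]
        have e2 : fderiv ℝ Ω (t • x) h y = fderiv ℝ Ω (t • x) h x + fderiv ℝ Ω (t • x) h h := by
          rw [← map_add, ← hyx]
        simp only [hw', hw, ← smul_sub, ← hh, hi, map_sub, map_add, map_smul, sub_apply,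
          add_apply, smul_apply, e1, e2]
        module
      rw [e]
      have ht1 : ‖t‖ ≤ 1 := by rw [Real.norm_of_nonneg ht.1]; exact ht.2
      have n1 : ‖ev (Ω (t • y) y) (w t)‖ ≤ 1 * ‖w t‖ := by
        refine (hev _ _).trans ?_
        gcongr
        refine (ContinuousLinearMap.le_opNorm _ _).trans ?_
        nlinarith [hδC y hy, hC (t • y), norm_nonneg y]
      have nh : ‖t • y - t • x‖ ≤ ‖h‖ := by
        rw [← smul_sub, norm_smul]
        exact mul_le_of_le_one_left (norm_nonneg _) ht1
      have hKt := hK t ht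
      have nΩ : ‖Ω (t • x) h‖ ≤ C * ‖h‖ :=
        (ContinuousLinearMap.le_opNorm _ _).trans (by gcongr; exact hC _)
      have n2 : ‖ev ((Ω (t • y) - Ω (t • x) - fderiv ℝ Ω (t • x) (t • y - t • x)) y) (U x t)‖ ≤
          C * ‖h‖ * ‖h‖ * 1 * K := by
        refine (hev _ _).trans ?_
        gcongr
        refine (ContinuousLinearMap.le_opNorm _ _).trans ?_
        gcongr
        exact (taylor _ _).trans (by gcongr)
      have n3 : ‖t • ev (fderiv ℝ Ω (t • x) h h) (U x t)‖ ≤ 1 * (C * ‖h‖ * ‖h‖ * K) := by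
        rw [norm_smul]
        gcongr
        refine (hev _ _).trans ?_
        gcongr
        refine (ContinuousLinearMap.le_opNorm₂ _ _ _).trans ?_
        gcongr
        exact hC' _
      have n4 : ‖ev ((Ω (t • y) - Ω (t • x)) y + Ω (t • x) h)
          (t • ev (Ω (t • x) h) (U x t))‖ ≤
          (C * ‖h‖ * 1 + C * ‖h‖) * (1 * (C * ‖h‖ * K)) := by
        refine (hev _ _).trans ?_
        gcongr
        · refine (norm_add_le _ _).trans ?_
          gcongr
          refine (ContinuousLinearMap.le_opNorm _ _).trans ?_
          gcongr
          exact (lip1 _ _).trans (by gcongr)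
        · rw [norm_smul]
          gcongr
          exact (hev _ _).trans (by gcongr)
      refine (norm_add_le _ _).trans (add_le_add n1 ?_)
      refine (norm_add_le _ _).trans ((add_le_add ((norm_add_le _ _).trans
        (add_le_add n2 n3)) n4).trans (le_of_eq ?_))
      simp only [hε]
      ring
    have hg := norm_le_gronwallBound_of_norm_deriv_right_le (f := w) (f' := w') (δ := 0) (K := 1)
      (ε := ε * ‖h‖ ^ 2) (a := 0) (b := 1) (fun t ht ↦ (hderiv t ht).continuousWithinAt)
      (fun t ht ↦ (hderiv t (Ico_subset_Icc_self ht)).mono_of_mem_nhdsWithin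
        (Icc_mem_nhdsGE_of_mem ht)) (by simp [hw, hU0])
      (fun t ht ↦ hbound t (Ico_subset_Icc_self ht)) 1 (by simp)
    simpa [hw] using hg
  -- The Grönwall bound at time 1 is ε(e - 1)‖y - x‖², which is o(‖y - x‖).
  refine HasFDerivAt.of_isLittleO ?_
  refine Asymptotics.IsBigO.trans_isLittleO ?_ (Asymptotics.isLittleO_pow_sub_sub x one_lt_two)
  refine Asymptotics.IsBigO.of_bound (ε * (Real.exp 1 - 1)) ?_
  filter_upwards [Metric.isOpen_ball.mem_nhds hx] with y hy
  refine (key y hy).trans (le_of_eq ?_)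
  rw [gronwallBound_of_K_ne_0 one_ne_zero]
  simp
  ring

end Frobenius

/-! ### Smoothness of solutions -/

section Frobenius

variable {E G : Type*} [NormedAddCommGroup E] [NormedSpace ℝ E]
  [NormedAddCommGroup G] [NormedSpace ℝ G]

/-- Solutions of total differential systems with smooth coefficients are smooth. -/
lemma contDiffOn_of_hasFDerivAt {L : Type*} [NormedAddCommGroup L]
    [NormedSpace ℝ L] {ev : L →L[ℝ] G →L[ℝ] G} {Ω : E → E →L[ℝ] L} (hΩ : ContDiff ℝ ∞ Ω)
    {u : E → G} {s : Set E} (hs : IsOpen s)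
    (hu : ∀ x ∈ s, HasFDerivAt u ((ev.flip (u x)).comp (Ω x)) x) : ContDiffOn ℝ ∞ u s := by
  refine contDiffOn_infty.2 fun m ↦ ?_
  induction m with
  | zero => exact contDiffOn_zero.2 fun x hx ↦ (hu x hx).continuousAt.continuousWithinAt
  | succ m ih =>
    push_cast
    refine (contDiffOn_succ_iff_fderiv_of_isOpen hs).2
      ⟨fun x hx ↦ (hu x hx).differentiableAt.differentiableWithinAt, by simp, ?_⟩
    -- Bootstrapping: the equation itself writes the derivative of u as a smooth expression in u and
    -- Ω, so each order of smoothness yields the next.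
    have h : ContDiffOn ℝ m (fun x ↦ (ev.flip (u x)).comp (Ω x)) s :=
      (ev.flip.contDiff.comp_contDiffOn ih).clm_comp
        ((hΩ.of_le (by exact_mod_cast le_top)).contDiffOn)
    exact h.congr fun x hx ↦ (hu x hx).fderiv

end Frobenius

/-! ### Coordinate vector fields of a chart -/

section CoordinateFields

set_option linter.unusedSectionVars false

variable {n : ℕ} {M : Type*} [TopologicalSpace M]
  [ChartedSpace (EuclideanSpace ℝ (Fin n)) M] [IsManifold (𝓡 n) ∞ M]

/-- The `i`-th coordinate vector field of the preferred chart at `p`. -/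
noncomputable def coordField (p : M) (i : Fin n) : Π x : M, TangentSpace (𝓡 n) x :=
  (trivializationAt (EuclideanSpace ℝ (Fin n)) (TangentSpace (𝓡 n)) p).localFrame
    (EuclideanSpace.basisFun (Fin n) ℝ).toBasis i

lemma smoothVectorFieldOn_coordField (p : M) (i : Fin n) :
    SmoothVectorFieldOn (coordField p i) (chartAt (EuclideanSpace ℝ (Fin n)) p).source :=
  fun _ hx ↦ (contMDiffAt_localFrame_of_mem ∞ _ _ i (by simpa using hx)).contMDiffWithinAt

/-- The trivialization of the tangent bundle at p is the differential of the chart at p, so the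
frame it induces is carried to the standard basis. This turns derivatives along `coordField p i`
into ordinary partial derivatives. -/
lemma mfderiv_extChartAt_coordField {p x : M}
    (hx : x ∈ (chartAt (EuclideanSpace ℝ (Fin n)) p).source) (i : Fin n) :
    mfderiv (𝓡 n) 𝓘(ℝ, EuclideanSpace ℝ (Fin n)) (extChartAt (𝓡 n) p) x (coordField p i x) =
      EuclideanSpace.single i (1 : ℝ) := by
  have hb : x ∈ (trivializationAt (EuclideanSpace ℝ (Fin n))
    (TangentSpace (𝓡 n)) p).baseSet := by simpa using hx
  rw [← TangentBundle.continuousLinearMapAt_trivializationAt hx, coordField,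
    Trivialization.localFrame_apply_of_mem_baseSet _ _ hb]
  simp only [Trivialization.basisAt, Module.Basis.map_apply]
  have := (Trivialization.continuousLinearMapAt_symmL (R := ℝ)
    (trivializationAt (EuclideanSpace ℝ (Fin n)) (TangentSpace (𝓡 n)) p) hb
    (EuclideanSpace.single i (1 : ℝ)))
  simp only [OrthonormalBasis.coe_toBasis, EuclideanSpace.basisFun_apply,
    Trivialization.linearEquivAt_symm_apply]
  rwa [Trivialization.symmL_apply _ hb] at this

lemma dirDeriv_coordField_comp {p x : M}
    (hx : x ∈ (chartAt (EuclideanSpace ℝ (Fin n)) p).source) (i : Fin n)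
    {g : EuclideanSpace ℝ (Fin n) → ℝ} (hg : DifferentiableAt ℝ g (extChartAt (𝓡 n) p x)) :
    dirDeriv (coordField p i) (g ∘ extChartAt (𝓡 n) p) x =
      fderiv ℝ g (extChartAt (𝓡 n) p x) (EuclideanSpace.single i 1) := by
  rw [dirDeriv, mvfderiv_comp_apply x hg.mdifferentiableAt (mdifferentiableAt_extChartAt hx),
    mfderiv_extChartAt_coordField hx, mvfderiv, mfderiv_eq_fderiv]
  rfl

lemma dirDeriv_congr {X : Π x : M, TangentSpace (𝓡 n) x} {f g : M → ℝ} {x : M}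
    (h : f =ᶠ[𝓝 x] g) : dirDeriv X f x = dirDeriv X g x := by
  change (mfderiv (𝓡 n) 𝓘(ℝ, ℝ) f x (X x) : ℝ) = mfderiv (𝓡 n) 𝓘(ℝ, ℝ) g x (X x)
  rw [h.mfderiv_eq]
  rfl

lemma contDiffAt_comp_extChartAt_symm {p : M} {f : M → ℝ} {z : EuclideanSpace ℝ (Fin n)}
    (hz : z ∈ (extChartAt (𝓡 n) p).target)
    (hf : ContMDiffAt (𝓡 n) 𝓘(ℝ, ℝ) ∞ f ((extChartAt (𝓡 n) p).symm z)) :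
    ContDiffAt ℝ ∞ (f ∘ (extChartAt (𝓡 n) p).symm) z := by
  have h := hf.comp z ((contMDiffOn_extChartAt_symm (n := ∞) p).contMDiffAt
    ((isOpen_extChartAt_target p).mem_nhds hz))
  exact h.contDiffAt

lemma fderiv_comp_extChartAt_symm {p : M} {f : M → ℝ} {z : EuclideanSpace ℝ (Fin n)}
    (hz : z ∈ (extChartAt (𝓡 n) p).target)
    (hf : ContMDiffAt (𝓡 n) 𝓘(ℝ, ℝ) ∞ f ((extChartAt (𝓡 n) p).symm z)) (i : Fin n) :
    fderiv ℝ (f ∘ (extChartAt (𝓡 n) p).symm) z (EuclideanSpace.single i 1) =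
      dirDeriv (coordField p i) f ((extChartAt (𝓡 n) p).symm z) := by
  have hs : (extChartAt (𝓡 n) p).symm z ∈ (extChartAt (𝓡 n) p).source :=
    (extChartAt (𝓡 n) p).map_target hz
  have hd := (contDiffAt_comp_extChartAt_symm hz hf).differentiableAt (by simp)
  have e := (extChartAt (𝓡 n) p).right_inv hz
  have := dirDeriv_coordField_comp (p := p) (by rwa [extChartAt_source] at hs) i
    (g := f ∘ (extChartAt (𝓡 n) p).symm) (by rwa [e])
  rw [e] at this
  rw [← this]
  refine dirDeriv_congr ?_
  filter_upwards [(isOpen_extChartAt_source p).mem_nhds hs] with y hy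
  simp only [Function.comp_apply, (extChartAt (𝓡 n) p).left_inv hy]

end CoordinateFields

/-! ### The Frobenius theorem in ℝⁿ with matrix coefficients -/

section LinearSystems

variable {n : ℕ} {ι : Type*} [Fintype ι] {L : Type*} [NormedAddCommGroup L] [NormedSpace ℝ L]

/-- The elementary coefficient `dxⁱ ⊗ E` of a linear total differential system. -/
noncomputable def elemCoeff (i : Fin n) (m : L) : EuclideanSpace ℝ (Fin n) →L[ℝ] L :=
  (EuclideanSpace.proj (𝕜 := ℝ) i).smulRight m

/-- By `hm` the element `m a b` acts as the matrix unit with a single 1 in row a and column b. This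
is the dictionary between the operator form and the index form of a system. -/
lemma sum_elemCoeff_apply [DecidableEq ι] {ev : L →L[ℝ] (ι → ℝ) →L[ℝ] (ι → ℝ)} {m : ι → ι → L}
    (hm : ∀ a b u, ev (m a b) u = u b • (Pi.single a 1 : ι → ℝ)) (c : Fin n → ι → ι → ℝ)
    (k : EuclideanSpace ℝ (Fin n)) (u : ι → ℝ) (a : ι) :
    ev ((∑ i, ∑ a, ∑ b, c i a b • elemCoeff i (m a b)) k) u a =
      ∑ i, ∑ b, k i * (c i a b * u b) := by
  simp only [sum_apply, smul_apply, elemCoeff, ContinuousLinearMap.smulRight_apply,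
    PiLp.proj_apply, map_sum, map_smul, hm, Finset.sum_apply, Pi.smul_apply, smul_eq_mul]
  refine Finset.sum_congr rfl fun i _ ↦ ?_
  rw [Finset.sum_eq_single a]
  · refine Finset.sum_congr rfl fun b _ ↦ ?_
    simp
    ring
  · intro a' _ ha'
    exact Finset.sum_eq_zero fun b _ ↦ by simp [ha'.symm]
  · simp

lemma fderiv_sum_smul_apply {E : Type*} [NormedAddCommGroup E] [NormedSpace ℝ E]
    {w : Fin n → ι → ι → E → ℝ} {z : E} (hw : ∀ i a b, DifferentiableAt ℝ (w i a b) z)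
    (m : Fin n → ι → ι → L) (h : E) :
    fderiv ℝ (fun z ↦ ∑ i, ∑ a, ∑ b, w i a b z • m i a b) z h =
      ∑ i, ∑ a, ∑ b, fderiv ℝ (w i a b) z h • m i a b := by
  have : HasFDerivAt (fun z ↦ ∑ i, ∑ a, ∑ b, w i a b z • m i a b)
      (∑ i, ∑ a, ∑ b, (fderiv ℝ (w i a b) z).smulRight (m i a b)) z :=
    HasFDerivAt.fun_sum fun i _ ↦ HasFDerivAt.fun_sum fun a _ ↦ HasFDerivAt.fun_sum fun b _ ↦
      (hw i a b).hasFDerivAt.smul_const _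
  rw [this.fderiv]
  simp

/-- Auxiliary form of `exists_solution_of_integrable`, in which the matrices act through an abstract
normed space `L`. -/
lemma exists_solution_of_integrable_aux [DecidableEq ι] {ev : L →L[ℝ] (ι → ℝ) →L[ℝ] (ι → ℝ)}
    (hev : ∀ a u, ‖ev a u‖ ≤ ‖a‖ * ‖u‖) {m : ι → ι → L}
    (hm : ∀ a b u, ev (m a b) u = u b • (Pi.single a 1 : ι → ℝ))
    {O : Set (EuclideanSpace ℝ (Fin n))}
    {w : Fin n → ι → ι → EuclideanSpace ℝ (Fin n) → ℝ} (hO : IsOpen O) (h0 : 0 ∈ O)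
    (hw : ∀ i a b, ∀ z ∈ O, ContDiffAt ℝ ∞ (w i a b) z)
    (hint : ∀ z ∈ O, ∀ i j a b,
      fderiv ℝ (w j a b) z (EuclideanSpace.single i 1) + ∑ c, w j a c z * w i c b z =
        fderiv ℝ (w i a b) z (EuclideanSpace.single j 1) + ∑ c, w i a c z * w j c b z)
    (u₀ : ι → ℝ) :
    ∃ δ > 0, Metric.ball 0 δ ⊆ O ∧ ∃ u : EuclideanSpace ℝ (Fin n) → ι → ℝ, u 0 = u₀ ∧
      ContDiffOn ℝ ∞ u (Metric.ball 0 δ) ∧ ∀ z ∈ Metric.ball 0 δ, ∀ i a,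
        fderiv ℝ (fun z ↦ u z a) z (EuclideanSpace.single i 1) = ∑ b, w i a b z * u z b := by
  obtain ⟨r, hr, hrO⟩ := Metric.nhds_basis_closedBall.mem_iff.1 (hO.mem_nhds h0)
  -- A cutoff supported in O gives the coefficients a compactly supported smooth extension.
  -- Integrability survives only where χ = 1, so the operator version is applied with radius r / 2.
  let χ : ContDiffBump (0 : EuclideanSpace ℝ (Fin n)) := ⟨r / 2, r, by positivity, by linarith⟩
  let w' : Fin n → ι → ι → EuclideanSpace ℝ (Fin n) → ℝ := fun i a b z ↦ χ z * w i a b z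
  have hw' : ∀ i a b, ContDiff ℝ ∞ (w' i a b) := by
    intro i a b
    refine contMDiff_iff_contDiff.1 (contMDiff_of_tsupport fun z hz ↦ ?_)
    have hz' : z ∈ O := hrO ((tsupport_mul_subset_left hz : z ∈ tsupport χ) |> fun h ↦ by
      rwa [χ.tsupport_eq] at h)
    exact (χ.contDiff.contDiffAt.mul (hw i a b z hz')).contMDiffAt
  have heq : ∀ z ∈ Metric.ball (0 : EuclideanSpace ℝ (Fin n)) (r / 2), ∀ i a b,
      w' i a b =ᶠ[𝓝 z] w i a b := by
    intro z hz i a b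
    filter_upwards [Metric.isOpen_ball.mem_nhds hz] with y hy
    have : χ y = 1 := χ.one_of_mem_closedBall (Metric.ball_subset_closedBall hy)
    simp [w', this]
  let Ω : EuclideanSpace ℝ (Fin n) →
      EuclideanSpace ℝ (Fin n) →L[ℝ] L :=
    fun z ↦ ∑ i, ∑ a, ∑ b, w' i a b z • elemCoeff i (m a b)
  have hΩ : ContDiff ℝ ∞ Ω := ContDiff.sum fun i _ ↦ ContDiff.sum fun a _ ↦ ContDiff.sum
    fun b _ ↦ (hw' i a b).smul contDiff_const
  have hfΩ : ∀ z h, fderiv ℝ Ω z h = ∑ i, ∑ a, ∑ b, fderiv ℝ (w' i a b) z h • elemCoeff i (m a b) := by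
    intro z h
    exact fderiv_sum_smul_apply (fun i a b ↦ (hw' i a b).differentiable (by simp) z) _ h
  have hc : HasCompactSupport Ω := by
    refine HasCompactSupport.intro (isCompact_closedBall (0 : EuclideanSpace ℝ (Fin n)) r) ?_
    intro z hz
    have : χ z = 0 := by
      rw [← χ.tsupport_eq] at hz
      exact image_eq_zero_of_notMem_tsupport hz
    simp [Ω, w', this]
  have hball : Metric.ball (0 : EuclideanSpace ℝ (Fin n)) (r / 2) ⊆ O := fun z hz ↦
    hrO (Metric.closedBall_subset_closedBall (by linarith) (Metric.ball_subset_closedBall hz))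
  -- In index form, interchanging h and k amounts to interchanging i and j in the bracket, which is
  -- exactly what `hint` allows.
  have hsum : ∀ z ∈ Metric.ball (0 : EuclideanSpace ℝ (Fin n)) (r / 2),
      ∀ (h k : EuclideanSpace ℝ (Fin n)) (u : ι → ℝ) (a : ι),
      (ev (fderiv ℝ Ω z h k) u + ev (Ω z k) (ev (Ω z h) u)) a = ∑ i, ∑ j, k i * h j * ∑ b,
        (fderiv ℝ (w i a b) z (EuclideanSpace.single j 1) + ∑ c, w i a c z * w j c b z) * u b := by
    intro z hz h k u a
    have hv : ∀ i a b, w' i a b z = w i a b z := fun i a b ↦ (heq z hz i a b).self_of_nhds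
    have hh : h = ∑ j, h j • EuclideanSpace.single j (1 : ℝ) := by
      simpa using ((EuclideanSpace.basisFun (Fin n) ℝ).sum_repr h).symm
    have hd : ∀ i a b, fderiv ℝ (w' i a b) z h =
        ∑ j, h j * fderiv ℝ (w i a b) z (EuclideanSpace.single j 1) := by
      intro i a b
      rw [(heq z hz i a b).fderiv_eq]
      conv_lhs => rw [hh]
      simp only [map_sum, map_smul, smul_eq_mul]
    simp only [Pi.add_apply, hfΩ, Ω, sum_elemCoeff_apply hm, hd, hv]
    rw [← Finset.sum_add_distrib]
    refine Finset.sum_congr rfl fun i _ ↦ ?_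
    simp only [Finset.mul_sum, Finset.sum_mul, add_mul, mul_add, Finset.sum_add_distrib]
    congr 1
    · rw [Finset.sum_comm]
      refine Finset.sum_congr rfl fun j _ ↦ Finset.sum_congr rfl fun b _ ↦ by ring
    · rw [Finset.sum_comm]
      refine Finset.sum_congr rfl fun j _ ↦ ?_
      rw [Finset.sum_comm]
      refine Finset.sum_congr rfl fun b _ ↦ Finset.sum_congr rfl fun c _ ↦ by ring
  obtain ⟨δ, hδ, u, hu0, hu⟩ := exists_hasFDerivAt_of_integrable
    (ev := ev) (Ω := Ω) hev (hΩ.of_le (WithTop.coe_le_coe.2 (le_top : (2 : ℕ∞) ≤ ⊤))) hc (half_pos hr) (by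
      intro z hz h k u
      ext a
      rw [hsum z hz, hsum z hz, Finset.sum_comm]
      refine Finset.sum_congr rfl fun i _ ↦ Finset.sum_congr rfl fun j _ ↦ ?_
      rw [mul_comm (k j)]
      congr 1
      refine Finset.sum_congr rfl fun b _ ↦ ?_
      rw [hint z (hball hz)]) u₀
  have hsub : Metric.ball (0 : EuclideanSpace ℝ (Fin n)) (min δ (r / 2)) ⊆ Metric.ball 0 δ :=
    Metric.ball_subset_ball (min_le_left _ _)
  have hsub' : Metric.ball (0 : EuclideanSpace ℝ (Fin n)) (min δ (r / 2)) ⊆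
    Metric.ball 0 (r / 2) := Metric.ball_subset_ball (min_le_right _ _)
  refine ⟨min δ (r / 2), by positivity, hsub'.trans hball, u, hu0,
    contDiffOn_of_hasFDerivAt hΩ Metric.isOpen_ball fun z hz ↦ hu z (hsub hz), fun z hz i a ↦ ?_⟩
  have := hasFDerivAt_pi'.1 (hu z (hsub hz)) a
  rw [this.fderiv]
  have hv : ∀ i a b, w' i a b z = w i a b z := fun i a b ↦
    (heq z (hsub' hz) i a b).self_of_nhds
  change ev (Ω z (EuclideanSpace.single i 1)) (u z) a = _
  rw [sum_elemCoeff_apply hm, Finset.sum_eq_single i]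
  · simp [hv]
  · intro j _ hj
    simp [hj]
  · simp

/-- **Frobenius theorem** for linear total differential systems in `ℝⁿ`, in index form. -/
theorem exists_solution_of_integrable {O : Set (EuclideanSpace ℝ (Fin n))}
    {w : Fin n → ι → ι → EuclideanSpace ℝ (Fin n) → ℝ} (hO : IsOpen O) (h0 : 0 ∈ O)
    (hw : ∀ i a b, ∀ z ∈ O, ContDiffAt ℝ ∞ (w i a b) z)
    (hint : ∀ z ∈ O, ∀ i j a b,
      fderiv ℝ (w j a b) z (EuclideanSpace.single i 1) + ∑ c, w j a c z * w i c b z =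
        fderiv ℝ (w i a b) z (EuclideanSpace.single j 1) + ∑ c, w i a c z * w j c b z)
    (u₀ : ι → ℝ) :
    ∃ δ > 0, Metric.ball 0 δ ⊆ O ∧ ∃ u : EuclideanSpace ℝ (Fin n) → ι → ℝ, u 0 = u₀ ∧
      ContDiffOn ℝ ∞ u (Metric.ball 0 δ) ∧ ∀ z ∈ Metric.ball 0 δ, ∀ i a,
        fderiv ℝ (fun z ↦ u z a) z (EuclideanSpace.single i 1) = ∑ b, w i a b z * u z b := by
  classical
  exact exists_solution_of_integrable_aux
    (ev := ContinuousLinearMap.id ℝ ((ι → ℝ) →L[ℝ] (ι → ℝ))) (fun a u ↦ a.le_opNorm u)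
    (m := fun a b ↦ (ContinuousLinearMap.proj (R := ℝ) (φ := fun _ : ι ↦ ℝ) b).smulRight
      (Pi.single a (1 : ℝ) : ι → ℝ)) (fun a b u ↦ by simp) hO h0 hw hint u₀

end LinearSystems

/-! ### The Frobenius theorem on a manifold -/

section CoordinateFields

variable {n : ℕ} {M : Type*} [TopologicalSpace M]
  [ChartedSpace (EuclideanSpace ℝ (Fin n)) M] [IsManifold (𝓡 n) ∞ M]

/-- **Frobenius theorem** for linear total differential systems on a manifold. -/
theorem exists_coordField_solution {ι : Type*} [Fintype ι] {p : M} {O : Set M} (hO : IsOpen O)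
    (hp : p ∈ O) (hOs : O ⊆ (chartAt (EuclideanSpace ℝ (Fin n)) p).source)
    {W : Fin n → ι → ι → M → ℝ} (hW : ∀ i a b, ContMDiffOn (𝓡 n) 𝓘(ℝ, ℝ) ∞ (W i a b) O)
    (hint : ∀ x ∈ O, ∀ i j a b,
      dirDeriv (coordField p i) (W j a b) x + ∑ c, W j a c x * W i c b x =
        dirDeriv (coordField p j) (W i a b) x + ∑ c, W i a c x * W j c b x)
    (u₀ : ι → ℝ) :
    ∃ U, IsOpen U ∧ p ∈ U ∧ U ⊆ O ∧ ∃ u : ι → M → ℝ,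
      (∀ a, ContMDiffOn (𝓡 n) 𝓘(ℝ, ℝ) ∞ (u a) U) ∧ (∀ a, u a p = u₀ a) ∧
      ∀ x ∈ U, ∀ i a, dirDeriv (coordField p i) (u a) x = ∑ b, W i a b x * u b x := by
  set e := extChartAt (𝓡 n) p with he
  set z₀ := e p with hz₀
  have hep : p ∈ e.source := mem_extChartAt_source p
  have hT : IsOpen e.target := isOpen_extChartAt_target p
  have hO' : IsOpen (e.target ∩ e.symm ⁻¹' O) :=
    (continuousOn_extChartAt_symm p).isOpen_inter_preimage hT hO
  have hcont : Continuous fun z : EuclideanSpace ℝ (Fin n) ↦ z + z₀ := by fun_prop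
  -- The coefficients read in the chart, translated so that p corresponds to the origin.
  set w : Fin n → ι → ι → EuclideanSpace ℝ (Fin n) → ℝ :=
    fun i a b z ↦ (W i a b ∘ e.symm) (z + z₀) with hw
  have hfd : ∀ z, z + z₀ ∈ e.target ∩ e.symm ⁻¹' O → ∀ i j a b,
      fderiv ℝ (w j a b) z (EuclideanSpace.single i 1) =
        dirDeriv (coordField p i) (W j a b) (e.symm (z + z₀)) := by
    intro z hz i j a b
    rw [hw, fderiv_comp_add_right, fderiv_comp_extChartAt_symm hz.1
      ((hW j a b).contMDiffAt (hO.mem_nhds hz.2))]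
  obtain ⟨δ, hδ, hδO, u, hu0, hus, hu⟩ := exists_solution_of_integrable (w := w)
    (hO'.preimage hcont)
    (by simp [hz₀, e.map_source hep, e.left_inv hep, hp])
    (fun i a b z hz ↦ ContDiffAt.comp z (f := fun z ↦ z + z₀) (g := W i a b ∘ e.symm)
      (contDiffAt_comp_extChartAt_symm hz.1 ((hW i a b).contMDiffAt (hO.mem_nhds hz.2)))
      (contDiffAt_id.add contDiffAt_const))
    (fun z hz i j a b ↦ by
      rw [hfd z hz, hfd z hz]
      exact hint _ hz.2 i j a b) u₀
  have hce : ContinuousOn (fun x ↦ e x - z₀) O := by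
    refine ContinuousOn.sub (f := e) ((continuousOn_extChartAt p).mono fun x hx ↦ ?_)
      continuousOn_const
    rw [extChartAt_source]
    exact hOs hx
  refine ⟨O ∩ (fun x ↦ e x - z₀) ⁻¹' Metric.ball 0 δ,
    hce.isOpen_inter_preimage hO Metric.isOpen_ball, ⟨hp, by simp [hz₀, hδ]⟩,
    inter_subset_left, fun a ↦ (fun z ↦ u (z - z₀) a) ∘ e, fun a ↦ ?_, fun a ↦ ?_,
    fun x hx i a ↦ ?_⟩
  · have h1 : ContDiffOn ℝ ∞ (fun z ↦ u (z - z₀) a) ((fun z ↦ z - z₀) ⁻¹' Metric.ball 0 δ) :=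
      ((contDiffOn_pi.1 hus a).comp (contDiffOn_id.sub contDiffOn_const) fun z hz ↦ hz)
    refine (h1.contMDiffOn).comp ((contMDiffOn_extChartAt (n := ∞)).mono fun x hx ↦ hOs hx.1)
      fun x hx ↦ hx.2
  · simp [hz₀, hu0]
  · have hxs := hOs hx.1
    have hd : DifferentiableAt ℝ (fun z ↦ u (z - z₀) a) (e x) := by
      have := ((contDiffOn_pi.1 hus a).contDiffAt
        (Metric.isOpen_ball.mem_nhds hx.2)).differentiableAt (by simp)
      exact DifferentiableAt.comp (e x) (g := fun z ↦ u z a) (f := fun z ↦ z - z₀) this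
        (differentiableAt_id.sub_const z₀)
    rw [dirDeriv_coordField_comp hxs i hd]
    have := hu (e x - z₀) hx.2 i a
    have hsub := fderiv_comp_sub (𝕜 := ℝ) (f := fun z ↦ u z a) (x := e x) z₀
    rw [hsub, this]
    have hxe : e.symm (e x) = x := e.left_inv (by rwa [he, extChartAt_source])
    simp [hw, hxe]

end CoordinateFields

/-! ### Smooth sections, germs and connections -/

section BundleBasics

set_option linter.unusedSectionVars false

variable {n : ℕ} {M : Type*} [TopologicalSpace M]
  [ChartedSpace (EuclideanSpace ℝ (Fin n)) M] [IsManifold (𝓡 n) ∞ M]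
  {F : Type*} [NormedAddCommGroup F] [NormedSpace ℝ F]
  {V : M → Type*} [TopologicalSpace (TotalSpace F V)]
  [∀ x, AddCommGroup (V x)] [∀ x, Module ℝ (V x)] [∀ x, TopologicalSpace (V x)]
  [∀ x, IsTopologicalAddGroup (V x)] [∀ x, ContinuousSMul ℝ (V x)]
  [FiberBundle F V] [VectorBundle ℝ F V]
  {U : Set M} {x : M}

lemma SmoothSectionOn.contMDiffAt {σ : Π x : M, V x} (h : SmoothSectionOn n F σ U) (hU : IsOpen U)
    (hx : x ∈ U) :
    ContMDiffAt (𝓡 n) ((𝓡 n).prod 𝓘(ℝ, F)) ∞ (fun x ↦ TotalSpace.mk' F x (σ x)) x :=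
  ContMDiffOn.contMDiffAt h (hU.mem_nhds hx)

lemma SmoothSectionOn.mdifferentiableAt {σ : Π x : M, V x} (h : SmoothSectionOn n F σ U)
    (hU : IsOpen U) (hx : x ∈ U) :
    MDifferentiableAt (𝓡 n) ((𝓡 n).prod 𝓘(ℝ, F)) (fun x ↦ TotalSpace.mk' F x (σ x)) x :=
  (h.contMDiffAt hU hx).mdifferentiableAt (by simp)

lemma SmoothSectionOn.congr {σ τ : Π x : M, V x} (h : SmoothSectionOn n F σ U)
    (hστ : ∀ y ∈ U, τ y = σ y) : SmoothSectionOn n F τ U :=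
  ContMDiffOn.congr h fun y hy ↦ by rw [hστ y hy]

lemma SmoothSectionOn.mono {σ : Π x : M, V x} {U' : Set M} (h : SmoothSectionOn n F σ U)
    (hs : U' ⊆ U) : SmoothSectionOn n F σ U' :=
  ContMDiffOn.mono h hs

lemma SmoothVectorFieldOn.toSection {X : Π x : M, TangentSpace (𝓡 n) x}
    (h : SmoothVectorFieldOn X U) :
    SmoothSectionOn n (EuclideanSpace ℝ (Fin n)) X U := h

lemma SmoothVectorFieldOn.mono {X : Π x : M, TangentSpace (𝓡 n) x} {U' : Set M}
    (h : SmoothVectorFieldOn X U) (hs : U' ⊆ U) : SmoothVectorFieldOn X U' :=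
  ContMDiffOn.mono h hs

/-- A real function is smooth iff it is smooth as a section of the trivial line bundle. -/
lemma contMDiffAt_trivial_iff {f : M → ℝ} :
    ContMDiffAt (𝓡 n) ((𝓡 n).prod 𝓘(ℝ, ℝ)) ∞
      (fun y ↦ TotalSpace.mk' ℝ (E := Bundle.Trivial M ℝ) y (f y)) x ↔
      ContMDiffAt (𝓡 n) 𝓘(ℝ, ℝ) ∞ f x :=
  Bundle.contMDiffAt_section (E := Bundle.Trivial M ℝ) x

lemma SmoothDualSectionOn.contMDiffAt_apply {ρ : Π x : M, V x →L[ℝ] ℝ}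
    (h : SmoothDualSectionOn n F ρ U) {η : Π x : M, V x} (hη : SmoothSectionOn n F η U)
    (hU : IsOpen U) (hx : x ∈ U) :
    ContMDiffAt (𝓡 n) 𝓘(ℝ, ℝ) ∞ (fun y ↦ ρ y (η y)) x :=
  contMDiffAt_trivial_iff.1 (ContMDiffAt.clm_bundle_apply (E₂ := Bundle.Trivial M ℝ)
    (ContMDiffOn.contMDiffAt h (hU.mem_nhds hx)) (hη.contMDiffAt hU hx))

lemma SmoothTensor.contMDiffAt_apply {A : Π x : M, TangentSpace (𝓡 n) x →L[ℝ] V x →L[ℝ] ℝ}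
    (h : SmoothTensor F A) {X : Π x : M, TangentSpace (𝓡 n) x} (hX : SmoothVectorFieldOn X U)
    {η : Π x : M, V x} (hη : SmoothSectionOn n F η U) (hU : IsOpen U) (hx : x ∈ U) :
    ContMDiffAt (𝓡 n) 𝓘(ℝ, ℝ) ∞ (fun y ↦ A y (X y) (η y)) x :=
  contMDiffAt_trivial_iff.1 (ContMDiffAt.clm_bundle_apply₂ (E₃ := Bundle.Trivial M ℝ)
    (h x) (hX.toSection.contMDiffAt hU hx) (hη.contMDiffAt hU hx))

lemma SmoothBundleMap.smoothSectionOn_apply {φ : Π x : M, TangentSpace (𝓡 n) x →L[ℝ] V x}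
    (h : SmoothBundleMap F φ) {X : Π x : M, TangentSpace (𝓡 n) x}
    (hX : SmoothVectorFieldOn X U) : SmoothSectionOn n F (fun y ↦ φ y (X y)) U :=
  ContMDiffOn.clm_bundle_apply (b := id) (ContMDiff.contMDiffOn h) hX

lemma SmoothSectionOn.add {σ τ : Π x : M, V x} (hσ : SmoothSectionOn n F σ U)
    (hτ : SmoothSectionOn n F τ U) : SmoothSectionOn n F (σ + τ) U :=
  ContMDiffOn.add_section hσ hτ

lemma SmoothSectionOn.smul {f : M → ℝ} {σ : Π x : M, V x}
    (hf : ∀ x ∈ U, ContMDiffAt (𝓡 n) 𝓘(ℝ, ℝ) ∞ f x) (hσ : SmoothSectionOn n F σ U) :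
    SmoothSectionOn n F (f • σ) U :=
  ContMDiffOn.smul_section (fun x hx ↦ (hf x hx).contMDiffWithinAt) hσ

lemma dirDeriv_mul {X : Π x : M, TangentSpace (𝓡 n) x} {f g : M → ℝ}
    (hf : ContMDiffAt (𝓡 n) 𝓘(ℝ, ℝ) ∞ f x) (hg : ContMDiffAt (𝓡 n) 𝓘(ℝ, ℝ) ∞ g x) :
    dirDeriv X (fun y ↦ f y * g y) x = f x * dirDeriv X g x + g x * dirDeriv X f x := by
  have := mvfderiv_mul (hf.mdifferentiableAt (by simp)) (hg.mdifferentiableAt (by simp))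
  exact congr($this (X x))

lemma SmoothVectorFieldOn.mlieBracket {X Y : Π x : M, TangentSpace (𝓡 n) x}
    (hX : SmoothVectorFieldOn X U) (hY : SmoothVectorFieldOn Y U) (hU : IsOpen U) :
    SmoothVectorFieldOn (VectorField.mlieBracket (𝓡 n) X Y) U := by
  have : IsManifold (𝓡 n) (minSmoothness ℝ 3) M := by
    rw [minSmoothness_of_isRCLikeNormedField]; infer_instance
  have : IsManifold (𝓡 n) (((⊤ : ℕ∞) : WithTop ℕ∞) + 1) M := by
    simpa using (inferInstance : IsManifold (𝓡 n) ∞ M)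
  intro x hx
  exact (ContMDiffAt.mlieBracket_vectorField (m := ⊤) (n := ⊤)
    (hX.toSection.contMDiffAt hU hx) (hY.toSection.contMDiffAt hU hx) (by simp)).contMDiffWithinAt

variable [T2Space M] [ContMDiffVectorBundle ∞ F V (𝓡 n)]

/-- A section that is smooth near a point has the same germ as a globally smooth section. -/
lemma SmoothSectionOn.exists_global {σ : Π x : M, V x} (h : SmoothSectionOn n F σ U)
    (hU : IsOpen U) (hx : x ∈ U) :
    ∃ σ' : Π x : M, V x, SmoothSectionOn n F σ' univ ∧ ∀ᶠ y in 𝓝 x, σ' y = σ y :=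
  exists_cutoff (Filter.eventually_of_mem (hU.mem_nhds hx) fun _ hy ↦ h.contMDiffAt hU hy)

lemma SmoothVectorFieldOn.exists_global {X : Π x : M, TangentSpace (𝓡 n) x}
    (h : SmoothVectorFieldOn X U) (hU : IsOpen U) (hx : x ∈ U) :
    ∃ X' : Π x : M, TangentSpace (𝓡 n) x, SmoothVectorFieldOn X' univ ∧
      ∀ᶠ y in 𝓝 x, X' y = X y :=
  h.toSection.exists_global hU hx

/-- Every vector of the bundle is the value of a globally smooth section. -/
lemma exists_smoothSection_eq (v : V x) :
    ∃ σ : Π x : M, V x, SmoothSectionOn n F σ univ ∧ σ x = v := by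
  obtain ⟨s, hs, hsW⟩ := FiberBundle.exists_contMDiffOn_extend (k := ∞) (𝓡 n) F v
  obtain ⟨σ, h1, h2⟩ := exists_cutoff (n := n) (σ := FiberBundle.extend F v) (x := x) (by
    filter_upwards [eventually_mem_nhds_iff.2 hs] with y hy
    exact hsW.contMDiffAt hy)
  exact ⟨σ, h1, by simpa using h2.self_of_nhds⟩

lemma exists_smoothVectorField_eq (v : TangentSpace (𝓡 n) x) :
    ∃ X : Π x : M, TangentSpace (𝓡 n) x, SmoothVectorFieldOn X univ ∧ X x = v :=
  exists_smoothSection_eq (F := EuclideanSpace ℝ (Fin n)) v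

variable {nabla : (Π x : M, V x) → (Π x : M, TangentSpace (𝓡 n) x →L[ℝ] V x)}

/-- Smoothness of a global connection is a condition on global sections. A local section is replaced
by a global one with the same germ, which does not change its covariant derivative near the point.
-/
lemma IsSmoothConnectionOn.contMDiffAt (hn : IsSmoothConnectionOn F nabla univ) {σ : Π x : M, V x}
    (h : SmoothSectionOn n F σ U) (hU : IsOpen U) (hx : x ∈ U) :
    ContMDiffAt (𝓡 n) ((𝓡 n).prod 𝓘(ℝ, EuclideanSpace ℝ (Fin n) →L[ℝ] F)) ∞
      (fun x ↦ TotalSpace.mk' (EuclideanSpace ℝ (Fin n) →L[ℝ] F)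
        (E := fun y : M ↦ TangentSpace (𝓡 n) y →L[ℝ] V y) x (nabla σ x)) x := by
  obtain ⟨σ', h', he⟩ := h.exists_global hU hx
  have h1 := (hn.smooth.contMDiff (σ := σ') h').contMDiffAt (x := x) Filter.univ_mem
  refine h1.congr_of_eventuallyEq ?_
  filter_upwards [hU.mem_nhds hx, he.eventually_nhds] with y hy hy'
  rw [hn.isCovariantDerivativeOn.congr_of_eventuallyEq (h.mdifferentiableAt hU hy)
    (h'.mdifferentiableAt isOpen_univ (mem_univ y)) Filter.univ_mem (hy'.mono fun _ h ↦ h.symm)]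

lemma IsSmoothConnectionOn.smoothSectionOn (hn : IsSmoothConnectionOn F nabla univ)
    {σ : Π x : M, V x} (h : SmoothSectionOn n F σ U) {X : Π x : M, TangentSpace (𝓡 n) x}
    (hX : SmoothVectorFieldOn X U) (hU : IsOpen U) :
    SmoothSectionOn n F (fun y ↦ nabla σ y (X y)) U := fun _ hx ↦
  (ContMDiffAt.clm_bundle_apply (b := id) (hn.contMDiffAt h hU hx)
    (hX.toSection.contMDiffAt hU hx)).contMDiffWithinAt

/-- The value of a connection at `x` only depends on the germ of the section at `x`. -/
lemma IsSmoothConnectionOn.congr {U' : Set M} (hn : IsSmoothConnectionOn F nabla U')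
    {σ τ : Π x : M, V x} (hσ : SmoothSectionOn n F σ U)
    (hU : IsOpen U) (hx : x ∈ U) (hU' : IsOpen U') (hx' : x ∈ U') (h : ∀ᶠ y in 𝓝 x, τ y = σ y) :
    nabla τ x = nabla σ x := by
  refine hn.isCovariantDerivativeOn.congr_of_eventuallyEq ?_
    (hσ.mdifferentiableAt hU hx) (hU'.mem_nhds hx') h
  refine (hσ.mdifferentiableAt hU hx).congr_of_eventuallyEq ?_
  filter_upwards [h] with y hy
  rw [hy]

/-- Curvature is built from germs, so identities assumed for global fields can be used for local
ones such as coordinate fields and frames. -/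
lemma curvature_eq_of_eventuallyEq (hn : IsSmoothConnectionOn F nabla univ)
    {X Y X' Y' : Π x : M, TangentSpace (𝓡 n) x} {η η' : Π x : M, V x}
    (hX : SmoothVectorFieldOn X U) (hY : SmoothVectorFieldOn Y U) (hη : SmoothSectionOn n F η U)
    (hU : IsOpen U) (hx : x ∈ U) (hXX' : ∀ᶠ y in 𝓝 x, X' y = X y)
    (hYY' : ∀ᶠ y in 𝓝 x, Y' y = Y y) (hηη' : ∀ᶠ y in 𝓝 x, η' y = η y) :
    curvature nabla X' Y' η' x = curvature nabla X Y η x := by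
  have key : ∀ {Z Z' : Π x : M, TangentSpace (𝓡 n) x}, SmoothVectorFieldOn Z U →
      (∀ᶠ y in 𝓝 x, Z' y = Z y) →
      nabla (fun y ↦ nabla η' y (Z' y)) x = nabla (fun y ↦ nabla η y (Z y)) x := by
    intro Z Z' hZ hZZ'
    refine hn.congr (hn.smoothSectionOn hη hZ hU) hU hx isOpen_univ (mem_univ x) ?_
    filter_upwards [hηη'.eventually_nhds, hZZ', hU.mem_nhds hx] with y h1 h2 h3
    rw [hn.congr hη hU h3 isOpen_univ (mem_univ y) h1, h2]
  simp only [curvature, key hX hXX', key hY hYY', hXX'.self_of_nhds, hYY'.self_of_nhds,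
    hn.congr hη hU hx isOpen_univ (mem_univ x) hηη',
    Filter.EventuallyEq.mlieBracket_vectorField_eq hXX' hYY']

lemma RelativelyTorsionFreeOn.restrict {φ : Π x : M, TangentSpace (𝓡 n) x →L[ℝ] V x}
    (h : RelativelyTorsionFreeOn φ nabla univ) (hφ : SmoothBundleMap F φ)
    (hn : IsSmoothConnectionOn F nabla univ) (hU : IsOpen U) :
    RelativelyTorsionFreeOn φ nabla U := by
  intro X Y hX hY x hx
  obtain ⟨X', hX', hXX'⟩ := hX.exists_global hU hx
  obtain ⟨Y', hY', hYY'⟩ := hY.exists_global hU hx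
  have key : ∀ {Z Z' : Π x : M, TangentSpace (𝓡 n) x}, SmoothVectorFieldOn Z U →
      (∀ᶠ y in 𝓝 x, Z' y = Z y) →
      nabla (fun y ↦ φ y (Z' y)) x = nabla (fun y ↦ φ y (Z y)) x := by
    intro Z Z' hZ hZZ'
    refine hn.congr (hφ.smoothSectionOn_apply hZ) hU hx isOpen_univ (mem_univ x) ?_
    filter_upwards [hZZ'] with y hy
    rw [hy]
  have := h X' Y' hX' hY' x (mem_univ x)
  rwa [key hX hXX', key hY hYY', hXX'.self_of_nhds, hYY'.self_of_nhds,
    Filter.EventuallyEq.mlieBracket_vectorField_eq hXX' hYY'] at this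

end BundleBasics

/-! ### Smoothness of bundle maps tested on sections -/

section HomBundle

set_option linter.unusedSectionVars false

variable {n : ℕ} {M : Type*} [TopologicalSpace M]
  [ChartedSpace (EuclideanSpace ℝ (Fin n)) M] [IsManifold (𝓡 n) ∞ M]
  {F : Type*} [NormedAddCommGroup F] [NormedSpace ℝ F]
  {V : M → Type*} [TopologicalSpace (TotalSpace F V)]
  [∀ x, AddCommGroup (V x)] [∀ x, Module ℝ (V x)] [∀ x, TopologicalSpace (V x)]
  [∀ x, IsTopologicalAddGroup (V x)] [∀ x, ContinuousSMul ℝ (V x)]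
  [FiberBundle F V] [VectorBundle ℝ F V]
  {F₂ : Type*} [NormedAddCommGroup F₂] [NormedSpace ℝ F₂]
  {V₂ : M → Type*} [TopologicalSpace (TotalSpace F₂ V₂)]
  [∀ x, AddCommGroup (V₂ x)] [∀ x, Module ℝ (V₂ x)] [∀ x, TopologicalSpace (V₂ x)]
  [∀ x, IsTopologicalAddGroup (V₂ x)] [∀ x, ContinuousSMul ℝ (V₂ x)]
  [FiberBundle F₂ V₂] [VectorBundle ℝ F₂ V₂]
  {U : Set M} {x₀ : M}

/-- A map into a space of linear maps with finite-dimensional source is smooth as soon as its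
evaluations are. -/
lemma contMDiffAt_clm_of_apply [FiniteDimensional ℝ F] {f : M → F →L[ℝ] F₂}
    (h : ∀ v, ContMDiffAt (𝓡 n) 𝓘(ℝ, F₂) ∞ (fun x ↦ f x v) x₀) :
    ContMDiffAt (𝓡 n) 𝓘(ℝ, F →L[ℝ] F₂) ∞ f x₀ := by
  let b := Module.finBasis ℝ F
  have e : f = fun x ↦ ∑ i, ContinuousLinearMap.smulRightL ℝ F F₂
      (LinearMap.toContinuousLinearMap (b.coord i)) (f x (b i)) := by
    ext x v
    have := congrArg (f x) (b.sum_repr v)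
    simp only [map_sum, map_smul] at this
    simp [← this]
  rw [e]
  exact contMDiffAt_finsetSum fun i _ ↦
    (ContinuousLinearMap.smulRightL ℝ F F₂ _).contMDiff.contMDiffAt.comp x₀ (h (b i))

/-- A field of linear maps is smooth as soon as it maps smooth sections to smooth sections. -/
lemma contMDiffAt_hom_of_apply [T2Space M] [ContMDiffVectorBundle ∞ F V (𝓡 n)]
    [FiniteDimensional ℝ F] {Φ : Π x : M, V x →L[ℝ] V₂ x}
    (h : ∀ σ : Π x : M, V x, SmoothSectionOn n F σ univ →
      ContMDiffAt (𝓡 n) ((𝓡 n).prod 𝓘(ℝ, F₂)) ∞ (fun x ↦ TotalSpace.mk' F₂ x (Φ x (σ x))) x₀) :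
    ContMDiffAt (𝓡 n) ((𝓡 n).prod 𝓘(ℝ, F →L[ℝ] F₂)) ∞
      (fun x ↦ TotalSpace.mk' (F →L[ℝ] F₂) (E := fun y : M ↦ V y →L[ℝ] V₂ y) x (Φ x)) x₀ := by
  refine (contMDiffAt_hom_bundle _).2 ⟨contMDiffAt_id, contMDiffAt_clm_of_apply fun v ↦ ?_⟩
  set t := trivializationAt F V x₀
  set t₂ := trivializationAt F₂ V₂ x₀
  have hx : x₀ ∈ t.baseSet := FiberBundle.mem_baseSet_trivializationAt F V x₀
  have hx₂ : x₀ ∈ t₂.baseSet := FiberBundle.mem_baseSet_trivializationAt F₂ V₂ x₀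
  -- The section that is constantly v in the trivialization at x₀. Applying Φ to it gives the
  -- coordinate expression of Φ evaluated at v.
  have hs : SmoothSectionOn n F (fun y ↦ t.symm y v) t.baseSet := by
    refine (t.contMDiffOn_section_baseSet_iff).2 ?_
    refine (contMDiffOn_const (c := v)).congr fun y hy ↦ ?_
    rw [← TotalSpace.mk', t.apply_mk_symm hy]
  obtain ⟨σ, hσ, he⟩ := hs.exists_global t.open_baseSet hx
  refine ((Bundle.contMDiffAt_section x₀).1 (h σ hσ)).congr_of_eventuallyEq ?_
  filter_upwards [he, t.open_baseSet.mem_nhds hx, t₂.open_baseSet.mem_nhds hx₂] with y h1 h2 h3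
  rw [ContinuousLinearMap.inCoordinates_eq h2 h3, h1]
  simp [t, t₂]

end HomBundle

/-! ### Smoothness of dual sections and tensors -/

section TensorSmoothness

variable {n : ℕ} {M : Type*} [TopologicalSpace M] [T2Space M]
  [ChartedSpace (EuclideanSpace ℝ (Fin n)) M] [IsManifold (𝓡 n) ∞ M]
  {F : Type*} [NormedAddCommGroup F] [NormedSpace ℝ F] [FiniteDimensional ℝ F]
  {V : M → Type*} [TopologicalSpace (TotalSpace F V)]
  [∀ x, AddCommGroup (V x)] [∀ x, Module ℝ (V x)] [∀ x, TopologicalSpace (V x)]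
  [∀ x, IsTopologicalAddGroup (V x)] [∀ x, ContinuousSMul ℝ (V x)]
  [FiberBundle F V] [VectorBundle ℝ F V] [ContMDiffVectorBundle ∞ F V (𝓡 n)]
  {U : Set M}

lemma smoothDualSectionOn_of_apply {ρ : Π x : M, V x →L[ℝ] ℝ}
    (h : ∀ η : Π x : M, V x, SmoothSectionOn n F η univ → ∀ x ∈ U,
      ContMDiffAt (𝓡 n) 𝓘(ℝ, ℝ) ∞ (fun y ↦ ρ y (η y)) x) : SmoothDualSectionOn n F ρ U :=
  fun x hx ↦ (contMDiffAt_hom_of_apply (V₂ := Bundle.Trivial M ℝ)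
    fun σ hσ ↦ contMDiffAt_trivial_iff.2 (h σ hσ x hx)).contMDiffWithinAt

/-- The criterion for bundle maps is applied twice: to A as a map from TM to the dual bundle, then
to each A(X, ·). -/
lemma smoothTensor_of_apply {A : Π x : M, TangentSpace (𝓡 n) x →L[ℝ] V x →L[ℝ] ℝ}
    (h : ∀ (X : Π x : M, TangentSpace (𝓡 n) x) (η : Π x : M, V x), SmoothVectorFieldOn X univ →
      SmoothSectionOn n F η univ → ∀ x,
      ContMDiffAt (𝓡 n) 𝓘(ℝ, ℝ) ∞ (fun y ↦ A y (X y) (η y)) x) : SmoothTensor F A :=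
  fun _ ↦ contMDiffAt_hom_of_apply (F := EuclideanSpace ℝ (Fin n))
    (V := fun y : M ↦ TangentSpace (𝓡 n) y)
    (V₂ := fun y : M ↦ V y →L[ℝ] Bundle.Trivial M ℝ y) fun X hX ↦
    contMDiffAt_hom_of_apply (V₂ := Bundle.Trivial M ℝ) fun η hη ↦
      contMDiffAt_trivial_iff.2 (h X η hX hη _)

end TensorSmoothness

/-! ### Curvature and torsion under projective change; the Riccati form -/

section ProjectiveChange

set_option linter.unusedSectionVars false

variable {n : ℕ} {M : Type*} [TopologicalSpace M] [T2Space M]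
  [ChartedSpace (EuclideanSpace ℝ (Fin n)) M] [IsManifold (𝓡 n) ∞ M]
  {F : Type*} [NormedAddCommGroup F] [NormedSpace ℝ F]
  {V : M → Type*} [TopologicalSpace (TotalSpace F V)]
  [∀ x, AddCommGroup (V x)] [∀ x, Module ℝ (V x)] [∀ x, TopologicalSpace (V x)]
  [∀ x, IsTopologicalAddGroup (V x)] [∀ x, ContinuousSMul ℝ (V x)]
  [FiberBundle F V] [VectorBundle ℝ F V] [ContMDiffVectorBundle ∞ F V (𝓡 n)]
  {U : Set M} {x : M}
  {nabla nabla' : (Π x : M, V x) → (Π x : M, TangentSpace (𝓡 n) x →L[ℝ] V x)}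
  {φ : Π x : M, TangentSpace (𝓡 n) x →L[ℝ] V x} {ρ : Π x : M, V x →L[ℝ] ℝ}

/-- The covariant derivative `(∇_X ρ)(η) = X (ρ η) - ρ (∇_X η)` of a section of the dual bundle. -/
noncomputable def dualDeriv
    (nabla : (Π x : M, V x) → (Π x : M, TangentSpace (𝓡 n) x →L[ℝ] V x))
    (ρ : Π x : M, V x →L[ℝ] ℝ) (X : Π x : M, TangentSpace (𝓡 n) x) (η : Π x : M, V x) (x : M) :
    ℝ :=
  dirDeriv X (fun y ↦ ρ y (η y)) x - ρ x (nabla η x (X x))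

/-- The defect `(∇_X ρ)(η) - ρ(φ X) ρ(η)` by which `ρ` fails to satisfy the Riccati equation. -/
noncomputable def riccati
    (nabla : (Π x : M, V x) → (Π x : M, TangentSpace (𝓡 n) x →L[ℝ] V x))
    (φ : Π x : M, TangentSpace (𝓡 n) x →L[ℝ] V x) (ρ : Π x : M, V x →L[ℝ] ℝ)
    (X : Π x : M, TangentSpace (𝓡 n) x) (η : Π x : M, V x) (x : M) : ℝ :=
  dualDeriv nabla ρ X η x - ρ x (φ x (X x)) * ρ x (η x)

/-- The curvature of a projectively changed connection. -/
theorem curvature_projective_change (hU : IsOpen U) (hn : IsSmoothConnectionOn F nabla univ)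
    (hφ : SmoothBundleMap F φ) (ht : RelativelyTorsionFreeOn φ nabla univ)
    (hρ : SmoothDualSectionOn n F ρ U)
    (h : ∀ (X : Π x : M, TangentSpace (𝓡 n) x) (η : Π x : M, V x),
      SmoothVectorFieldOn X U → SmoothSectionOn n F η U →
      ∀ x ∈ U, nabla' η x (X x) =
        nabla η x (X x) + ρ x (φ x (X x)) • η x + ρ x (η x) • φ x (X x))
    {X Y : Π x : M, TangentSpace (𝓡 n) x} {η : Π x : M, V x} (hX : SmoothVectorFieldOn X U)
    (hY : SmoothVectorFieldOn Y U) (hη : SmoothSectionOn n F η U) (hx : x ∈ U) :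
    curvature nabla' X Y η x = curvature nabla X Y η x +
      (riccati nabla φ ρ X (fun y ↦ φ y (Y y)) x -
        riccati nabla φ ρ Y (fun y ↦ φ y (X y)) x) • η x +
      riccati nabla φ ρ X η x • φ x (Y x) - riccati nabla φ ρ Y η x • φ x (X x) := by
  have hc := hn.isCovariantDerivativeOn
  have df : ∀ {g : M → ℝ}, ContMDiffAt (𝓡 n) 𝓘(ℝ, ℝ) ∞ g x →
      MDifferentiableAt (𝓡 n) 𝓘(ℝ, ℝ) g x := fun h ↦ h.mdifferentiableAt (by simp)
  -- The second derivative in full: each of the three terms of the inner derivative is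
  -- differentiated by ∇, and the two correction terms of the outer derivative are added.
  have aux : ∀ {Y Z : Π x : M, TangentSpace (𝓡 n) x}, SmoothVectorFieldOn Y U →
      SmoothVectorFieldOn Z U →
      nabla' (fun y ↦ nabla' η y (Y y)) x (Z x) =
        nabla (fun y ↦ nabla η y (Y y)) x (Z x) +
        (ρ x (φ x (Y x)) • nabla η x (Z x) + dirDeriv Z (fun y ↦ ρ y (φ y (Y y))) x • η x) +
        (ρ x (η x) • nabla (fun y ↦ φ y (Y y)) x (Z x) +
          dirDeriv Z (fun y ↦ ρ y (η y)) x • φ x (Y x)) +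
        ρ x (φ x (Z x)) • (nabla η x (Y x) + ρ x (φ x (Y x)) • η x + ρ x (η x) • φ x (Y x)) +
        ρ x (nabla η x (Y x) + ρ x (φ x (Y x)) • η x + ρ x (η x) • φ x (Y x)) • φ x (Z x) := by
    intro Y Z hY hZ
    have s1 := hn.smoothSectionOn hη hY hU
    have s2 := hφ.smoothSectionOn_apply hY
    have f1 : ∀ y ∈ U, ContMDiffAt (𝓡 n) 𝓘(ℝ, ℝ) ∞ (fun y ↦ ρ y (φ y (Y y))) y :=
      fun y hy ↦ hρ.contMDiffAt_apply s2 hU hy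
    have f2 : ∀ y ∈ U, ContMDiffAt (𝓡 n) 𝓘(ℝ, ℝ) ∞ (fun y ↦ ρ y (η y)) y :=
      fun y hy ↦ hρ.contMDiffAt_apply hη hU hy
    have s3 := SmoothSectionOn.smul f1 hη
    have s4 := SmoothSectionOn.smul f2 s2
    have s5 := (s1.add s3).add s4
    have e : ∀ y ∈ U, nabla' η y (Y y) = ((fun y ↦ nabla η y (Y y)) +
        (fun y ↦ ρ y (φ y (Y y))) • η + (fun y ↦ ρ y (η y)) • fun y ↦ φ y (Y y)) y :=
      fun y hy ↦ h Y η hY hη y hy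
    have s6 : SmoothSectionOn n F (fun y ↦ nabla' η y (Y y)) U := s5.congr e
    rw [h Z _ hZ s6 x hx, hn.congr s5 hU hx isOpen_univ (mem_univ x)
      (Filter.eventually_of_mem (hU.mem_nhds hx) e),
      hc.add ((s1.add s3).mdifferentiableAt hU hx) (s4.mdifferentiableAt hU hx),
      hc.add (s1.mdifferentiableAt hU hx) (s3.mdifferentiableAt hU hx),
      hc.leibniz (hη.mdifferentiableAt hU hx) (df (f1 x hx)),
      hc.leibniz (s2.mdifferentiableAt hU hx) (df (f2 x hx)), h Y η hY hη x hx]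
    rfl
  have ht' := ht.restrict hφ hn hU X Y hX hY x hx
  -- Eliminating ∇_X φ(Y) removes the terms ρ(η)(∇_X φ(Y) - ∇_Y φ(X) - φ[X,Y]), and it rewrites the
  -- coefficient of η as the antisymmetrized Riccati form.
  have ht'' : nabla (fun y ↦ φ y (Y y)) x (X x) = nabla (fun y ↦ φ y (X y)) x (Y x) +
      φ x (VectorField.mlieBracket (𝓡 n) X Y x) := by
    rw [← sub_eq_zero, ← ht']
    abel
  have hb := h _ η (hX.mlieBracket hY hU) hη x hx
  simp only [curvature, aux hY hX, aux hX hY, hb, riccati, dualDeriv, ht'', map_add, map_smul,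
    smul_eq_mul]
  module

/-- A relatively torsion-free connection stays relatively torsion-free under projective change. -/
lemma relativelyTorsionFreeOn_projective_change (hU : IsOpen U)
    (hn : IsSmoothConnectionOn F nabla univ)
    (hφ : SmoothBundleMap F φ) (ht : RelativelyTorsionFreeOn φ nabla univ)
    (h : ∀ (X : Π x : M, TangentSpace (𝓡 n) x) (η : Π x : M, V x),
      SmoothVectorFieldOn X U → SmoothSectionOn n F η U →
      ∀ x ∈ U, nabla' η x (X x) =
        nabla η x (X x) + ρ x (φ x (X x)) • η x + ρ x (η x) • φ x (X x)) :
    RelativelyTorsionFreeOn φ nabla' U := by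
  intro X Y hX hY x hx
  have ht' := ht.restrict hφ hn hU X Y hX hY x hx
  rw [h X _ hX (hφ.smoothSectionOn_apply hY) x hx, h Y _ hY (hφ.smoothSectionOn_apply hX) x hx,
    ← ht']
  abel

variable [FiniteDimensional ℝ F]

lemma riccati_tensorial_left (τ : Π x : M, V x) :
    TensorialAt (𝓡 n) (EuclideanSpace ℝ (Fin n)) (fun X ↦ riccati nabla φ ρ X τ x) x where
  smul _ _ := by simp [riccati, dualDeriv, dirDeriv]; ring
  add _ _ := by simp [riccati, dualDeriv, dirDeriv]; ring

lemma mdifferentiableAt_dual_apply (hU : IsOpen U) (hρ : SmoothDualSectionOn n F ρ U)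
    (hx : x ∈ U) {η : Π x : M, V x}
    (hη : MDifferentiableAt (𝓡 n) ((𝓡 n).prod 𝓘(ℝ, F)) (fun x ↦ TotalSpace.mk' F x (η x)) x) :
    MDifferentiableAt (𝓡 n) 𝓘(ℝ, ℝ) (fun y ↦ ρ y (η y)) x := by
  have h1 := (ContMDiffOn.contMDiffAt hρ (hU.mem_nhds hx)).mdifferentiableAt (by simp)
  have h2 := MDifferentiableAt.clm_bundle_apply (E₂ := Bundle.Trivial M ℝ) h1 hη
  exact ((mdifferentiableAt_totalSpace (𝓡 n) _).1 h2).2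

/-- When η is multiplied by f, the term (Xf)ρ(η) arises both from X(ρ(fη)) and from ρ(∇_X(fη)), and
the two cancel. -/
lemma riccati_tensorial_right (hU : IsOpen U) (hn : IsSmoothConnectionOn F nabla univ)
    (hρ : SmoothDualSectionOn n F ρ U) (hx : x ∈ U) (X : Π x : M, TangentSpace (𝓡 n) x) :
    TensorialAt (𝓡 n) F (fun η ↦ riccati nabla φ ρ X η x) x where
  smul {f σ} hf hσ := by
    have h1 : mvfderiv (𝓡 n) (fun y ↦ ρ y ((f • σ) y)) x = _ :=
      (congrArg (fun g ↦ mvfderiv (𝓡 n) g x) (by ext y; simp)).trans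
        (mvfderiv_mul hf (mdifferentiableAt_dual_apply hU hρ hx hσ))
    simp only [riccati, dualDeriv, dirDeriv, h1, hn.isCovariantDerivativeOn.leibniz hσ hf]
    simp
    ring
  add {σ τ} hσ hτ := by
    have h1 : mvfderiv (𝓡 n) (fun y ↦ ρ y ((σ + τ) y)) x = _ :=
      (congrArg (fun g ↦ mvfderiv (𝓡 n) g x) (by ext y; simp)).trans
        (mvfderiv_add (mdifferentiableAt_dual_apply hU hρ hx hσ)
          (mdifferentiableAt_dual_apply hU hρ hx hτ))
    simp only [riccati, dualDeriv, dirDeriv, h1, hn.isCovariantDerivativeOn.add hσ hτ]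
    simp
    ring

end ProjectiveChange

/-- This is how rank at least three is used: an image of dimension three does not fit into the span
of two vectors. -/
lemma exists_apply_notMem_span {E G : Type*} [AddCommGroup E] [Module ℝ E] [AddCommGroup G]
    [Module ℝ G] {f : E →ₗ[ℝ] G} (h : 3 ≤ Module.finrank ℝ (LinearMap.range f)) (u v : G) :
    ∃ z, f z ∉ Submodule.span ℝ {u, v} := by
  classical
  by_contra! hz
  have h1 : LinearMap.range f ≤ Submodule.span ℝ {u, v} := by
    rintro _ ⟨z, rfl⟩
    exact hz z
  have : Module.Finite ℝ (Submodule.span ℝ {u, v}) := Module.Finite.span_of_finite ℝ (by simp)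
  have h2 := Submodule.finrank_mono h1
  have h3 := finrank_span_finset_le_card (R := ℝ) ({u, v} : Finset G)
  have h4 : ({u, v} : Finset G).card ≤ 2 := Finset.card_le_two
  rw [Finset.coe_pair] at h3
  have := h3.trans h4
  change Module.finrank ℝ (Submodule.span ℝ {u, v}) ≤ 2 at this
  omega

lemma eq_zero_of_smul_add_eq_zero {G : Type*} [AddCommGroup G] [Module ℝ G] {u v w : G}
    (hw : w ∉ Submodule.span ℝ {u, v}) {a b c : ℝ} (h : a • w + b • u + c • v = 0) : a = 0 := by
  by_contra ha
  refine hw (Submodule.mem_span_pair.2 ⟨-(a⁻¹ * b), -(a⁻¹ * c), ?_⟩)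
  have : a⁻¹ • (a • w + b • u + c • v) = 0 := by rw [h, smul_zero]
  rw [smul_add, smul_add, smul_smul, smul_smul, smul_smul, inv_mul_cancel₀ ha, one_smul] at this
  rw [← sub_eq_zero, ← neg_eq_zero, ← this]
  module

/-! ### The second Bianchi identity and the Codazzi equation -/

section Codazzi

set_option linter.unusedSectionVars false

variable {n : ℕ} {M : Type*} [TopologicalSpace M] [T2Space M]
  [ChartedSpace (EuclideanSpace ℝ (Fin n)) M] [IsManifold (𝓡 n) ∞ M]
  {F : Type*} [NormedAddCommGroup F] [NormedSpace ℝ F]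
  {V : M → Type*} [TopologicalSpace (TotalSpace F V)]
  [∀ x, AddCommGroup (V x)] [∀ x, Module ℝ (V x)] [∀ x, TopologicalSpace (V x)]
  [∀ x, IsTopologicalAddGroup (V x)] [∀ x, ContinuousSMul ℝ (V x)]
  [FiberBundle F V] [VectorBundle ℝ F V] [ContMDiffVectorBundle ∞ F V (𝓡 n)]
  {x : M} {nabla : (Π x : M, V x) → (Π x : M, TangentSpace (𝓡 n) x →L[ℝ] V x)}

/-- The complement of a null set is dense. -/
lemma IsNull.dense_compl {S : Set M} (h : IsNull n S) : Dense Sᶜ := by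
  rw [dense_iff_inter_open]
  intro W hW hne
  obtain ⟨p, hp⟩ := hne
  by_contra hemp
  have hsub : W ⊆ S := fun y hy ↦ by_contra fun hyS ↦ hemp ⟨y, hy, hyS⟩
  set e := chartAt (EuclideanSpace ℝ (Fin n)) p
  -- If the complement missed an open set, its chart image would be a nonempty open set of Lebesgue
  -- measure zero.
  have ho : IsOpen (e '' (e.source ∩ W)) :=
    e.isOpen_image_of_subset_source (e.open_source.inter hW) inter_subset_left
  have h0 : MeasureTheory.volume (e '' (e.source ∩ W)) = 0 :=
    MeasureTheory.measure_mono_null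
      (image_mono (show e.source ∩ W ⊆ S ∩ e.source from fun y hy ↦ ⟨hsub hy.2, hy.1⟩))
      (h e (chart_mem_atlas _ p))
  have := (ho.measure_eq_zero_iff MeasureTheory.volume).1 h0
  have hm : e p ∈ e '' (e.source ∩ W) :=
    mem_image_of_mem e (mem_inter (mem_chart_source (EuclideanSpace ℝ (Fin n)) p) hp)
  rw [this] at hm
  exact hm

lemma CoherentTangentBundle.RankAtLeastAE.dense {B : CoherentTangentBundle n F V} {k : ℕ}
    (h : B.RankAtLeastAE k) :
    Dense {x : M | k ≤ Module.finrank ℝ (LinearMap.range (B.φ x).toLinearMap)} := by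
  have := IsNull.dense_compl h
  simpa [compl_ofPred] using this

/-- The rank of φ never exceeds n, and density provides a point where it is at least k as soon as M
has a point. With k = 3 this ensures that n - 1 is invertible. -/
lemma CoherentTangentBundle.RankAtLeastAE.le_dim {B : CoherentTangentBundle n F V} {k : ℕ}
    (h : B.RankAtLeastAE k) (p : M) : k ≤ n := by
  obtain ⟨x, -, hx⟩ := (dense_iff_inter_open.1 h.dense) univ isOpen_univ ⟨p, mem_univ p⟩
  have h1 : k ≤ Module.finrank ℝ (LinearMap.range (B.φ x).toLinearMap) := hx
  have : Module.Finite ℝ (TangentSpace (𝓡 n) x) :=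
    inferInstanceAs (Module.Finite ℝ (EuclideanSpace ℝ (Fin n)))
  have h2 := LinearMap.finrank_range_le (B.φ x).toLinearMap
  have h3 : Module.finrank ℝ (TangentSpace (𝓡 n) x) = n := finrank_euclideanSpace_fin
  omega

lemma IsSmoothConnectionOn.nabla_sub (hn : IsSmoothConnectionOn F nabla univ)
    {σ τ : Π x : M, V x} (hσ : SmoothSectionOn n F σ univ) (hτ : SmoothSectionOn n F τ univ) :
    nabla (fun y ↦ σ y - τ y) x = nabla σ x - nabla τ x := by
  have hc := hn.isCovariantDerivativeOn
  have e : (fun y ↦ σ y - τ y) = σ + (-1 : ℝ) • τ := by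
    ext y
    simp [sub_eq_add_neg]
  have hτ' : SmoothSectionOn n F ((-1 : ℝ) • τ) univ :=
    SmoothSectionOn.smul (f := fun _ ↦ -1) (fun _ _ ↦ contMDiffAt_const) hτ
  rw [e, hc.add (hσ.mdifferentiableAt isOpen_univ (mem_univ x))
    (hτ'.mdifferentiableAt isOpen_univ (mem_univ x)),
    hc.smul_const _ (hτ.mdifferentiableAt isOpen_univ (mem_univ x))]
  simp [sub_eq_add_neg]

lemma IsSmoothConnectionOn.nabla_smul (hn : IsSmoothConnectionOn F nabla univ)
    {f : M → ℝ} {σ : Π x : M, V x} (hf : ContMDiffAt (𝓡 n) 𝓘(ℝ, ℝ) ∞ f x)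
    (hσ : SmoothSectionOn n F σ univ) (X : Π x : M, TangentSpace (𝓡 n) x) :
    nabla (fun y ↦ f y • σ y) x (X x) = f x • nabla σ x (X x) + dirDeriv X f x • σ x := by
  have := hn.isCovariantDerivativeOn.leibniz (hσ.mdifferentiableAt isOpen_univ (mem_univ x))
    (hf.mdifferentiableAt (by simp))
  exact congr($this (X x))

lemma SmoothSectionOn.sub {σ τ : Π x : M, V x} {U : Set M} (hσ : SmoothSectionOn n F σ U)
    (hτ : SmoothSectionOn n F τ U) : SmoothSectionOn n F (fun y ↦ σ y - τ y) U :=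
  ContMDiffOn.sub_section hσ hτ

lemma mlieBracket_jacobi {X Y Z : Π x : M, TangentSpace (𝓡 n) x}
    (hX : SmoothVectorFieldOn X univ) (hY : SmoothVectorFieldOn Y univ)
    (hZ : SmoothVectorFieldOn Z univ) :
    VectorField.mlieBracket (𝓡 n) (VectorField.mlieBracket (𝓡 n) X Y) Z x +
      VectorField.mlieBracket (𝓡 n) (VectorField.mlieBracket (𝓡 n) Y Z) X x +
      VectorField.mlieBracket (𝓡 n) (VectorField.mlieBracket (𝓡 n) Z X) Y x = 0 := by
  have : IsManifold (𝓡 n) (minSmoothness ℝ 3) M := by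
    rw [minSmoothness_of_isRCLikeNormedField]; infer_instance
  have hms : minSmoothness ℝ 2 ≤ (∞ : WithTop ℕ∞) := by
    rw [minSmoothness_of_isRCLikeNormedField]; exact WithTop.coe_le_coe.2 (le_top : (2 : ℕ∞) ≤ ⊤)
  have hs : ∀ {W : Π x : M, TangentSpace (𝓡 n) x}, SmoothVectorFieldOn W univ →
      ContMDiffAt (𝓡 n) (𝓡 n).tangent (minSmoothness ℝ 2)
        (fun x ↦ (⟨x, W x⟩ : TangentBundle (𝓡 n) M)) x := fun h ↦
    (ContMDiffOn.contMDiffAt h Filter.univ_mem).of_le hms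
  have J := VectorField.leibniz_identity_mlieBracket_apply (hs hX) (hs hY) (hs hZ)
  have e1 : VectorField.mlieBracket (𝓡 n) Y (VectorField.mlieBracket (𝓡 n) X Z) x =
      VectorField.mlieBracket (𝓡 n) (VectorField.mlieBracket (𝓡 n) Z X) Y x := by
    rw [VectorField.mlieBracket_swap_apply (V := Y), VectorField.mlieBracket_swap (V := X)]
    have h0 : SmoothVectorFieldOn (VectorField.mlieBracket (𝓡 n) Z X) univ :=
      hZ.mlieBracket hX isOpen_univ
    have := VectorField.mlieBracket_const_smul_left (W := Y) (c := (-1 : ℝ)) (𝕜 := ℝ)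
      (h0.toSection.mdifferentiableAt isOpen_univ (mem_univ x))
    rw [← neg_one_smul ℝ (VectorField.mlieBracket (𝓡 n) Z X), this]
    simp
  rw [VectorField.mlieBracket_swap_apply (V := VectorField.mlieBracket (𝓡 n) Y Z), J, e1]
  abel

/-- The **second Bianchi identity** for a connection on a vector bundle. -/
theorem second_bianchi (hn : IsSmoothConnectionOn F nabla univ)
    {X Y Z : Π x : M, TangentSpace (𝓡 n) x} {η : Π x : M, V x}
    (hX : SmoothVectorFieldOn X univ) (hY : SmoothVectorFieldOn Y univ)
    (hZ : SmoothVectorFieldOn Z univ) (hη : SmoothSectionOn n F η univ) :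
    (nabla (curvature nabla Y Z η) x (X x)
        - curvature nabla Y Z (fun y ↦ nabla η y (X y)) x
        - curvature nabla (VectorField.mlieBracket (𝓡 n) X Y) Z η x) +
      (nabla (curvature nabla Z X η) x (Y x)
        - curvature nabla Z X (fun y ↦ nabla η y (Y y)) x
        - curvature nabla (VectorField.mlieBracket (𝓡 n) Y Z) X η x) +
      (nabla (curvature nabla X Y η) x (Z x)
        - curvature nabla X Y (fun y ↦ nabla η y (Z y)) x
        - curvature nabla (VectorField.mlieBracket (𝓡 n) Z X) Y η x) = 0 := by
  have s : ∀ {W : Π x : M, TangentSpace (𝓡 n) x} {σ : Π x : M, V x},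
      SmoothVectorFieldOn W univ → SmoothSectionOn n F σ univ →
      SmoothSectionOn n F (fun y ↦ nabla σ y (W y)) univ :=
    fun hW hσ ↦ hn.smoothSectionOn hσ hW isOpen_univ
  have key : ∀ {Y Z : Π x : M, TangentSpace (𝓡 n) x}, SmoothVectorFieldOn Y univ →
      SmoothVectorFieldOn Z univ → nabla (curvature nabla Y Z η) x =
        nabla (fun y ↦ nabla (fun y ↦ nabla η y (Z y)) y (Y y)) x -
        nabla (fun y ↦ nabla (fun y ↦ nabla η y (Y y)) y (Z y)) x -
        nabla (fun y ↦ nabla η y (VectorField.mlieBracket (𝓡 n) Y Z y)) x := by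
    intro Y Z hY hZ
    have h1 := s hY (s hZ hη)
    have h2 := s hZ (s hY hη)
    have h3 := s (hY.mlieBracket hZ isOpen_univ) hη
    change nabla (fun y ↦ (nabla (fun y ↦ nabla η y (Z y)) y (Y y) -
      nabla (fun y ↦ nabla η y (Y y)) y (Z y)) -
      nabla η y (VectorField.mlieBracket (𝓡 n) Y Z y)) x = _
    rw [hn.nabla_sub (h1.sub h2) h3, hn.nabla_sub h1 h2]
  -- After expansion the threefold derivatives and the mixed terms containing one bracket cancel in
  -- pairs. What remains is ∇η along the cyclic sum of double brackets, which vanishes by the Jacobi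
  -- identity.
  have J := congrArg (nabla η x) (mlieBracket_jacobi (x := x) hX hY hZ)
  simp only [map_add, map_zero] at J
  simp only [key hX hY, key hY hZ, key hZ hX, sub_apply]
  simp only [curvature]
  rw [← J]
  abel

/-- The defect in the Codazzi equation for `A`. -/
noncomputable def codazziDefect
    (nabla : (Π x : M, V x) → (Π x : M, TangentSpace (𝓡 n) x →L[ℝ] V x))
    (A : Π x : M, TangentSpace (𝓡 n) x →L[ℝ] V x →L[ℝ] ℝ)
    (X Y : Π x : M, TangentSpace (𝓡 n) x) (η : Π x : M, V x) (x : M) : ℝ :=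
  dirDeriv X (fun y ↦ A y (Y y) (η y)) x - dirDeriv Y (fun y ↦ A y (X y) (η y)) x
    - A x (VectorField.mlieBracket (𝓡 n) X Y x) (η x)
    - A x (Y x) (nabla η x (X x)) + A x (X x) (nabla η x (Y x))

variable (B : CoherentTangentBundle n F V)
  {A : Π x : M, TangentSpace (𝓡 n) x →L[ℝ] V x →L[ℝ] ℝ}

/-- The curvature formula is inserted into the second Bianchi identity. Writing φ([X,Y]) as ∇_X φ(Y)
- ∇_Y φ(X) cancels all derivatives of sections φ(·), and the coefficients of φ(X), φ(Y), φ(Z) are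
Codazzi defects. -/
lemma codazziDefect_cyclic_sum (hA : SmoothTensor F A) (hR : B.CurvatureCondition A)
    {X Y Z : Π x : M, TangentSpace (𝓡 n) x} {η : Π x : M, V x}
    (hX : SmoothVectorFieldOn X univ) (hY : SmoothVectorFieldOn Y univ)
    (hZ : SmoothVectorFieldOn Z univ) (hη : SmoothSectionOn n F η univ) :
    (1 / ((n : ℝ) - 1)) • (codazziDefect B.nabla A X Y η x • B.φ x (Z x) +
      codazziDefect B.nabla A Y Z η x • B.φ x (X x) +
      codazziDefect B.nabla A Z X η x • B.φ x (Y x)) = 0 := by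
  have hn := B.connection
  set c : ℝ := 1 / ((n : ℝ) - 1) with hc
  have sφ : ∀ {W : Π x : M, TangentSpace (𝓡 n) x}, SmoothVectorFieldOn W univ →
      SmoothSectionOn n F (fun y ↦ B.φ y (W y)) univ := fun h ↦ B.smooth_φ.smoothSectionOn_apply h
  have sA : ∀ {W : Π x : M, TangentSpace (𝓡 n) x}, SmoothVectorFieldOn W univ → ∀ y ∈ univ,
      ContMDiffAt (𝓡 n) 𝓘(ℝ, ℝ) ∞ (fun y ↦ A y (W y) (η y)) y :=
    fun h y hy ↦ hA.contMDiffAt_apply h hη isOpen_univ hy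
  have s : ∀ {W : Π x : M, TangentSpace (𝓡 n) x}, SmoothVectorFieldOn W univ →
      SmoothSectionOn n F (fun y ↦ B.nabla η y (W y)) univ :=
    fun hW ↦ hn.smoothSectionOn hη hW isOpen_univ
  have key : ∀ {X Y Z : Π x : M, TangentSpace (𝓡 n) x}, SmoothVectorFieldOn X univ →
      SmoothVectorFieldOn Y univ → SmoothVectorFieldOn Z univ →
      B.nabla (curvature B.nabla Y Z η) x (X x) =
        c • ((A x (Z x) (η x) • B.nabla (fun y ↦ B.φ y (Y y)) x (X x) +
          dirDeriv X (fun y ↦ A y (Z y) (η y)) x • B.φ x (Y x)) -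
          (A x (Y x) (η x) • B.nabla (fun y ↦ B.φ y (Z y)) x (X x) +
          dirDeriv X (fun y ↦ A y (Y y) (η y)) x • B.φ x (Z x))) := by
    intro X Y Z hX hY hZ
    have e : curvature B.nabla Y Z η = c • fun y ↦
        (A y (Z y) (η y) • B.φ y (Y y) - A y (Y y) (η y) • B.φ y (Z y)) := by
      ext y
      exact hR Y Z η hY hZ hη y
    have s1 := SmoothSectionOn.smul (sA hZ) (sφ hY)
    have s2 := SmoothSectionOn.smul (sA hY) (sφ hZ)
    have s3 : SmoothSectionOn n F
        (fun y ↦ A y (Z y) (η y) • B.φ y (Y y) - A y (Y y) (η y) • B.φ y (Z y)) univ := s1.sub s2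
    have h3 : B.nabla (fun y ↦ A y (Z y) (η y) • B.φ y (Y y) - A y (Y y) (η y) • B.φ y (Z y)) x =
        B.nabla (fun y ↦ A y (Z y) (η y) • B.φ y (Y y)) x -
          B.nabla (fun y ↦ A y (Y y) (η y) • B.φ y (Z y)) x := hn.nabla_sub s1 s2
    rw [e, hn.isCovariantDerivativeOn.smul_const _ (s3.mdifferentiableAt isOpen_univ (mem_univ x)),
      smul_apply, h3, sub_apply, hn.nabla_smul (sA hZ x (mem_univ x)) (sφ hY),
      hn.nabla_smul (sA hY x (mem_univ x)) (sφ hZ)]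
  have tor : ∀ {X Y : Π x : M, TangentSpace (𝓡 n) x}, SmoothVectorFieldOn X univ →
      SmoothVectorFieldOn Y univ → B.φ x (VectorField.mlieBracket (𝓡 n) X Y x) =
      B.nabla (fun y ↦ B.φ y (Y y)) x (X x) - B.nabla (fun y ↦ B.φ y (X y)) x (Y x) :=
    fun hX hY ↦ (sub_eq_zero.1 (B.torsionFree _ _ hX hY x (mem_univ x))).symm
  have b := second_bianchi (x := x) hn hX hY hZ hη
  rw [key hX hY hZ, key hY hZ hX, key hZ hX hY, hR Y Z _ hY hZ (s hX), hR Z X _ hZ hX (s hY),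
    hR X Y _ hX hY (s hZ), hR _ Z _ (hX.mlieBracket hY isOpen_univ) hZ hη,
    hR _ X _ (hY.mlieBracket hZ isOpen_univ) hX hη,
    hR _ Y _ (hZ.mlieBracket hX isOpen_univ) hY hη, tor hX hY, tor hY hZ, tor hZ hX,
    ← neg_eq_zero] at b
  rw [← b]
  simp only [codazziDefect, ← hc]
  module

/-- At a point of rank at least three, a third field Z with φ(Z) independent of φ(X) and φ(Y)
isolates the defect of X, Y in the cyclic identity. Such points are dense and the defect is
continuous. -/
theorem codazziCondition_of_curvatureCondition (hrank : B.RankAtLeastAE 3) (hA : SmoothTensor F A)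
    (hR : B.CurvatureCondition A) : B.CodazziCondition A := by
  intro X Y η hX hY hη x
  have hn := B.connection
  have hdir : ∀ {W f}, SmoothVectorFieldOn (n := n) (M := M) W univ →
      (∀ x, ContMDiffAt (𝓡 n) 𝓘(ℝ, ℝ) ∞ f x) → Continuous (dirDeriv W f) := fun hW hf ↦
    continuous_iff_continuousAt.2 fun x ↦ (contMDiffAt_dirDeriv (hf x) hW).continuousAt
  have hcA : ∀ {W : Π x : M, TangentSpace (𝓡 n) x} {σ : Π x : M, V x},
      SmoothVectorFieldOn W univ → SmoothSectionOn n F σ univ → ∀ x,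
      ContMDiffAt (𝓡 n) 𝓘(ℝ, ℝ) ∞ (fun y ↦ A y (W y) (σ y)) x :=
    fun hW hσ x ↦ hA.contMDiffAt_apply hW hσ isOpen_univ (mem_univ x)
  have hcont : ∀ {W : Π x : M, TangentSpace (𝓡 n) x} {σ : Π x : M, V x},
      SmoothVectorFieldOn W univ → SmoothSectionOn n F σ univ →
      Continuous (fun y ↦ A y (W y) (σ y)) := fun hW hσ ↦
    continuous_iff_continuousAt.2 fun x ↦ (hcA hW hσ x).continuousAt
  have hC : Continuous (codazziDefect B.nabla A X Y η) :=
    ((((hdir hX (hcA hY hη)).sub (hdir hY (hcA hX hη))).sub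
      (hcont (hX.mlieBracket hY isOpen_univ) hη)).sub
      (hcont hY (hn.smoothSectionOn hη hX isOpen_univ))).add
      (hcont hX (hn.smoothSectionOn hη hY isOpen_univ))
  have h0 : codazziDefect B.nabla A X Y η = fun _ ↦ 0 := by
    refine hC.ext_on hrank.dense continuous_const fun y hy ↦ ?_
    have h3 : 3 ≤ n := hrank.le_dim y
    obtain ⟨z, hz⟩ := exists_apply_notMem_span hy (B.φ y (X y)) (B.φ y (Y y))
    obtain ⟨Z, hZ, rfl⟩ := exists_smoothVectorField_eq z
    refine eq_zero_of_smul_add_eq_zero hz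
      ((smul_eq_zero.1 (codazziDefect_cyclic_sum B hA hR hX hY hZ hη)).resolve_left ?_)
    have : (3 : ℝ) ≤ n := by exact_mod_cast h3
    have : (n : ℝ) - 1 ≠ 0 := by linarith
    positivity
  have := congrFun h0 x
  simp only [codazziDefect] at this
  linarith

end Codazzi

/-! ### From projective flatness to the curvature formula -/

section FlatImpliesTensor

set_option linter.unusedSectionVars false

variable {n : ℕ} {M : Type*} [TopologicalSpace M] [T2Space M]
  [ChartedSpace (EuclideanSpace ℝ (Fin n)) M] [IsManifold (𝓡 n) ∞ M]
  {F : Type*} [NormedAddCommGroup F] [NormedSpace ℝ F] [FiniteDimensional ℝ F]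
  {V : M → Type*} [TopologicalSpace (TotalSpace F V)]
  [∀ x, AddCommGroup (V x)] [∀ x, Module ℝ (V x)] [∀ x, TopologicalSpace (V x)]
  [∀ x, IsTopologicalAddGroup (V x)] [∀ x, ContinuousSMul ℝ (V x)]
  [FiberBundle F V] [VectorBundle ℝ F V] [ContMDiffVectorBundle ∞ F V (𝓡 n)]
  {U : Set M} {x : M}
  {nabla : (Π x : M, V x) → (Π x : M, TangentSpace (𝓡 n) x →L[ℝ] V x)}
  {φ : Π x : M, TangentSpace (𝓡 n) x →L[ℝ] V x} {ρ : Π x : M, V x →L[ℝ] ℝ}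

/-- The Riccati defect of `ρ` is a field of bilinear forms. -/
lemma exists_riccati_form (φ : Π x : M, TangentSpace (𝓡 n) x →L[ℝ] V x) (hU : IsOpen U)
    (hn : IsSmoothConnectionOn F nabla univ) (hρ : SmoothDualSectionOn n F ρ U) :
    ∃ T : Π x : M, TangentSpace (𝓡 n) x →L[ℝ] V x →L[ℝ] ℝ,
      ∀ (X : Π x : M, TangentSpace (𝓡 n) x) (η : Π x : M, V x), ∀ x ∈ U,
        MDifferentiableAt (𝓡 n) (𝓡 n).tangent
          (fun x ↦ (⟨x, X x⟩ : TangentBundle (𝓡 n) M)) x →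
        MDifferentiableAt (𝓡 n) ((𝓡 n).prod 𝓘(ℝ, F)) (fun x ↦ TotalSpace.mk' F x (η x)) x →
        T x (X x) (η x) = riccati nabla φ ρ X η x := by
  classical
  refine ⟨fun x ↦ if hx : x ∈ U then
    TensorialAt.mkHom₂ (I := 𝓡 n) (F := EuclideanSpace ℝ (Fin n)) (F' := F)
      (V := fun y : M ↦ TangentSpace (𝓡 n) y) (V' := V)
      (fun X η ↦ riccati nabla φ ρ X η x) x (fun τ _ ↦ riccati_tensorial_left τ)
      (fun X _ ↦ riccati_tensorial_right hU hn hρ hx X) else 0, fun X η x hx hX hη ↦ ?_⟩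
  simp only [dif_pos hx]
  exact TensorialAt.mkHom₂_apply _ _ hX hη

lemma contMDiffAt_riccati (hU : IsOpen U) (hn : IsSmoothConnectionOn F nabla univ)
    (hφ : SmoothBundleMap F φ) (hρ : SmoothDualSectionOn n F ρ U)
    {X : Π x : M, TangentSpace (𝓡 n) x} {η : Π x : M, V x} (hX : SmoothVectorFieldOn X univ)
    (hη : SmoothSectionOn n F η univ) (hx : x ∈ U) :
    ContMDiffAt (𝓡 n) 𝓘(ℝ, ℝ) ∞ (riccati nabla φ ρ X η) x := by
  have h1 := hρ.contMDiffAt_apply (hη.mono (subset_univ U)) hU hx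
  have h2 := hρ.contMDiffAt_apply ((hn.smoothSectionOn hη hX isOpen_univ).mono (subset_univ U))
    hU hx
  have h3 := hρ.contMDiffAt_apply ((hφ.smoothSectionOn_apply hX).mono (subset_univ U)) hU hx
  exact ((contMDiffAt_dirDeriv h1 hX).sub h2).sub (h3.mul h1)

variable (B : CoherentTangentBundle n F V)

lemma finrank_fibre (x : M) : Module.finrank ℝ (V x) = Module.finrank ℝ F :=
  (VectorBundle.continuousLinearEquivAt ℝ F V x).toLinearEquiv.finrank_eq

/-- A projective change to a flat connection exhibits the curvature in terms of its Riccati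
form, when the curvature is trace-free. -/
lemma curvature_eq_riccati_form (hF : Module.finrank ℝ F = n) (htr : B.CurvatureTraceFree)
    (hU : IsOpen U)
    {nabla' : (Π x : M, V x) → (Π x : M, TangentSpace (𝓡 n) x →L[ℝ] V x)}
    (hflat : FlatOn F nabla' U) (hρ : SmoothDualSectionOn n F ρ U)
    (h : ∀ (X : Π x : M, TangentSpace (𝓡 n) x) (η : Π x : M, V x),
      SmoothVectorFieldOn X U → SmoothSectionOn n F η U →
      ∀ x ∈ U, nabla' η x (X x) =
        B.nabla η x (X x) + ρ x (B.φ x (X x)) • η x + ρ x (η x) • B.φ x (X x))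
    {X Y : Π x : M, TangentSpace (𝓡 n) x} {η : Π x : M, V x} (hX : SmoothVectorFieldOn X univ)
    (hY : SmoothVectorFieldOn Y univ) (hη : SmoothSectionOn n F η univ) (hx : x ∈ U) :
    curvature B.nabla X Y η x = riccati B.nabla B.φ ρ Y η x • B.φ x (X x) -
      riccati B.nabla B.φ ρ X η x • B.φ x (Y x) := by
  obtain ⟨T, hT⟩ := exists_riccati_form B.φ hU B.connection hρ
  have hT' : ∀ {X : Π x : M, TangentSpace (𝓡 n) x} {η : Π x : M, V x},
      SmoothVectorFieldOn X univ → SmoothSectionOn n F η univ →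
      riccati B.nabla B.φ ρ X η x = T x (X x) (η x) := fun hX hη ↦
    (hT _ _ x hx (hX.toSection.mdifferentiableAt isOpen_univ (mem_univ x))
      (hη.mdifferentiableAt isOpen_univ (mem_univ x))).symm
  have hφX := B.smooth_φ.smoothSectionOn_apply hX
  have hφY := B.smooth_φ.smoothSectionOn_apply hY
  set d := T x (X x) (B.φ x (Y x)) - T x (Y x) (B.φ x (X x)) with hd
  have hc : ∀ {η : Π x : M, V x}, SmoothSectionOn n F η univ → curvature B.nabla X Y η x =
      T x (Y x) (η x) • B.φ x (X x) - T x (X x) (η x) • B.φ x (Y x) - d • η x := by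
    intro η hη
    have h1 := curvature_projective_change hU B.connection B.smooth_φ B.torsionFree hρ h
      (hX.mono (subset_univ U)) (hY.mono (subset_univ U)) (hη.mono (subset_univ U)) hx
    rw [hflat X Y η (hX.mono (subset_univ U)) (hY.mono (subset_univ U))
      (hη.mono (subset_univ U)) x hx, hT' hX hη, hT' hY hη, hT' hX hφY, hT' hY hφX, ← hd,
      eq_comm] at h1
    rw [← sub_eq_zero, ← h1]
    abel
  have hend : curvatureEnd F B.nabla X Y x =
      (T x (Y x)).toLinearMap.smulRight (B.φ x (X x)) -
        (T x (X x)).toLinearMap.smulRight (B.φ x (Y x)) - d • LinearMap.id := by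
    ext v
    obtain ⟨η, hη, rfl⟩ := exists_smoothSection_eq (n := n) (F := F) v
    rw [curvatureEnd_apply B.connection hX hY hη, hc hη]
    simp
  have hfin : Module.finrank ℝ (V x) = n := (finrank_fibre x).trans hF
  have hfd : FiniteDimensional ℝ (V x) := VectorBundle.finiteDimensional ℝ F V x
  have htr' := htr X Y hX hY x
  -- The endomorphism v ↦ T(Y,v)φ(X) has trace T(Y,φX), so the total trace is -d - n d = -(n + 1)d.
  rw [hend] at htr'
  simp only [map_sub, map_smul, LinearMap.trace_smulRight, LinearMap.trace_id, hfin] at htr'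
  have hd0 : d = 0 := by
    have : ((n : ℝ) + 1) * d = 0 := by
      rw [← neg_eq_zero, ← htr', hd]
      simp
      ring
    refine (mul_eq_zero.1 this).resolve_left (by positivity)
  rw [hc hη, hd0, hT' hX hη, hT' hY hη]
  simp

/-- Over a set where `φ` has rank at least three on a dense subset, the tensor field by which the
curvature is expressed is unique. -/
lemma curvature_form_unique (hrank : B.RankAtLeastAE 3) (hU : IsOpen U)
    {T T' : Π x : M, TangentSpace (𝓡 n) x →L[ℝ] V x →L[ℝ] ℝ}
    (hs : ∀ (X : Π x : M, TangentSpace (𝓡 n) x) (η : Π x : M, V x), SmoothVectorFieldOn X univ →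
      SmoothSectionOn n F η univ → ContinuousOn (fun y ↦ T y (X y) (η y)) U)
    (hs' : ∀ (X : Π x : M, TangentSpace (𝓡 n) x) (η : Π x : M, V x), SmoothVectorFieldOn X univ →
      SmoothSectionOn n F η univ → ContinuousOn (fun y ↦ T' y (X y) (η y)) U)
    (h : ∀ (X Y : Π x : M, TangentSpace (𝓡 n) x) (η : Π x : M, V x), SmoothVectorFieldOn X univ →
      SmoothVectorFieldOn Y univ → SmoothSectionOn n F η univ → ∀ x ∈ U,
      T x (Y x) (η x) • B.φ x (X x) - T x (X x) (η x) • B.φ x (Y x) =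
        T' x (Y x) (η x) • B.φ x (X x) - T' x (X x) (η x) • B.φ x (Y x)) (hx : x ∈ U) :
    T x = T' x := by
  ext v w
  obtain ⟨Y, hY, rfl⟩ := exists_smoothVectorField_eq v
  obtain ⟨η, hη, rfl⟩ := exists_smoothSection_eq (n := n) (F := F) w
  refine Set.EqOn.of_subset_closure (f := fun y ↦ T y (Y y) (η y))
    (g := fun y ↦ T' y (Y y) (η y)) ?_ (hs Y η hY hη) (hs' Y η hY hη) inter_subset_left
    (hrank.dense.open_subset_closure_inter hU) hx
  rintro y ⟨hyU, hy⟩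
  -- Only independence from φ(Y) is needed here, so the second spanning vector is 0. Comparing
  -- coefficients of φ(X) then gives equality.
  obtain ⟨z, hz⟩ := exists_apply_notMem_span hy (B.φ y (Y y)) 0
  obtain ⟨X, hX, rfl⟩ := exists_smoothVectorField_eq z
  refine sub_eq_zero.1 (eq_zero_of_smul_add_eq_zero hz (b := T' y (X y) (η y) - T y (X y) (η y))
    (c := 0) ?_)
  have := h X Y η hX hY hη y hyU
  rw [← sub_eq_zero] at this
  rw [← this]
  simp only [ContinuousLinearMap.coe_coe]
  module

/-- Each local flat change gives a local Riccati form representing the curvature. Uniqueness makes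
these forms agree on overlaps, although the sections ρ themselves need not agree. -/
theorem exists_tensor_of_projectivelyFlat (hF : Module.finrank ℝ F = n)
    (hrank : B.RankAtLeastAE 3) (htr : B.CurvatureTraceFree) (hflat : B.ProjectivelyFlat) :
    ∃ A : Π x : M, TangentSpace (𝓡 n) x →L[ℝ] V x →L[ℝ] ℝ,
      SmoothTensor F A ∧ B.CurvatureCondition A := by
  choose U hU hpU nabla' _ _ hfl hpe using hflat
  choose ρ hρ h using hpe
  choose T hT using fun p ↦ exists_riccati_form B.φ (hU p) B.connection (hρ p)
  have hT' : ∀ p, ∀ {X : Π x : M, TangentSpace (𝓡 n) x} {η : Π x : M, V x},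
      SmoothVectorFieldOn X univ → SmoothSectionOn n F η univ → ∀ x ∈ U p,
      T p x (X x) (η x) = riccati B.nabla B.φ (ρ p) X η x := fun p _ _ hX hη x hx ↦
    hT p _ _ x hx (hX.toSection.mdifferentiableAt isOpen_univ (mem_univ x))
      (hη.mdifferentiableAt isOpen_univ (mem_univ x))
  have hsm : ∀ p (X : Π x : M, TangentSpace (𝓡 n) x) (η : Π x : M, V x),
      SmoothVectorFieldOn X univ → SmoothSectionOn n F η univ → ∀ x ∈ U p,
      ContMDiffAt (𝓡 n) 𝓘(ℝ, ℝ) ∞ (fun y ↦ T p y (X y) (η y)) x := fun p X η hX hη x hx ↦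
    (contMDiffAt_riccati (hU p) B.connection B.smooth_φ (hρ p) hX hη hx).congr_of_eventuallyEq
      (Filter.eventually_of_mem ((hU p).mem_nhds hx) fun y hy ↦ hT' p hX hη y hy)
  have hR : ∀ p (X Y : Π x : M, TangentSpace (𝓡 n) x) (η : Π x : M, V x),
      SmoothVectorFieldOn X univ → SmoothVectorFieldOn Y univ → SmoothSectionOn n F η univ →
      ∀ x ∈ U p, curvature B.nabla X Y η x =
        T p x (Y x) (η x) • B.φ x (X x) - T p x (X x) (η x) • B.φ x (Y x) := by
    intro p X Y η hX hY hη x hx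
    rw [hT' p hX hη x hx, hT' p hY hη x hx]
    exact curvature_eq_riccati_form B hF htr (hU p) (hfl p) (hρ p) (h p) hX hY hη hx
  have hcont : ∀ p (W : Set M), W ⊆ U p → ∀ (X : Π x : M, TangentSpace (𝓡 n) x)
      (η : Π x : M, V x), SmoothVectorFieldOn X univ → SmoothSectionOn n F η univ →
      ContinuousOn (fun y ↦ T p y (X y) (η y)) W := fun p W hW X η hX hη x hx ↦
    (hsm p X η hX hη x (hW hx)).continuousAt.continuousWithinAt
  have huniq : ∀ p, ∀ x ∈ U p, T x x = T p x := fun p x hx ↦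
    curvature_form_unique B hrank ((hU x).inter (hU p)) (hcont x _ inter_subset_left)
      (hcont p _ inter_subset_right) (fun X Y η hX hY hη y hy ↦ by
        rw [← hR x X Y η hX hY hη y hy.1, hR p X Y η hX hY hη y hy.2]) ⟨hpU x, hx⟩
  -- The value at x is taken from the neighbourhood chosen for x itself. Near p it coincides with
  -- the single form `T p` by `huniq`, hence smoothness.
  refine ⟨fun x ↦ ((n : ℝ) - 1) • T x x, smoothTensor_of_apply fun X η hX hη p ↦ ?_, ?_⟩
  · refine (contMDiffAt_const.mul (hsm p X η hX hη p (hpU p))).congr_of_eventuallyEq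
      (f := fun y ↦ ((n : ℝ) - 1) * T p y (X y) (η y)) ?_
    filter_upwards [(hU p).mem_nhds (hpU p)] with y hy
    simp [huniq p y hy]
  · intro X Y η hX hY hη x
    have h3 : (3 : ℝ) ≤ n := by exact_mod_cast hrank.le_dim x
    have h4 : (n : ℝ) - 1 ≠ 0 := by linarith
    rw [hR x X Y η hX hY hη x (hpU x)]
    simp only [smul_apply, smul_eq_mul, smul_sub, smul_smul]
    field_simp

end FlatImpliesTensor

/-! ### Local frames and localization of the equations -/

section LocalFrames

set_option linter.unusedSectionVars false

variable {n : ℕ} {M : Type*} [TopologicalSpace M] [T2Space M]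
  [ChartedSpace (EuclideanSpace ℝ (Fin n)) M] [IsManifold (𝓡 n) ∞ M]
  {F : Type*} [NormedAddCommGroup F] [NormedSpace ℝ F] [FiniteDimensional ℝ F]
  {V : M → Type*} [TopologicalSpace (TotalSpace F V)]
  [∀ x, AddCommGroup (V x)] [∀ x, Module ℝ (V x)] [∀ x, TopologicalSpace (V x)]
  [∀ x, IsTopologicalAddGroup (V x)] [∀ x, ContinuousSMul ℝ (V x)]
  [FiberBundle F V] [VectorBundle ℝ F V] [ContMDiffVectorBundle ∞ F V (𝓡 n)]
  {U : Set M} {x p : M}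

variable (n F V) in
/-- A local frame of `V` together with its dual coframe. -/
structure DualFrameOn (ι : Type*) [Fintype ι] [DecidableEq ι] (O : Set M) where
  frame : ι → Π x : M, V x
  coframe : ι → Π x : M, V x →L[ℝ] ℝ
  smooth_frame : ∀ a, SmoothSectionOn n F (frame a) O
  smooth_coframe : ∀ a, SmoothDualSectionOn n F (coframe a) O
  sum_coframe_smul : ∀ x ∈ O, ∀ v : V x, ∑ a, coframe a x v • frame a x = v
  coframe_frame : ∀ x ∈ O, ∀ a b, coframe a x (frame b x) = (Pi.single b 1 : ι → ℝ) a

lemma exists_dualFrameOn (p : M) : ∃ (k : ℕ) (O : Set M), IsOpen O ∧ p ∈ O ∧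
    Nonempty (DualFrameOn n F V (Fin k) O) := by
  set e := trivializationAt F V p
  let b := Module.finBasis ℝ F
  have hfd : ∀ x, FiniteDimensional ℝ (V x) := fun x ↦ VectorBundle.finiteDimensional ℝ F V x
  have ht2 : ∀ x, T2Space (V x) := fun x ↦ FiberBundle.t2Space F V x
  have hco : ∀ a (η : Π x : M, V x), SmoothSectionOn n F η univ → ∀ x ∈ e.baseSet,
      ContMDiffAt (𝓡 n) 𝓘(ℝ, ℝ) ∞ (fun y ↦ e.localFrameCoeff (𝓡 n) b a y (η y)) x :=
    fun a η hη x hx ↦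
      contMDiffAt_localFrameCoeff b hx (hη.contMDiffAt isOpen_univ (mem_univ x)) a
  refine ⟨Module.finrank ℝ F, e.baseSet, e.open_baseSet, FiberBundle.mem_baseSet_trivializationAt F V p, ⟨?_⟩⟩
  exact
    { frame := e.localFrame b
      coframe := fun a x ↦ LinearMap.toContinuousLinearMap (e.localFrameCoeff (𝓡 n) b a x)
      smooth_frame := fun a x hx ↦
        (contMDiffAt_localFrame_of_mem ∞ e b a hx).contMDiffWithinAt
      smooth_coframe := fun a ↦ smoothDualSectionOn_of_apply fun η hη x hx ↦ hco a η hη x hx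
      sum_coframe_smul := fun x hx v ↦ by
        obtain ⟨η, -, rfl⟩ := exists_smoothSection_eq (n := n) (F := F) v
        exact (e.eq_sum_localFrameCoeff_smul (I := 𝓡 n) (s := η) (b := b) hx).symm
      coframe_frame := fun x hx i j ↦ by
        have := e.localFrameCoeff_apply_of_mem_baseSet (I := 𝓡 n) b hx (e.localFrame b j) i
        rw [LinearMap.coe_toContinuousLinearMap', this, e.localFrame_apply_of_mem_baseSet b hx,
          Module.Basis.repr_self, Finsupp.single_eq_pi_single] }

lemma DualFrameOn.sum_apply {ι : Type*} [Fintype ι] [DecidableEq ι] {O : Set M} (s : DualFrameOn n F V ι O)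
    (hx : x ∈ O) (l : V x →L[ℝ] ℝ) (v : V x) :
    ∑ a, s.coframe a x v * l (s.frame a x) = l v := by
  conv_rhs => rw [← s.sum_coframe_smul x hx v]
  simp

/-- Covariant differentiation in components with respect to a frame. -/
lemma DualFrameOn.coframe_nabla {ι : Type*} [Fintype ι] [DecidableEq ι] {O : Set M} (s : DualFrameOn n F V ι O)
    (hO : IsOpen O) {nabla : (Π x : M, V x) → (Π x : M, TangentSpace (𝓡 n) x →L[ℝ] V x)}
    (hn : IsSmoothConnectionOn F nabla univ) {σ : Π x : M, V x} (hσ : SmoothSectionOn n F σ O)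
    (hx : x ∈ O) (X : Π x : M, TangentSpace (𝓡 n) x) (b : ι) :
    s.coframe b x (nabla σ x (X x)) = dirDeriv X (fun y ↦ s.coframe b y (σ y)) x +
      ∑ a, s.coframe a x (σ x) * s.coframe b x (nabla (s.frame a) x (X x)) := by
  have hc := hn.isCovariantDerivativeOn
  have hf : ∀ a, ∀ y ∈ O, ContMDiffAt (𝓡 n) 𝓘(ℝ, ℝ) ∞ (fun y ↦ s.coframe a y (σ y)) y :=
    fun a y hy ↦ (s.smooth_coframe a).contMDiffAt_apply hσ hO hy
  -- Additivity of the connection holds for pairs of differentiable sections, so smoothness of the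
  -- partial sums is carried through the induction.
  have hsum : ∀ S : Finset ι,
      SmoothSectionOn n F (∑ a ∈ S, (fun y ↦ s.coframe a y (σ y)) • s.frame a) O ∧
      nabla (∑ a ∈ S, (fun y ↦ s.coframe a y (σ y)) • s.frame a) x (X x) =
        ∑ a ∈ S, (s.coframe a x (σ x) • nabla (s.frame a) x (X x) +
          dirDeriv X (fun y ↦ s.coframe a y (σ y)) x • s.frame a x) := by
    intro S
    induction S using Finset.induction_on with
    | empty =>
      have h0 : SmoothSectionOn n F (0 : Π x, V x) O := fun y _ ↦
        ((contMDiff_zeroSection ℝ V) y).contMDiffWithinAt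
      refine ⟨by simpa using h0, ?_⟩
      have := hc.add (h0.mdifferentiableAt hO hx) (h0.mdifferentiableAt hO hx)
      simp only [add_zero, left_eq_add] at this
      simp [this]
    | insert a S ha ih =>
      simp only [Finset.sum_insert ha]
      have h1 := SmoothSectionOn.smul (hf a) (s.smooth_frame a)
      refine ⟨h1.add ih.1, ?_⟩
      rw [hc.add (h1.mdifferentiableAt hO hx) (ih.1.mdifferentiableAt hO hx), add_apply, ih.2,
        hc.leibniz ((s.smooth_frame a).mdifferentiableAt hO hx)
          ((hf a x hx).mdifferentiableAt (by simp))]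
      rfl
  have e : nabla σ x = nabla (∑ a, (fun y ↦ s.coframe a y (σ y)) • s.frame a) x := by
    refine hn.congr (hsum Finset.univ).1 hO hx isOpen_univ (mem_univ x) ?_
    filter_upwards [hO.mem_nhds hx] with y hy
    simpa using (s.sum_coframe_smul y hy (σ y)).symm
  rw [e, (hsum Finset.univ).2, map_sum, add_comm]
  simp only [map_add, map_smul, smul_eq_mul, s.coframe_frame x hx, Finset.sum_add_distrib]
  congr 1
  simp [Pi.single_apply]

lemma coordField_span (hx : x ∈ (chartAt (EuclideanSpace ℝ (Fin n)) p).source)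
    (v : TangentSpace (𝓡 n) x) : ∃ c : Fin n → ℝ, v = ∑ i, c i • coordField p i x := by
  set e := trivializationAt (EuclideanSpace ℝ (Fin n)) (TangentSpace (𝓡 n)) p
  have hb : x ∈ e.baseSet := by simpa [e] using hx
  let b := e.basisAt (EuclideanSpace.basisFun (Fin n) ℝ).toBasis hb
  refine ⟨b.repr v, ?_⟩
  conv_lhs => rw [← b.sum_repr v]
  refine Finset.sum_congr rfl fun i _ ↦ ?_
  rw [coordField, e.localFrame_apply_of_mem_baseSet _ hb]

/-- A coordinate function has constant derivative along each coordinate field, so the bracket of two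
such fields annihilates every coordinate function. These derivatives are the components of the
bracket. -/
lemma mlieBracket_coordField (hx : x ∈ (chartAt (EuclideanSpace ℝ (Fin n)) p).source)
    (i j : Fin n) :
    VectorField.mlieBracket (𝓡 n) (coordField p i) (coordField p j) x = 0 := by
  set C := (chartAt (EuclideanSpace ℝ (Fin n)) p).source
  have hC : IsOpen C := (chartAt (EuclideanSpace ℝ (Fin n)) p).open_source
  obtain ⟨X, hX, hX'⟩ := (smoothVectorFieldOn_coordField p i).exists_global hC hx
  obtain ⟨Y, hY, hY'⟩ := (smoothVectorFieldOn_coordField p j).exists_global hC hx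
  rw [← Filter.EventuallyEq.mlieBracket_vectorField_eq hX' hY']
  obtain ⟨c, hc⟩ := coordField_span hx (VectorField.mlieBracket (𝓡 n) X Y x)
  suffices ∀ k, c k = 0 by simp [hc, this]
  intro k
  let g : EuclideanSpace ℝ (Fin n) →L[ℝ] ℝ := EuclideanSpace.proj k
  have hd : ∀ y ∈ C, ∀ i, dirDeriv (coordField p i) (g ∘ extChartAt (𝓡 n) p) y =
      (EuclideanSpace.single i (1 : ℝ) : EuclideanSpace ℝ (Fin n)) k := fun y hy i ↦ by
    rw [dirDeriv_coordField_comp hy i g.differentiableAt, g.fderiv]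
    rfl
  have hsm : ∀ᶠ y in 𝓝 x, ContMDiffAt (𝓡 n) 𝓘(ℝ, ℝ) ∞ (g ∘ extChartAt (𝓡 n) p) y := by
    filter_upwards [hC.mem_nhds hx] with y hy
    exact g.contMDiff.contMDiffAt.comp y (contMDiffAt_extChartAt' hy)
  have hcst : ∀ {Z W : Π x : M, TangentSpace (𝓡 n) x} {i}, (∀ᶠ y in 𝓝 x, Z y = coordField p i y) →
      dirDeriv W (dirDeriv Z (g ∘ extChartAt (𝓡 n) p)) x = 0 := by
    intro Z W i hZ
    have : dirDeriv Z (g ∘ extChartAt (𝓡 n) p) =ᶠ[𝓝 x] fun _ ↦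
        (EuclideanSpace.single i (1 : ℝ) : EuclideanSpace ℝ (Fin n)) k := by
      filter_upwards [hZ, hC.mem_nhds hx] with y h1 h2
      rw [← hd y h2 i, dirDeriv, dirDeriv, h1]
    rw [dirDeriv_congr this]
    simp [dirDeriv, mvfderiv_const]
  have hb := bracket_dirDeriv hsm hX hY
  rw [hcst hX', hcst hY', sub_zero, dirDeriv, hc, map_sum] at hb
  have : ∀ i, mvfderiv (𝓡 n) (g ∘ extChartAt (𝓡 n) p) x (c i • coordField p i x) =
      c i * (EuclideanSpace.single i (1 : ℝ) : EuclideanSpace ℝ (Fin n)) k := fun i ↦ by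
    rw [map_smul, ← hd x hx i]
    rfl
  simp only [this] at hb
  simpa [Pi.single_apply] using hb.symm

variable (B : CoherentTangentBundle n F V)
  {A : Π x : M, TangentSpace (𝓡 n) x →L[ℝ] V x →L[ℝ] ℝ}
  {X Y : Π x : M, TangentSpace (𝓡 n) x} {η : Π x : M, V x}

lemma CoherentTangentBundle.CurvatureCondition.local {B : CoherentTangentBundle n F V}
    (hR : B.CurvatureCondition A) (hU : IsOpen U)
    (hX : SmoothVectorFieldOn X U) (hY : SmoothVectorFieldOn Y U) (hη : SmoothSectionOn n F η U)
    (hx : x ∈ U) : curvature B.nabla X Y η x = (1 / ((n : ℝ) - 1)) •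
        (A x (Y x) (η x) • B.φ x (X x) - A x (X x) (η x) • B.φ x (Y x)) := by
  obtain ⟨X', hX', eX⟩ := hX.exists_global hU hx
  obtain ⟨Y', hY', eY⟩ := hY.exists_global hU hx
  obtain ⟨η', hη', eη⟩ := hη.exists_global hU hx
  rw [← curvature_eq_of_eventuallyEq B.connection hX hY hη hU hx eX eY eη,
    hR X' Y' η' hX' hY' hη' x, eX.self_of_nhds, eY.self_of_nhds, eη.self_of_nhds]

lemma CoherentTangentBundle.CodazziCondition.local {B : CoherentTangentBundle n F V}
    (hA : B.CodazziCondition A) (hU : IsOpen U)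
    (hX : SmoothVectorFieldOn X U) (hY : SmoothVectorFieldOn Y U) (hη : SmoothSectionOn n F η U)
    (hx : x ∈ U) :
    dirDeriv X (fun y ↦ A y (Y y) (η y)) x - dirDeriv Y (fun y ↦ A y (X y) (η y)) x
        - A x (VectorField.mlieBracket (𝓡 n) X Y x) (η x) =
      A x (Y x) (B.nabla η x (X x)) - A x (X x) (B.nabla η x (Y x)) := by
  obtain ⟨X', hX', eX⟩ := hX.exists_global hU hx
  obtain ⟨Y', hY', eY⟩ := hY.exists_global hU hx
  obtain ⟨η', hη', eη⟩ := hη.exists_global hU hx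
  have key : ∀ {Z Z' W W' : Π x : M, TangentSpace (𝓡 n) x}, (∀ᶠ y in 𝓝 x, Z' y = Z y) →
      (∀ᶠ y in 𝓝 x, W' y = W y) → dirDeriv Z' (fun y ↦ A y (W' y) (η' y)) x =
        dirDeriv Z (fun y ↦ A y (W y) (η y)) x := by
    intro Z Z' W W' hZ hW
    have : (fun y ↦ A y (W' y) (η' y)) =ᶠ[𝓝 x] fun y ↦ A y (W y) (η y) := by
      filter_upwards [hW, eη] with y h1 h2
      rw [h1, h2]
    rw [dirDeriv_congr this, dirDeriv, dirDeriv, hZ.self_of_nhds]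
  have := hA X' Y' η' hX' hY' hη' x
  rwa [key eX eY, key eY eX, Filter.EventuallyEq.mlieBracket_vectorField_eq eX eY,
    eX.self_of_nhds, eY.self_of_nhds, eη.self_of_nhds,
    B.connection.congr hη hU hx isOpen_univ (mem_univ x) eη] at this

/-- If the curvature is trace-free, the form by which it is expressed is symmetric on the image
of `φ`. -/
lemma CoherentTangentBundle.CurvatureTraceFree.symm {B : CoherentTangentBundle n F V}
    (htr : B.CurvatureTraceFree) (hR : B.CurvatureCondition A) (hn : (n : ℝ) - 1 ≠ 0)
    (v w : TangentSpace (𝓡 n) x) : A x v (B.φ x w) = A x w (B.φ x v) := by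
  obtain ⟨X, hX, rfl⟩ := exists_smoothVectorField_eq v
  obtain ⟨Y, hY, rfl⟩ := exists_smoothVectorField_eq w
  -- The trace of the right-hand side is a nonzero multiple of A(Y,φX) - A(X,φY).
  have hend : curvatureEnd F B.nabla X Y x = (1 / ((n : ℝ) - 1)) •
      ((A x (Y x)).toLinearMap.smulRight (B.φ x (X x)) -
        (A x (X x)).toLinearMap.smulRight (B.φ x (Y x))) := by
    ext v
    obtain ⟨η, hη, rfl⟩ := exists_smoothSection_eq (n := n) (F := F) v
    rw [curvatureEnd_apply B.connection hX hY hη, hR X Y η hX hY hη]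
    simp
  have hfd : FiniteDimensional ℝ (V x) := VectorBundle.finiteDimensional ℝ F V x
  have h := htr X Y hX hY x
  rw [hend, map_smul, map_sub, LinearMap.trace_smulRight, LinearMap.trace_smulRight] at h
  exact (sub_eq_zero.1 ((smul_eq_zero.1 h).resolve_left (one_div_ne_zero hn))).symm

end LocalFrames

/-! ### Linearization and solution of the Riccati equation -/

section TensorImpliesFlat

set_option linter.unusedSectionVars false

variable {n : ℕ} {M : Type*} [TopologicalSpace M] [T2Space M]
  [ChartedSpace (EuclideanSpace ℝ (Fin n)) M] [IsManifold (𝓡 n) ∞ M]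
  {F : Type*} [NormedAddCommGroup F] [NormedSpace ℝ F] [FiniteDimensional ℝ F]
  {V : M → Type*} [TopologicalSpace (TotalSpace F V)]
  [∀ x, AddCommGroup (V x)] [∀ x, Module ℝ (V x)] [∀ x, TopologicalSpace (V x)]
  [∀ x, IsTopologicalAddGroup (V x)] [∀ x, ContinuousSMul ℝ (V x)]
  [FiberBundle F V] [VectorBundle ℝ F V] [ContMDiffVectorBundle ∞ F V (𝓡 n)]
  {U O : Set M} {x p : M}
  {ι : Type*} [Fintype ι] [DecidableEq ι]

/-- The restriction of a frame to a smaller set. -/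
def DualFrameOn.mono (s : DualFrameOn n F V ι O) (h : U ⊆ O) : DualFrameOn n F V ι U where
  frame := s.frame
  coframe := s.coframe
  smooth_frame a := (s.smooth_frame a).mono h
  smooth_coframe a := ContMDiffOn.mono (s.smooth_coframe a) h
  sum_coframe_smul x hx := s.sum_coframe_smul x (h hx)
  coframe_frame x hx := s.coframe_frame x (h hx)

/-- The coefficients, in a frame, of the linear system
`∇_i μ = c f A_i`, `∂_i f = - μ (φ ∂_i)` that linearizes the Riccati equation for `ρ = μ / f`. -/
noncomputable def linearizedCoeff (B : CoherentTangentBundle n F V)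
    (A : Π x : M, TangentSpace (𝓡 n) x →L[ℝ] V x →L[ℝ] ℝ) (s : DualFrameOn n F V ι O)
    (X : Π x : M, TangentSpace (𝓡 n) x) : Option ι → Option ι → M → ℝ
  -- The unknown with index `some a` is μ evaluated on the a-th frame section, and the unknown with
  -- index `none` is f. This entry is the connection term in X(μ(e_a)) = (∇_X μ)(e_a) + μ(∇_X e_a).
  | some a, some b => fun x ↦ s.coframe b x (B.nabla (s.frame a) x (X x))
  | some a, none => fun x ↦ 1 / ((n : ℝ) - 1) * A x (X x) (s.frame a x)
  | none, some b => fun x ↦ -1 * s.coframe b x (B.φ x (X x))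
  | none, none => fun _ ↦ 0

variable {B : CoherentTangentBundle n F V}
  {A : Π x : M, TangentSpace (𝓡 n) x →L[ℝ] V x →L[ℝ] ℝ}
  {X Y : Π x : M, TangentSpace (𝓡 n) x}

lemma contMDiffAt_linearizedCoeff (hO : IsOpen O) (hA : SmoothTensor F A)
    (s : DualFrameOn n F V ι O) (hX : SmoothVectorFieldOn X O) (hx : x ∈ O) (a b : Option ι) :
    ContMDiffAt (𝓡 n) 𝓘(ℝ, ℝ) ∞ (linearizedCoeff B A s X a b) x := by
  rcases a with _ | a <;> rcases b with _ | b
  · exact contMDiffAt_const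
  · exact contMDiffAt_const.mul ((s.smooth_coframe b).contMDiffAt_apply
      (B.smooth_φ.smoothSectionOn_apply hX) hO hx)
  · exact contMDiffAt_const.mul (hA.contMDiffAt_apply hX (s.smooth_frame a) hO hx)
  · exact (s.smooth_coframe b).contMDiffAt_apply
      (B.connection.smoothSectionOn (s.smooth_frame a) hX hO) hO hx

lemma dirDeriv_const_mul {c : ℝ} {f : M → ℝ} (hf : ContMDiffAt (𝓡 n) 𝓘(ℝ, ℝ) ∞ f x) :
    dirDeriv X (fun y ↦ c * f y) x = c * dirDeriv X f x := by
  rw [dirDeriv_mul contMDiffAt_const hf]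
  simp [dirDeriv, mvfderiv_const]

/-- The curvature condition and its consequences make the linearized system integrable. -/
lemma linearizedCoeff_integrable (hO : IsOpen O) (hA : SmoothTensor F A)
    (hR : B.CurvatureCondition A) (hC : B.CodazziCondition A)
    (hsymm : ∀ (x : M) (v w : TangentSpace (𝓡 n) x), A x v (B.φ x w) = A x w (B.φ x v))
    (s : DualFrameOn n F V ι O) (hX : SmoothVectorFieldOn X O) (hY : SmoothVectorFieldOn Y O)
    (hx : x ∈ O) (hXY : VectorField.mlieBracket (𝓡 n) X Y x = 0) (a b : Option ι) :
    dirDeriv X (linearizedCoeff B A s Y a b) x +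
        ∑ c, linearizedCoeff B A s Y a c x * linearizedCoeff B A s X c b x =
      dirDeriv Y (linearizedCoeff B A s X a b) x +
        ∑ c, linearizedCoeff B A s X a c x * linearizedCoeff B A s Y c b x := by
  have hn := B.connection
  rcases a with _ | a <;> rcases b with _ | b
  -- Compatibility of f with itself: symmetry of A(X, φY).
  · have key : ∀ {X Y : Π x : M, TangentSpace (𝓡 n) x},
        dirDeriv X (linearizedCoeff B A s Y none none) x +
        ∑ c, linearizedCoeff B A s Y none c x * linearizedCoeff B A s X c none x =
        -(1 / ((n : ℝ) - 1) * A x (X x) (B.φ x (Y x))) := by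
      intro X Y
      rw [Fintype.sum_option, ← s.sum_apply hx (A x (X x)) (B.φ x (Y x))]
      simp only [linearizedCoeff, Finset.mul_sum, ← Finset.sum_neg_distrib]
      simp only [dirDeriv, mvfderiv_const, mul_zero, zero_add, zero_apply]
      exact Finset.sum_congr rfl fun c _ ↦ by ring
    rw [key, key, hsymm]
  -- Coefficient of μ in the condition for f: relative torsion-freeness for commuting X and Y.
  · have key : ∀ {X Y : Π x : M, TangentSpace (𝓡 n) x}, SmoothVectorFieldOn Y O →
        dirDeriv X (linearizedCoeff B A s Y none (some b)) x +
        ∑ c, linearizedCoeff B A s Y none c x * linearizedCoeff B A s X c (some b) x =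
        -s.coframe b x (B.nabla (fun y ↦ B.φ y (Y y)) x (X x)) := by
      intro X Y hY
      have hφ := B.smooth_φ.smoothSectionOn_apply hY
      rw [Fintype.sum_option, s.coframe_nabla hO hn hφ hx X b]
      simp only [linearizedCoeff]
      rw [dirDeriv_const_mul ((s.smooth_coframe b).contMDiffAt_apply hφ hO hx), zero_mul, zero_add,
        neg_add, ← Finset.sum_neg_distrib, neg_one_mul]
      congr 1
      exact Finset.sum_congr rfl fun c _ ↦ by ring
    have ht := B.torsionFree.restrict B.smooth_φ hn hO X Y hX hY x hx
    rw [hXY, map_zero, sub_zero, sub_eq_zero] at ht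
    rw [key hY, key hX, ht]
  -- Coefficient of f in the condition for μ: the Codazzi equation for commuting X and Y.
  · have key : ∀ {X Y : Π x : M, TangentSpace (𝓡 n) x}, SmoothVectorFieldOn Y O →
        dirDeriv X (linearizedCoeff B A s Y (some a) none) x +
        ∑ c, linearizedCoeff B A s Y (some a) c x * linearizedCoeff B A s X c none x =
        1 / ((n : ℝ) - 1) * (dirDeriv X (fun y ↦ A y (Y y) (s.frame a y)) x +
          A x (X x) (B.nabla (s.frame a) x (Y x))) := by
      intro X Y hY
      rw [Fintype.sum_option, ← s.sum_apply hx (A x (X x)) (B.nabla (s.frame a) x (Y x))]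
      simp only [linearizedCoeff]
      rw [dirDeriv_const_mul (hA.contMDiffAt_apply hY (s.smooth_frame a) hO hx), mul_zero, zero_add,
        mul_add, Finset.mul_sum]
      congr 1
      exact Finset.sum_congr rfl fun c _ ↦ by ring
    have hc := hC.local hO hX hY (s.smooth_frame a) hx
    rw [hXY, map_zero, zero_apply, sub_zero] at hc
    rw [key hY, key hX]
    congr 1
    linarith
  -- Coefficient of μ in the condition for μ: the curvature formula, in components.
  · have key : ∀ {X Y : Π x : M, TangentSpace (𝓡 n) x}, SmoothVectorFieldOn Y O →
        dirDeriv X (linearizedCoeff B A s Y (some a) (some b)) x +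
        ∑ c, linearizedCoeff B A s Y (some a) c x * linearizedCoeff B A s X c (some b) x =
        s.coframe b x (B.nabla (fun y ↦ B.nabla (s.frame a) y (Y y)) x (X x)) -
          1 / ((n : ℝ) - 1) * A x (Y x) (s.frame a x) * s.coframe b x (B.φ x (X x)) := by
      intro X Y hY
      have h1 := hn.smoothSectionOn (s.smooth_frame a) hY hO
      rw [Fintype.sum_option, s.coframe_nabla hO hn h1 hx X b]
      simp only [linearizedCoeff]
      ring
    have hc := congrArg (s.coframe b x) (hR.local hO hX hY (s.smooth_frame a) hx)
    simp only [curvature, hXY, map_zero, sub_zero, map_sub, map_smul, smul_eq_mul] at hc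
    rw [key hY, key hX]
    linarith

/-- The Riccati equation `(∇_X ρ)(η) - ρ(φ X) ρ(η) = c A(X,η)` is locally solvable. -/
lemma exists_riccati_solution (hA : SmoothTensor F A)
    (hR : B.CurvatureCondition A) (hC : B.CodazziCondition A)
    (hsymm : ∀ (x : M) (v w : TangentSpace (𝓡 n) x), A x v (B.φ x w) = A x w (B.φ x v)) (p : M) :
    ∃ U : Set M, IsOpen U ∧ p ∈ U ∧ ∃ ρ : Π x : M, V x →L[ℝ] ℝ, SmoothDualSectionOn n F ρ U ∧
      ∀ (X : Π x : M, TangentSpace (𝓡 n) x) (η : Π x : M, V x), SmoothVectorFieldOn X U →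
        SmoothSectionOn n F η U → ∀ x ∈ U,
        riccati B.nabla B.φ ρ X η x = 1 / ((n : ℝ) - 1) * A x (X x) (η x) := by
  obtain ⟨k, O', hO', hpO', ⟨s'⟩⟩ := exists_dualFrameOn (n := n) (F := F) (V := V) p
  set C := (chartAt (EuclideanSpace ℝ (Fin n)) p).source
  have hCo : IsOpen C := (chartAt (EuclideanSpace ℝ (Fin n)) p).open_source
  set O := O' ∩ C
  have hO : IsOpen O := hO'.inter hCo
  let s : DualFrameOn n F V (Fin k) O := s'.mono inter_subset_left
  have hcf : ∀ i, SmoothVectorFieldOn (coordField p i) O := fun i ↦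
    (smoothVectorFieldOn_coordField p i).mono inter_subset_right
  -- The initial value is μ = 0 and f = 1 at p; only f(p) ≠ 0 matters, as it allows division by f
  -- near p.
  obtain ⟨U₀, hU₀, hpU₀, hU₀O, u, hu, hup, hdu⟩ := exists_coordField_solution hO
    (p := p) ⟨hpO', mem_chart_source _ p⟩ inter_subset_right
    (W := fun i ↦ linearizedCoeff B A s (coordField p i))
    (fun i a b x hx ↦ (contMDiffAt_linearizedCoeff hO hA s (hcf i) hx a b).contMDiffWithinAt)
    (fun x hx i j a b ↦ linearizedCoeff_integrable hO hA hR hC hsymm s (hcf i) (hcf j) hx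
      (mlieBracket_coordField hx.2 i j) a b) (Pi.single none 1)
  have hcu : ∀ a, ∀ x ∈ U₀, ContMDiffAt (𝓡 n) 𝓘(ℝ, ℝ) ∞ (u a) x := fun a x hx ↦
    (hu a).contMDiffAt (hU₀.mem_nhds hx)
  set f := u none
  set U := U₀ ∩ f ⁻¹' {0}ᶜ
  have hU : IsOpen U := (hu none).continuousOn.isOpen_inter_preimage hU₀ isOpen_compl_singleton
  have hUO : U ⊆ O := inter_subset_left.trans hU₀O
  let ρ : Π x : M, V x →L[ℝ] ℝ := fun x ↦ ∑ b, (u (some b) x / f x) • s.coframe b x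
  have hf0 : ∀ x ∈ U, f x ≠ 0 := fun x hx ↦ hx.2
  have hq : ∀ b, ∀ x ∈ U, ContMDiffAt (𝓡 n) 𝓘(ℝ, ℝ) ∞ (fun y ↦ u (some b) y / f y) x :=
    fun b x hx ↦ (hcu _ x hx.1).div₀ (hcu none x hx.1) (hf0 x hx)
  have hρ : SmoothDualSectionOn n F ρ U := by
    refine smoothDualSectionOn_of_apply fun η hη x hx ↦ ?_
    have : (fun y ↦ ρ y (η y)) = fun y ↦ ∑ b, u (some b) y / f y * s.coframe b y (η y) := by
      ext y
      simp [ρ]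
    rw [this]
    exact contMDiffAt_finsetSum fun b _ ↦ (hq b x hx).mul
      ((s.smooth_coframe b).contMDiffAt_apply (hη.mono (subset_univ _)) hO (hUO hx))
  have hρs : ∀ x ∈ U, ∀ a, ρ x (s.frame a x) = u (some a) x / f x := by
    intro x hx a
    simp [ρ, s.coframe_frame x (hUO hx), Pi.single_apply]
  refine ⟨U, hU, ⟨hpU₀, by simp [f, hup none]⟩, ρ, hρ, ?_⟩
  obtain ⟨T, hT⟩ := exists_riccati_form B.φ hU B.connection hρ
  -- Both sides are bilinear in the values of X and η at the point, so it suffices to treat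
  -- coordinate fields and frame sections.
  have hframe : ∀ x ∈ U, ∀ i a, T x (coordField p i x) (s.frame a x) =
      1 / ((n : ℝ) - 1) * A x (coordField p i x) (s.frame a x) := by
    intro x hx i a
    rw [hT _ _ x hx ((hcf i).toSection.mdifferentiableAt hO (hUO hx))
      ((s.smooth_frame a).mdifferentiableAt hO (hUO hx)), riccati, dualDeriv]
    have e1 : (fun y ↦ ρ y (s.frame a y)) =ᶠ[𝓝 x] fun y ↦ u (some a) y / f y :=
      Filter.eventually_of_mem (hU.mem_nhds hx) fun y hy ↦ hρs y hy a
    -- The quotient rule, obtained by differentiating the product f · (μ_a / f).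
    have hqf : dirDeriv (coordField p i) (u (some a)) x =
        f x * dirDeriv (coordField p i) (fun y ↦ u (some a) y / f y) x +
          u (some a) x / f x * dirDeriv (coordField p i) f x := by
      have e2 : u (some a) =ᶠ[𝓝 x] fun y ↦ f y * (u (some a) y / f y) :=
        Filter.eventually_of_mem (hU.mem_nhds hx) fun y hy ↦ by
          have := hf0 y hy
          field_simp
      rw [dirDeriv_congr e2, dirDeriv_mul (hcu none x hx.1) (hq a x hx)]
    have d1 := hdu x hx.1 i (some a)
    have d2 := hdu x hx.1 i none
    rw [Fintype.sum_option] at d1 d2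
    simp only [linearizedCoeff, zero_mul, zero_add] at d1 d2
    rw [dirDeriv_congr e1, hρs x hx a]
    have r1 : ρ x (B.nabla (s.frame a) x (coordField p i x)) * f x =
        ∑ b, s.coframe b x (B.nabla (s.frame a) x (coordField p i x)) * u (some b) x := by
      have := hf0 x hx
      simp only [ρ, sum_apply, smul_apply, smul_eq_mul, Finset.sum_mul]
      exact Finset.sum_congr rfl fun b _ ↦ by field_simp
    have r2 : -(ρ x (B.φ x (coordField p i x)) * f x) =
        ∑ b, -1 * s.coframe b x (B.φ x (coordField p i x)) * u (some b) x := by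
      have := hf0 x hx
      simp only [ρ, sum_apply, smul_apply, smul_eq_mul, Finset.sum_mul, ← Finset.sum_neg_distrib]
      exact Finset.sum_congr rfl fun b _ ↦ by field_simp
    rw [← r2] at d2
    rw [← r1, hqf] at d1
    change dirDeriv (coordField p i) f x = _ at d2
    rw [d2] at d1
    change _ = _ * f x + _ at d1
    have h0 := hf0 x hx
    -- Substituting df = -ρ(φ ·) f produces the quadratic term ρ(φX)ρ(η); the common factor f is
    -- then cancelled.
    refine mul_left_cancel₀ h0 ?_
    linear_combination d1
  intro X η hX hη x hx
  rw [← hT X η x hx (hX.toSection.mdifferentiableAt hU hx) (hη.mdifferentiableAt hU hx)]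
  obtain ⟨c, hc⟩ := coordField_span (hUO hx).2 (X x)
  rw [hc]
  simp only [map_sum, map_smul, sum_apply, smul_apply, smul_eq_mul, Finset.mul_sum]
  refine Finset.sum_congr rfl fun i _ ↦ ?_
  rw [← s.sum_apply (hUO hx) (T x (coordField p i x)) (η x),
    ← s.sum_apply (hUO hx) (A x (coordField p i x)) (η x)]
  simp only [hframe x hx, Finset.mul_sum]
  exact Finset.sum_congr rfl fun a _ ↦ by ring

end TensorImpliesFlat

/-! ### The projectively changed connection and its flatness -/

section ProjectiveChangeConnection

set_option linter.unusedSectionVars false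

variable {n : ℕ} {M : Type*} [TopologicalSpace M] [T2Space M]
  [ChartedSpace (EuclideanSpace ℝ (Fin n)) M] [IsManifold (𝓡 n) ∞ M]
  {F : Type*} [NormedAddCommGroup F] [NormedSpace ℝ F] [FiniteDimensional ℝ F]
  {V : M → Type*} [TopologicalSpace (TotalSpace F V)]
  [∀ x, AddCommGroup (V x)] [∀ x, Module ℝ (V x)] [∀ x, TopologicalSpace (V x)]
  [∀ x, IsTopologicalAddGroup (V x)] [∀ x, ContinuousSMul ℝ (V x)]
  [FiberBundle F V] [VectorBundle ℝ F V] [ContMDiffVectorBundle ∞ F V (𝓡 n)]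
  {U : Set M}

/-- The projective change of a connection by a section `ρ` of the dual bundle. -/
noncomputable def projectiveChange
    (nabla : (Π x : M, V x) → (Π x : M, TangentSpace (𝓡 n) x →L[ℝ] V x))
    (φ : Π x : M, TangentSpace (𝓡 n) x →L[ℝ] V x) (ρ : Π x : M, V x →L[ℝ] ℝ)
    (η : Π x : M, V x) (x : M) : TangentSpace (𝓡 n) x →L[ℝ] V x :=
  nabla η x + ((ρ x).comp (φ x)).smulRight (η x) + ρ x (η x) • φ x

lemma projectiveChange_apply
    (nabla : (Π x : M, V x) → (Π x : M, TangentSpace (𝓡 n) x →L[ℝ] V x))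
    (φ : Π x : M, TangentSpace (𝓡 n) x →L[ℝ] V x) (ρ : Π x : M, V x →L[ℝ] ℝ)
    (η : Π x : M, V x) (x : M) (v : TangentSpace (𝓡 n) x) :
    projectiveChange nabla φ ρ η x v =
      nabla η x v + ρ x (φ x v) • η x + ρ x (η x) • φ x v := rfl

/-- The two added terms are linear over functions in η, so they do not disturb the Leibniz rule of
∇. -/
lemma isSmoothConnectionOn_projectiveChange
    {nabla : (Π x : M, V x) → (Π x : M, TangentSpace (𝓡 n) x →L[ℝ] V x)}
    {φ : Π x : M, TangentSpace (𝓡 n) x →L[ℝ] V x} {ρ : Π x : M, V x →L[ℝ] ℝ}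
    (hU : IsOpen U) (hn : IsSmoothConnectionOn F nabla univ) (hφ : SmoothBundleMap F φ)
    (hρ : SmoothDualSectionOn n F ρ U) :
    IsSmoothConnectionOn F (projectiveChange nabla φ ρ) U where
  isCovariantDerivativeOn :=
    { add := fun {σ τ x} hσ hτ _ ↦ by
        ext v
        simp only [projectiveChange_apply, add_apply, hn.isCovariantDerivativeOn.add hσ hτ,
          Pi.add_apply, map_add]
        module
      leibniz := fun {σ g x} hσ hg _ ↦ by
        ext v
        simp only [projectiveChange_apply, add_apply, smul_apply,
          hn.isCovariantDerivativeOn.leibniz hσ hg, Pi.smul_apply', map_smul, smul_eq_mul]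
        module }
  smooth := ⟨fun {σ} hσ x hx ↦ by
    have hσ' : SmoothSectionOn n F σ U := ContMDiffOn.of_le hσ (by simp)
    refine (contMDiffAt_hom_of_apply (F := EuclideanSpace ℝ (Fin n))
      (V := fun y : M ↦ TangentSpace (𝓡 n) y) fun X hX ↦ ?_).contMDiffWithinAt
    have hX' : SmoothVectorFieldOn X U := SmoothVectorFieldOn.mono hX (subset_univ U)
    have s1 := hn.smoothSectionOn hσ' hX' hU
    have s2 := hφ.smoothSectionOn_apply hX'
    exact ((s1.add (SmoothSectionOn.smul (fun y hy ↦ hρ.contMDiffAt_apply s2 hU hy) hσ')).add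
      (SmoothSectionOn.smul (fun y hy ↦ hρ.contMDiffAt_apply hσ' hU hy) s2)).contMDiffAt hU hx⟩

/-- For a solution ρ of the Riccati equation the form T equals A/(n-1). In the curvature of the
changed connection the terms T(X,η)φ(Y) - T(Y,η)φ(X) then cancel R, and the multiple of the identity
vanishes by the symmetry of A on the image of φ. -/
theorem projectivelyFlat_of_curvatureCondition (B : CoherentTangentBundle n F V)
    (hrank : B.RankAtLeastAE 3) (htr : B.CurvatureTraceFree)
    {A : Π x : M, TangentSpace (𝓡 n) x →L[ℝ] V x →L[ℝ] ℝ}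
    (hA : SmoothTensor F A) (hR : B.CurvatureCondition A) : B.ProjectivelyFlat := by
  intro p
  have h3 : (3 : ℝ) ≤ n := by exact_mod_cast hrank.le_dim p
  have hsymm : ∀ (x : M) (v w : TangentSpace (𝓡 n) x), A x v (B.φ x w) = A x w (B.φ x v) :=
    fun _ ↦ htr.symm hR (by linarith)
  obtain ⟨U, hU, hpU, ρ, hρ, hric⟩ := exists_riccati_solution hA hR
    (codazziCondition_of_curvatureCondition B hrank hA hR) hsymm p
  have h : ∀ (X : Π x : M, TangentSpace (𝓡 n) x) (η : Π x : M, V x),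
      SmoothVectorFieldOn X U → SmoothSectionOn n F η U →
      ∀ x ∈ U, projectiveChange B.nabla B.φ ρ η x (X x) =
        B.nabla η x (X x) + ρ x (B.φ x (X x)) • η x + ρ x (η x) • B.φ x (X x) :=
    fun _ _ _ _ _ _ ↦ rfl
  refine ⟨U, hU, hpU, projectiveChange B.nabla B.φ ρ,
    isSmoothConnectionOn_projectiveChange hU B.connection B.smooth_φ hρ,
    relativelyTorsionFreeOn_projective_change hU B.connection B.smooth_φ B.torsionFree h,
    fun X Y η hX hY hη x hx ↦ ?_, ρ, hρ, h⟩
  rw [curvature_projective_change hU B.connection B.smooth_φ B.torsionFree hρ h hX hY hη hx,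
    hR.local hU hX hY hη hx, hric X _ hX (B.smooth_φ.smoothSectionOn_apply hY) x hx,
    hric Y _ hY (B.smooth_φ.smoothSectionOn_apply hX) x hx, hric X η hX hη x hx,
    hric Y η hY hη x hx, hsymm]
  module

end ProjectiveChangeConnection

end CoherentTB

theorem mainTheorem4 {n : ℕ} {M : Type*} [TopologicalSpace M] [T2Space M]
    [SecondCountableTopology M]
    [ChartedSpace (EuclideanSpace ℝ (Fin n)) M] [IsManifold (𝓡 n) ∞ M]
    {F : Type*} [NormedAddCommGroup F] [NormedSpace ℝ F] [FiniteDimensional ℝ F]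
    (hF : Module.finrank ℝ F = n)
    {V : M → Type*} [TopologicalSpace (TotalSpace F V)]
    [∀ x, AddCommGroup (V x)] [∀ x, Module ℝ (V x)] [∀ x, TopologicalSpace (V x)]
    [∀ x, IsTopologicalAddGroup (V x)] [∀ x, ContinuousSMul ℝ (V x)]
    [FiberBundle F V] [VectorBundle ℝ F V] [ContMDiffVectorBundle ∞ F V (𝓡 n)]
    (B : CoherentTB.CoherentTangentBundle n F V) (hrank : B.RankAtLeastAE 3) :
    (B.CurvatureTraceFree →
      (B.ProjectivelyFlat ↔
        ∃ A : Π x : M, TangentSpace (𝓡 n) x →L[ℝ] V x →L[ℝ] ℝ,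
          CoherentTB.SmoothTensor F A ∧ B.CurvatureCondition A)) ∧
    (∀ A : Π x : M, TangentSpace (𝓡 n) x →L[ℝ] V x →L[ℝ] ℝ,
      CoherentTB.SmoothTensor F A → B.CurvatureCondition A → B.CodazziCondition A) := by
  exact ⟨fun htr ↦ ⟨CoherentTB.exists_tensor_of_projectivelyFlat B hF hrank htr,
    fun ⟨_, hA, hR⟩ ↦ CoherentTB.projectivelyFlat_of_curvatureCondition B hrank htr hA hR⟩,
    fun _ hA hR ↦ CoherentTB.codazziCondition_of_curvatureCondition B hrank hA hR⟩
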